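/- For integers $l\ge 1$ and $s_1,\dots,s_l\ge 1$ define the bracket \[ [s_1,\dots,s_l] := \frac{1}{(s_1-1)!\cdots(s_l-1)!}\sum_{n>0}\Bigg(\sum_{\substack{u_1v_1+\dots+u_lv_l=n\\ u_1>\dots>u_l>0,\ v_1,\dots,v_l>0}} v_1^{s_1-1}\cdots v_l^{s_l-1}\Bigg)q^n\in\mathbb{Q}[[q]], \] of weight $s_1+\dots+s_l$ and length $l$, and put $[\emptyset]:=1$, of weight $0$ and length $0$. Call a bracket admissible if it is $[\emptyset]$ or if $s_1>1$. Let $\mathcal{MD}^{\mathrm a}\subset\mathbb{Q}[[q]]$ be the $\mathbb{Q}$-vector space spanned by the admissible brackets, and let $\operatorname{Fil}^{W,L}_{k,l}(\mathcal{MD}^{\mathrm a})$ be the $\mathbb{Q}$-subspace spanned by the admissible brackets of weight at most $k$ and length at most $l$. Theorem. For all $k,l$ for which the following table has a numerical entry $d$ in row $k$ and column $l$, one has $\dim_{\mathbb{Q}}\operatorname{Fil}^{W,L}_{k,l}(\mathcal{MD}^{\mathrm a})\ge d$. Equality holds for all entries printed in bold, i.e. for all entries with $l\le 2$, all entries with $k\le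 5$, and the entry $(k,l)=(6,3)$. \[ \begin{array}{c|cccccccccccc} k\backslash l&0&1&2&3&4&5&6&7&8&9&10&11\\ \hline 0&\mathbf{1}\\ 1&\mathbf{1}&\mathbf{1}\\ 2&\mathbf{1}&\mathbf{2}&\mathbf{2}\\ 3&\mathbf{1}&\mathbf{3}&\mathbf{4}&\mathbf{4}\\ 4&\mathbf{1}&\mathbf{4}&\mathbf{6}&\mathbf{7}&\mathbf{7}\\ 5&\mathbf{1}&\mathbf{5}&\mathbf{9}&\mathbf{12}&\mathbf{13}&\mathbf{13}\\ 6&\mathbf{1}&\mathbf{6}&\mathbf{12}&\mathbf{18}&22&23&23\\ 7&\mathbf{1}&\mathbf{7}&\mathbf{16}&26&35&40&41&41\\ 8&\mathbf{1}&\mathbf{8}&\mathbf{20}&36&53&66&72&73&73\\ 9&\mathbf{1}&\mathbf{9}&\mathbf{25}&48&76&103&121&128&129&129\\ 10&\mathbf{1}&\mathbf{10}&\mathbf{30}&63&107&155&196&220&228&229&229\\ 11&\mathbf{1}&\mathbf{11}&\mathbf{36}&80&145&225&304&364&395&404&405&405\\ 12&\mathbf{1}&\mathbf{12}&\mathbf{42}&100&193&317&456\\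 13&\mathbf{1}&\mathbf{13}&\mathbf{49}&123&251\\ 14&\mathbf{1}&\mathbf{14}&\mathbf{56}&150&321\\ 15&\mathbf{1}&\mathbf{15}&\mathbf{64}&179 \end{array} \] -/

import Mathlib

open scoped Nat PowerSeries

/-- The multiple divisor sum `σ_{r₁,…,r_l}(n) = ∑ v₁^{r₁} ⋯ v_l^{r_l}`, over all
`u₁ > ⋯ > u_l > 0` and `v₁, …, v_l > 0` with `u₁ v₁ + ⋯ + u_l v_l = n`.
(These conditions force all `u_j, v_j ≤ n`, so the boxes `[1, n]` lose nothing.) -/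
def multipleDivisorSum {l : ℕ} (r : Fin l → ℕ) (n : ℕ) : ℕ :=
  ∑ p ∈ ((Fintype.piFinset fun _ : Fin l => Finset.Icc 1 n) ×ˢ
      (Fintype.piFinset fun _ : Fin l => Finset.Icc 1 n)) with
      (∀ i j : Fin l, i < j → p.1 j < p.1 i) ∧ ∑ i, p.1 i * p.2 i = n,
    ∏ i, p.2 i ^ r i

/-- The bracket `[s₁,…,s_l] = 1/((s₁-1)! ⋯ (s_l-1)!) ∑_{n>0} σ_{s₁-1,…,s_l-1}(n) qⁿ ∈ ℚ⟦q⟧`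
for positive `s₁, …, s_l`. For `l > 0` the constant coefficient vanishes
(`coeff_zero_bracket`), and for `l = 0` this is `[∅] = 1` (`bracket_empty`). -/
noncomputable def bracket {l : ℕ} (s : Fin l → ℕ) : ℚ⟦X⟧ :=
  PowerSeries.mk fun n =>
    (multipleDivisorSum (fun i => s i - 1) n : ℚ) / ((∏ i, (s i - 1)! : ℕ) : ℚ)

theorem coeff_zero_bracket {l : ℕ} (hl : 0 < l) (s : Fin l → ℕ) :
    PowerSeries.coeff 0 (bracket s) = 0 := by
  have : multipleDivisorSum (fun i => s i - 1) 0 = 0 := by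
    unfold multipleDivisorSum
    apply Finset.sum_eq_zero
    intro p hp
    simp only [Finset.mem_filter, Finset.mem_product, Fintype.mem_piFinset,
      Finset.mem_Icc] at hp
    have := hp.1.1 ⟨0, hl⟩
    omega
  simp [bracket, this]

theorem bracket_empty (s : Fin 0 → ℕ) : bracket s = 1 := by
  ext n
  rcases Nat.eq_zero_or_pos n with rfl | hn
  · simp [bracket, multipleDivisorSum]
  · have h : (0 : ℕ) ≠ n := hn.ne
    simp [bracket, multipleDivisorSum, PowerSeries.coeff_one, h, hn.ne']

/-- `Fil^{W,L}_{k,l}(MDA)`: the `ℚ`-span in `ℚ⟦q⟧` of all admissible brackets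
`[s₁,…,s_m]` of weight `s₁ + ⋯ + s_m ≤ k` and length `m ≤ l`. A bracket is admissible if
it is `[∅] = 1` (the case `m = 0`) or if `s₁ > 1`. -/
noncomputable def filMDA (k l : ℕ) : Submodule ℚ ℚ⟦X⟧ :=
  Submodule.span ℚ {f | ∃ (m : ℕ) (s : Fin m → ℕ), m ≤ l ∧ (∀ i, 0 < s i) ∧
    (∀ h : 0 < m, 1 < s ⟨0, h⟩) ∧ ∑ i, s i ≤ k ∧ f = bracket s}

/-- The table: row `k` lists the given numbers for `l = 0, 1, 2, …`. -/
def dimTable : ℕ → List ℕ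
  | 0 => [1]
  | 1 => [1, 1]
  | 2 => [1, 2, 2]
  | 3 => [1, 3, 4, 4]
  | 4 => [1, 4, 6, 7, 7]
  | 5 => [1, 5, 9, 12, 13, 13]
  | 6 => [1, 6, 12, 18, 22, 23, 23]
  | 7 => [1, 7, 16, 26, 35, 40, 41, 41]
  | 8 => [1, 8, 20, 36, 53, 66, 72, 73, 73]
  | 9 => [1, 9, 25, 48, 76, 103, 121, 128, 129, 129]
  | 10 => [1, 10, 30, 63, 107, 155, 196, 220, 228, 229, 229]
  | 11 => [1, 11, 36, 80, 145, 225, 304, 364, 395, 404, 405, 405]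
  | 12 => [1, 12, 42, 100, 193, 317, 456]
  | 13 => [1, 13, 49, 123, 251]
  | 14 => [1, 14, 56, 150, 321]
  | 15 => [1, 15, 64, 179]
  | _ => []

/-- The entries of the table that are exact values (the others are lower bounds). -/
def IsExactEntry (k l : ℕ) : Prop :=
  l ≤ 2 ∨ k ≤ 5 ∨ (k = 6 ∧ l = 3)

/-! Up to the nonzero factorials, a bracket is the generating series of a word of exponents `r i = s
i - 1`; its weight is the sum of the word plus its length, and it is admissible when the word is
empty or its first letter is positive. Both halves of the theorem are statements about these word
series.

Lower bounds. The coefficients are integers, so linear independence modulo one prime gives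
independence over ℚ (`linearIndepOn_rat_of_zmod`). The prime is 31. A sum over decreasing parts
satisfies a recursion on the bound for the largest part (`truncSeries`), which yields the
coefficients modulo `q ^ m` by products with one-part series. A truncated series is packed into one
natural number with 40-bit digits, so that a product of series is a product of numbers
(`packDigits_mul_div`). As 31 = 2^5 - 1, all digits are reduced at once by masks and shifts
(`packDigits_fold`). Gaussian elimination on packed rows is run by a small machine whose program
lists words together with pivot columns; a nonzero pivot at every row proves independence
(`runMachine_correct`, `checkProgram_correct`). Four programs, evaluated in the kernel, supply
enough admissible words for all entries.

Upper bounds. A sum over pairs (u, v) can be expanded by comparing the u's (stuffle), or by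
comparing the v's and changing variables (shuffle). For weights vanishing where the v-comparison
degenerates, the difference is a relation with terms of smaller length on one side
(`series₂_sub_of_diag_eq_zero`, `series₃_sub_of_diag_eq_zero`). In length two, suitable symmetric
polynomials eliminate every word [a, b] with 1 ≤ a ≤ b (`exists_relation_two`). In length three, an
explicit family, corrected by the product of the non-admissible [1] with a length-two relation,
eliminates four words of weight five and six (`relation_three`). At the exact entries the words that
remain are as few as the table says. -/

/-! ### Words of exponents and their generating series -/

/-- The generating series of the multiple divisor sums with exponents `r`. -/
noncomputable def wordSeries (r : List ℕ) : ℚ⟦X⟧ :=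
  PowerSeries.mk fun n => (multipleDivisorSum r.get n : ℚ)

/-- The words of exponents that correspond to admissible brackets of weight at most `k`
and length at most `l`. -/
def admissibleWords (k l : ℕ) : Set (List ℕ) :=
  {r | r.length ≤ l ∧ r.sum + r.length ≤ k ∧ ∀ a ∈ r.head?, 0 < a}

theorem multipleDivisorSum_congr {l m : ℕ} (h : l = m) {r : Fin l → ℕ} {t : Fin m → ℕ}
    (hrt : ∀ i, r i = t (Fin.cast h i)) (n : ℕ) :
    multipleDivisorSum r n = multipleDivisorSum t n := by
  subst h
  congr 1
  funext i
  exact hrt i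

theorem bracket_eq_smul_wordSeries {l : ℕ} (s : Fin l → ℕ) :
    bracket s = ((∏ i, (s i - 1)! : ℕ) : ℚ)⁻¹ • wordSeries (List.ofFn fun i => s i - 1) := by
  ext n
  simp only [bracket, wordSeries, PowerSeries.coeff_mk, map_smul, smul_eq_mul]
  rw [div_eq_inv_mul]
  congr 2
  exact multipleDivisorSum_congr (by simp) (fun i => by simp) n

theorem wordSeries_mem_filMDA {k l : ℕ} {r : List ℕ} (hr : r ∈ admissibleWords k l) :
    wordSeries r ∈ filMDA k l := by
  obtain ⟨h1, h2, h3⟩ := hr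
  have key := bracket_eq_smul_wordSeries (fun i : Fin r.length => r.get i + 1)
  simp only [Nat.add_sub_cancel] at key
  have hne : ((∏ i : Fin r.length, (r.get i)! : ℕ) : ℚ) ≠ 0 := by
    exact_mod_cast Finset.prod_ne_zero_iff.mpr fun i _ => (r.get i).factorial_ne_zero
  have hof : List.ofFn (fun i : Fin r.length => r.get i) = r := List.ofFn_get r
  rw [hof] at key
  have : wordSeries r = ((∏ i : Fin r.length, (r.get i)! : ℕ) : ℚ) •
      bracket (fun i : Fin r.length => r.get i + 1) := by
    rw [key, smul_inv_smul₀ hne]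
  rw [this]
  refine Submodule.smul_mem _ _ (Submodule.subset_span
    ⟨r.length, _, h1, fun _ => Nat.succ_pos _, ?_, ?_, rfl⟩)
  · intro h
    cases r with
    | nil => simp at h
    | cons a t => simpa using h3 a (by simp)
  · change ∑ i : Fin r.length, (r.get i + 1) ≤ k
    rw [Finset.sum_add_distrib]
    have : ∑ i : Fin r.length, r.get i = r.sum := by
      conv_rhs => rw [← hof]
      rw [List.sum_ofFn]
    simp only [this]
    simpa using h2

/-- The factorials are nonzero scalars, so they may be dropped from the generators of the span. -/
theorem filMDA_eq_span (k l : ℕ) :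
    filMDA k l = Submodule.span ℚ (wordSeries '' admissibleWords k l) := by
  apply le_antisymm
  · refine Submodule.span_le.mpr ?_
    rintro f ⟨m, s, hm, hpos, hadm, hsum, rfl⟩
    rw [bracket_eq_smul_wordSeries]
    refine Submodule.smul_mem _ _ (Submodule.subset_span ⟨_, ⟨by simpa using hm, ?_, ?_⟩, rfl⟩)
    · rw [List.sum_ofFn, List.length_ofFn]
      have : ∑ i, s i = ∑ i, (s i - 1) + m := by
        have h1 : ∑ i, s i = ∑ i, ((s i - 1) + 1) :=
          Finset.sum_congr rfl fun i _ => (Nat.sub_add_cancel (hpos i)).symm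
        rw [h1, Finset.sum_add_distrib]
        simp
      omega
    · intro a ha
      cases m with
      | zero => simp at ha
      | succ m =>
        simp only [List.ofFn_succ, List.head?_cons, Option.mem_def, Option.some.injEq] at ha
        have := hadm (Nat.succ_pos m)
        have e : (⟨0, Nat.succ_pos m⟩ : Fin (m + 1)) = 0 := rfl
        rw [e] at this
        omega
  · refine Submodule.span_le.mpr ?_
    rintro _ ⟨r, hr, rfl⟩
    exact wordSeries_mem_filMDA hr

theorem finite_admissibleWords (k l : ℕ) : (admissibleWords k l).Finite := by
  refine Set.Finite.subset (List.finite_length_le (Fin (k + 1)) k |>.image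
    (List.map fun i : Fin (k + 1) => (i : ℕ))) ?_
  rintro r ⟨_, h2, _⟩
  have hle : ∀ a ∈ r, a < k + 1 := fun a ha => by
    have := List.le_sum_of_mem ha
    omega
  refine ⟨r.pmap (fun a (h : a < k + 1) => ⟨a, h⟩) hle, ?_, ?_⟩
  · simp only [Set.mem_ofPred_eq, List.length_pmap]
    omega
  · rw [List.map_pmap]
    simp

instance finiteDimensional_filMDA (k l : ℕ) : FiniteDimensional ℚ (filMDA k l) := by
  rw [filMDA_eq_span]
  exact FiniteDimensional.span_of_finite ℚ ((finite_admissibleWords k l).image _)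

/-- Independent word series bound the dimension from below. -/
theorem card_le_finrank_filMDA {k l : ℕ} (W : Finset (List ℕ))
    (hW : LinearIndepOn ℚ wordSeries (W : Set (List ℕ)))
    (hadm : ∀ r ∈ W, r ∈ admissibleWords k l) :
    W.card ≤ Module.finrank ℚ (filMDA k l) := by
  have h1 : LinearIndependent ℚ (fun r : (W : Set (List ℕ)) =>
      (⟨wordSeries r, wordSeries_mem_filMDA (hadm r r.2)⟩ : filMDA k l)) := by
    rw [← LinearMap.linearIndependent_iff (filMDA k l).subtype (by simp)]
    exact hW
  simpa using h1.fintype_card_le_finrank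

/-- A spanning set bounds the dimension from above. -/
theorem finrank_filMDA_le_card {k l : ℕ} (W : Finset (List ℕ))
    (hW : ∀ r ∈ admissibleWords k l, wordSeries r ∈ Submodule.span ℚ (wordSeries '' W)) :
    Module.finrank ℚ (filMDA k l) ≤ W.card := by
  classical
  have h1 : filMDA k l ≤ Submodule.span ℚ ((W.image wordSeries : Finset ℚ⟦X⟧) : Set ℚ⟦X⟧) := by
    rw [filMDA_eq_span, Finset.coe_image]
    refine Submodule.span_le.mpr ?_
    rintro _ ⟨r, hr, rfl⟩
    exact hW r hr
  have : FiniteDimensional ℚ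
      (Submodule.span ℚ ((W.image wordSeries : Finset ℚ⟦X⟧) : Set ℚ⟦X⟧)) :=
    FiniteDimensional.span_finset ℚ _
  exact (Submodule.finrank_mono h1).trans
    ((finrank_span_finset_le_card _).trans Finset.card_image_le)

/-! ### The recursion over the largest part -/

/-- The generating series `∑_{v > 0} v^r q^{uv}` of a single part `u`. -/
noncomputable def letterSeries (r u : ℕ) : ℤ⟦X⟧ :=
  PowerSeries.mk fun n => if 0 < n ∧ u ∣ n then ((n / u : ℕ) : ℤ) ^ r else 0

/-- The generating series of the multiple divisor sums with exponents `r`, restricted to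
parts of size at most `U`. -/
noncomputable def truncSeries : ℕ → List ℕ → ℤ⟦X⟧
  | _, [] => 1
  | 0, _ :: _ => 0
  | U + 1, r :: w => truncSeries U (r :: w) + letterSeries r (U + 1) * truncSeries U w

@[simp] theorem truncSeries_nil (U : ℕ) : truncSeries U [] = 1 := by
  cases U <;> rfl

theorem X_pow_dvd_letterSeries (r u : ℕ) : (PowerSeries.X : ℤ⟦X⟧) ^ u ∣ letterSeries r u := by
  rw [PowerSeries.X_pow_dvd_iff]
  intro m hm
  rw [letterSeries, PowerSeries.coeff_mk, if_neg]
  rintro ⟨h1, h2⟩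
  exact absurd (Nat.le_of_dvd h1 h2) (by omega)

/-- A sequence using a part larger than `U` has total at least `U + 1`, so the coefficients up to `q
^ U` are already stable. -/
theorem X_pow_dvd_truncSeries_sub (r : ℕ) (w : List ℕ) {U V : ℕ} (h : U ≤ V) :
    (PowerSeries.X : ℤ⟦X⟧) ^ (U + 1) ∣ truncSeries V (r :: w) - truncSeries U (r :: w) := by
  induction V, h using Nat.le_induction with
  | base => simp
  | succ V hV ih =>
    have : truncSeries (V + 1) (r :: w) - truncSeries U (r :: w) =
        (truncSeries V (r :: w) - truncSeries U (r :: w)) +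
          letterSeries r (V + 1) * truncSeries V w := by
      rw [truncSeries]; ring
    rw [this]
    refine dvd_add ih (Dvd.dvd.mul_right ?_ _)
    exact (pow_dvd_pow _ (by omega)).trans (X_pow_dvd_letterSeries r (V + 1))

theorem coeff_truncSeries_eq (r : ℕ) (w : List ℕ) {n U V : ℕ} (hU : n ≤ U) (hV : n ≤ V) :
    PowerSeries.coeff n (truncSeries U (r :: w)) =
      PowerSeries.coeff n (truncSeries V (r :: w)) := by
  wlog h : U ≤ V generalizing U V
  · exact (this hV hU (by omega)).symm
  have := PowerSeries.X_pow_dvd_iff.mp (X_pow_dvd_truncSeries_sub r w h) n (by omega)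
  rw [map_sub, sub_eq_zero] at this
  exact this.symm

/-- The strictly decreasing sequences of length `l` of parts in `[1, U]`. -/
def decreasingParts (U l : ℕ) : Finset (Fin l → ℕ) :=
  {u ∈ Fintype.piFinset fun _ : Fin l => Finset.Icc 1 U | ∀ i j : Fin l, i < j → u j < u i}

theorem mem_decreasingParts {U l : ℕ} {u : Fin l → ℕ} :
    u ∈ decreasingParts U l ↔
      (∀ i, 1 ≤ u i ∧ u i ≤ U) ∧ ∀ i j : Fin l, i < j → u j < u i := by
  simp [decreasingParts]

/-- The largest part `u 0` is either at most `U` or equal to `U + 1`; in the second case the tail is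
a decreasing sequence below it. This is the combinatorial form of the recursion for `truncSeries`.
-/
theorem sum_decreasingParts_succ {M : Type*} [AddCommMonoid M] (U l : ℕ)
    (F : (Fin (l + 1) → ℕ) → M) :
    ∑ u ∈ decreasingParts (U + 1) (l + 1), F u =
      ∑ u ∈ decreasingParts U (l + 1), F u +
        ∑ u ∈ decreasingParts U l, F (Fin.cons (U + 1) u) := by
  rw [← Finset.sum_filter_add_sum_filter_not _ (fun u => u 0 ≤ U)]
  congr 1
  · refine Finset.sum_congr ?_ fun _ _ => rfl
    ext u
    simp only [Finset.mem_filter, mem_decreasingParts]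
    constructor
    · rintro ⟨⟨h1, h2⟩, h3⟩
      refine ⟨fun i => ⟨(h1 i).1, ?_⟩, h2⟩
      rcases Fin.eq_zero_or_eq_succ i with rfl | ⟨j, rfl⟩
      · exact h3
      · exact (h2 0 j.succ j.succ_pos).le.trans h3
    · rintro ⟨h1, h2⟩
      exact ⟨⟨fun i => ⟨(h1 i).1, (h1 i).2.trans (Nat.le_succ _)⟩, h2⟩, (h1 0).2⟩
  · refine Finset.sum_nbij' (fun u => Fin.tail u) (fun u => Fin.cons (U + 1) u) ?_ ?_ ?_ ?_ ?_
    · intro u hu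
      simp only [Finset.mem_filter, mem_decreasingParts] at hu
      obtain ⟨⟨h1, h2⟩, h3⟩ := hu
      rw [mem_decreasingParts]
      have h0 := (h1 0).2
      refine ⟨fun i => ⟨(h1 i.succ).1, ?_⟩, fun i j hij => h2 i.succ j.succ (by simpa using hij)⟩
      have := h2 0 i.succ i.succ_pos
      change u i.succ ≤ U
      omega
    · intro u hu
      rw [mem_decreasingParts] at hu
      simp only [Finset.mem_filter, mem_decreasingParts, Fin.cons_zero]
      refine ⟨⟨fun i => ?_, fun i j hij => ?_⟩, by omega⟩
      · rcases Fin.eq_zero_or_eq_succ i with rfl | ⟨j, rfl⟩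
        · simp
        · have := hu.1 j
          simp only [Fin.cons_succ]
          omega
      · rcases Fin.eq_zero_or_eq_succ i with rfl | ⟨a, rfl⟩ <;>
          rcases Fin.eq_zero_or_eq_succ j with rfl | ⟨b, rfl⟩
        · exact absurd hij (lt_irrefl _)
        · have := hu.1 b
          simp only [Fin.cons_succ, Fin.cons_zero]
          omega
        · exact absurd hij (by simp)
        · simpa using hu.2 a b (by simpa using hij)
    · intro u hu
      simp only [Finset.mem_filter, mem_decreasingParts] at hu
      have : u 0 = U + 1 := by have := hu.1.1 0; omega
      rw [← this]
      exact Fin.cons_self_tail u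
    · intro u _
      exact Fin.tail_cons _ _
    · intro u hu
      simp only [Finset.mem_filter, mem_decreasingParts] at hu
      have : u 0 = U + 1 := by have := hu.1.1 0; omega
      rw [← this]
      exact congrArg F (Fin.cons_self_tail u).symm

theorem truncSeries_eq_sum (U : ℕ) (w : List ℕ) :
    truncSeries U w =
      ∑ u ∈ decreasingParts U w.length, ∏ i, letterSeries (w.get i) (u i) := by
  induction U generalizing w with
  | zero =>
    cases w with
    | nil =>
      have : decreasingParts 0 0 = {![]} := by
        ext u
        simp [mem_decreasingParts, Subsingleton.elim u ![]]
      simp [this]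
    | cons r w =>
      have : decreasingParts 0 (w.length + 1) = ∅ := by
        ext u
        simp only [mem_decreasingParts, Finset.notMem_empty, iff_false]
        rintro ⟨h, _⟩
        have := h 0
        omega
      simp [truncSeries, this]
  | succ U ih =>
    cases w with
    | nil =>
      have : decreasingParts (U + 1) 0 = {![]} := by
        ext u
        simp [mem_decreasingParts, Subsingleton.elim u ![]]
      simp [this]
    | cons r w =>
      rw [truncSeries, ih, ih]
      simp only [List.length_cons]
      rw [sum_decreasingParts_succ, Finset.mul_sum]
      congr 1
      refine Finset.sum_congr rfl fun u _ => ?_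
      rw [Fin.prod_univ_succ]
      simp

theorem coeff_mul_congr {R : Type*} [CommSemiring R] {a b c d : R⟦X⟧} {n : ℕ}
    (h1 : ∀ m ≤ n, PowerSeries.coeff m a = PowerSeries.coeff m c)
    (h2 : ∀ m ≤ n, PowerSeries.coeff m b = PowerSeries.coeff m d) :
    ∀ m ≤ n, PowerSeries.coeff m (a * b) = PowerSeries.coeff m (c * d) := by
  intro m hm
  rw [PowerSeries.coeff_mul, PowerSeries.coeff_mul]
  refine Finset.sum_congr rfl fun p hp => ?_
  rw [Finset.HasAntidiagonal.mem_antidiagonal] at hp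
  rw [h1 _ (by omega), h2 _ (by omega)]

theorem coeff_prod_congr {R ι : Type*} [CommSemiring R] (s : Finset ι) {a b : ι → R⟦X⟧} {n : ℕ}
    (h : ∀ i ∈ s, ∀ m ≤ n, PowerSeries.coeff m (a i) = PowerSeries.coeff m (b i)) :
    ∀ m ≤ n, PowerSeries.coeff m (∏ i ∈ s, a i) = PowerSeries.coeff m (∏ i ∈ s, b i) := by
  classical
  induction s using Finset.induction_on with
  | empty => simp
  | insert i s hi ih =>
    rw [Finset.prod_insert hi, Finset.prod_insert hi]
    exact coeff_mul_congr (h i (Finset.mem_insert_self _ _))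
      (ih fun j hj => h j (Finset.mem_insert_of_mem hj))

/-- Up to degree `n` a one-part series is a finite sum of monomials over `v ≤ n`, the same box as in
`multipleDivisorSum`, so a product of such series can be expanded as a finite sum. -/
theorem coeff_letterSeries {r u n m : ℕ} (hu : 1 ≤ u) (hm : m ≤ n) :
    PowerSeries.coeff m (letterSeries r u) =
      PowerSeries.coeff m (∑ v ∈ Finset.Icc 1 n, PowerSeries.monomial (u * v) ((v : ℤ) ^ r)) := by
  rw [letterSeries, PowerSeries.coeff_mk, map_sum]
  simp only [PowerSeries.coeff_monomial]
  split_ifs with h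
  · obtain ⟨h0, v, rfl⟩ := h
    have hv : 0 < v := Nat.pos_of_ne_zero fun h => by simp [h] at h0
    rw [Finset.sum_eq_single v]
    · rw [if_pos rfl, Nat.mul_div_cancel_left _ (by omega)]
    · intro b _ hb
      rw [if_neg]
      intro h
      exact hb (Nat.eq_of_mul_eq_mul_left (by omega) h).symm
    · intro h
      refine absurd (Finset.mem_Icc.mpr ⟨hv, ?_⟩) h
      exact (Nat.le_mul_of_pos_left v (by omega)).trans hm
  · symm
    apply Finset.sum_eq_zero
    intro v hv
    rw [Finset.mem_Icc] at hv
    rw [if_neg]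
    rintro rfl
    exact h ⟨Nat.mul_pos (by omega) (by omega), Dvd.intro _ rfl⟩

theorem prod_monomial {ι : Type*} (s : Finset ι) (f : ι → ℕ) (c : ι → ℤ) :
    ∏ i ∈ s, PowerSeries.monomial (f i) (c i) =
      PowerSeries.monomial (∑ i ∈ s, f i) (∏ i ∈ s, c i) := by
  classical
  induction s using Finset.induction_on with
  | empty => simp
  | insert i s hi ih =>
    rw [Finset.prod_insert hi, Finset.prod_insert hi, Finset.sum_insert hi, ih,
      PowerSeries.monomial_mul_monomial]

theorem coeff_truncSeries_self (n : ℕ) (w : List ℕ) :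
    PowerSeries.coeff n (truncSeries n w) = multipleDivisorSum w.get n := by
  rw [truncSeries_eq_sum, map_sum, multipleDivisorSum, Finset.filter_and]
  have h1 : ∀ u ∈ decreasingParts n w.length,
      PowerSeries.coeff n (∏ i, letterSeries (w.get i) (u i)) =
        ∑ v ∈ Fintype.piFinset fun _ : Fin w.length => Finset.Icc 1 n,
          if ∑ i, u i * v i = n then ∏ i, ((v i : ℤ) ^ w.get i) else 0 := by
    intro u hu
    rw [mem_decreasingParts] at hu
    rw [coeff_prod_congr (n := n) Finset.univ
      (fun i _ m hm => coeff_letterSeries (hu.1 i).1 hm) n le_rfl, Finset.prod_univ_sum, map_sum]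
    refine Finset.sum_congr rfl fun v _ => ?_
    rw [prod_monomial, PowerSeries.coeff_monomial]
    exact if_congr eq_comm rfl rfl
  rw [Finset.sum_congr rfl h1, ← Finset.filter_and, Finset.sum_filter, Finset.sum_product]
  push_cast
  rw [decreasingParts, Finset.sum_filter]
  refine Finset.sum_congr rfl fun u _ => ?_
  split_ifs with h
  · refine Finset.sum_congr rfl fun v _ => ?_
    exact (if_congr (and_iff_right h) rfl rfl).symm
  · symm
    apply Finset.sum_eq_zero
    intro v _
    rw [if_neg]
    exact fun h' => h h'.1

theorem coeff_truncSeries {n U : ℕ} (h : n ≤ U) (w : List ℕ) :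
    (PowerSeries.coeff n (truncSeries U w) : ℤ) = multipleDivisorSum w.get n := by
  rw [← coeff_truncSeries_self]
  cases w with
  | nil => simp
  | cons r w => exact coeff_truncSeries_eq r w h le_rfl

/-! ### Linear independence modulo a prime -/

/-- An integral family that is linearly independent modulo a prime is linearly independent
over the rationals. -/
theorem linearIndepOn_rat_of_zmod {ι : Type*} {p : ℕ} [Fact p.Prime] (c : ι → ℕ → ℤ)
    (W : Finset ι)
    (h : LinearIndepOn (ZMod p) (fun i => (PowerSeries.mk fun n => (c i n : ZMod p))) (W : Set ι)) :
    LinearIndepOn ℚ (fun i => (PowerSeries.mk fun n => (c i n : ℚ))) (W : Set ι) := by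
  rw [linearIndepOn_finset_iff] at h
  change LinearIndependent ℚ _
  -- Clearing denominators, it suffices to exclude integral relations.
  rw [← LinearIndependent.iff_fractionRing ℤ ℚ]
  change LinearIndepOn ℤ (fun i => (PowerSeries.mk fun n => (c i n : ℚ))) (W : Set ι)
  rw [linearIndepOn_finset_iff]
  intro g hg
  by_contra! hne
  obtain ⟨i, hi, hgi⟩ := hne
  -- Divide the relation by the gcd of its coefficients. The primitive relation survives reduction
  -- modulo `p`, where independence makes every coefficient divisible by `p`, against gcd one.
  obtain ⟨g', hg', hgcd⟩ := Finset.extract_gcd g ⟨i, hi⟩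
  have hG : W.gcd g ≠ 0 := fun h0 => hgi (Finset.gcd_eq_zero_iff.mp h0 i hi)
  have hrel : ∀ n, ∑ j ∈ W, g' j * c j n = 0 := by
    intro n
    have h1 := congrArg (PowerSeries.coeff n) hg
    simp only [map_sum, map_zsmul, PowerSeries.coeff_mk, map_zero] at h1
    simp only [zsmul_eq_mul] at h1
    have h2 : ∑ j ∈ W, g j * c j n = 0 := by exact_mod_cast h1
    have h3 : W.gcd g * ∑ j ∈ W, g' j * c j n = 0 := by
      rw [Finset.mul_sum, ← h2]
      exact Finset.sum_congr rfl fun j hj => by rw [hg' j hj, mul_assoc]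
    exact (mul_eq_zero.mp h3).resolve_left hG
  have hmod := h (fun j => (g' j : ZMod p)) (by
    ext n
    simp only [map_sum, map_smul, PowerSeries.coeff_mk, smul_eq_mul, map_zero]
    exact_mod_cast congrArg (Int.cast : ℤ → ZMod p) (hrel n))
  have hdvd : (p : ℤ) ∣ W.gcd g' := Finset.dvd_gcd fun j hj =>
    (ZMod.intCast_zmod_eq_zero_iff_dvd _ _).mp (hmod j hj) 
  rw [hgcd] at hdvd
  have := Int.natCast_dvd_natCast.mp (by simpa using hdvd : (p : ℤ) ∣ ((1 : ℕ) : ℤ))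
  exact (Fact.out : p.Prime).one_lt.ne' (Nat.dvd_one.mp this)

/-- A pivot set `P` for a subspace `S` of a space of power series: an element of `S` whose
coefficients at `P` vanish is zero. -/
def IsPivotSet {K : Type*} [Field K] (S : Submodule K K⟦X⟧) (P : Set ℕ) : Prop :=
  ∀ f ∈ S, (∀ n ∈ P, PowerSeries.coeff n f = 0) → f = 0

/-- Adjoin to a subspace with pivot set `P` a series that, modulo the subspace, vanishes at `P`
and does not vanish at `q`. -/
theorem IsPivotSet.insert {K ι : Type*} [Field K] {v : ι → K⟦X⟧} {s : Set ι} {P : Set ℕ}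
    (hP : IsPivotSet (Submodule.span K (v '' s)) P) {a : ι} {f : K⟦X⟧} {q : ℕ}
    (hf : f - v a ∈ Submodule.span K (v '' s)) (hfP : ∀ n ∈ P, PowerSeries.coeff n f = 0)
    (hq : PowerSeries.coeff q f ≠ 0) :
    v a ∉ Submodule.span K (v '' s) ∧
      IsPivotSet (Submodule.span K (v '' (insert a s))) (insert q P) := by
  constructor
  · intro ha
    have : f ∈ Submodule.span K (v '' s) := by simpa using Submodule.add_mem _ hf ha
    exact hq (by rw [hP f this hfP, map_zero])
  · intro x hx hxP
    rw [Set.image_insert_eq, Submodule.mem_span_insert] at hx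
    obtain ⟨t, z, hz, rfl⟩ := hx
    -- Rewrite the element with `f` in place of `v a`. Since `f` vanishes on `P`, the remaining part
    -- in the old span vanishes on `P` and is zero; then the coefficient at `q` forces `t = 0`.
    have h1 : z - t • (f - v a) ∈ Submodule.span K (v '' s) :=
      Submodule.sub_mem _ hz (Submodule.smul_mem _ _ hf)
    have h2 : t • v a + z = t • f + (z - t • (f - v a)) := by
      rw [smul_sub]; abel
    rw [h2] at hxP ⊢
    have h3 : z - t • (f - v a) = 0 := by
      refine hP _ h1 fun n hn => ?_
      have := hxP n (Set.mem_insert_of_mem _ hn)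
      rwa [map_add, map_smul, hfP n hn, smul_zero, zero_add] at this
    rw [h3, add_zero] at hxP ⊢
    have := hxP q (Set.mem_insert _ _)
    rw [map_smul, smul_eq_mul] at this
    rw [(mul_eq_zero.mp this).resolve_right hq, zero_smul]

/-! ### Packed power series -/

/-- The number with the `M` digits `d (M-1), …, d 0` (from low to high) in base `B`. -/
def packDigits (B M : ℕ) (d : ℕ → ℕ) : ℕ := ∑ n ∈ Finset.range M, d n * B ^ (M - 1 - n)

theorem packDigits_succ (B M : ℕ) (d : ℕ → ℕ) :
    packDigits B (M + 1) d = B * packDigits B M d + d M := by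
  rw [packDigits, Finset.sum_range_succ, packDigits, Finset.mul_sum]
  congr 1
  · refine Finset.sum_congr rfl fun n hn => ?_
    rw [Finset.mem_range] at hn
    rw [show M + 1 - 1 - n = (M - 1 - n) + 1 by omega, pow_succ]
    ring
  · simp

theorem packDigits_add (B M : ℕ) (d e : ℕ → ℕ) :
    packDigits B M d + packDigits B M e = packDigits B M (fun n => d n + e n) := by
  rw [packDigits, packDigits, packDigits, ← Finset.sum_add_distrib]
  exact Finset.sum_congr rfl fun n _ => (add_mul _ _ _).symm

theorem packDigits_mul_const (B M c : ℕ) (d : ℕ → ℕ) :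
    packDigits B M d * c = packDigits B M (fun n => d n * c) := by
  rw [packDigits, packDigits, Finset.sum_mul]
  exact Finset.sum_congr rfl fun n _ => by ring

theorem packDigits_const (B M c : ℕ) (hB : 2 ≤ B) :
    packDigits B M (fun _ => c) = (B ^ M - 1) / (B - 1) * c := by
  have h1 : packDigits B M (fun _ => 1) = (B ^ M - 1) / (B - 1) := by
    rw [← Nat.geomSum_eq hB, packDigits]
    simp only [one_mul]
    exact Finset.sum_range_reflect (fun n => B ^ n) M
  rw [← h1, packDigits_mul_const]
  simp

theorem packDigits_div_mod {B M : ℕ} {d : ℕ → ℕ} (hd : ∀ n, d n < B) {n : ℕ} (hn : n < M) :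
    packDigits B M d / B ^ (M - 1 - n) % B = d n := by
  induction M with
  | zero => omega
  | succ M ih =>
    have hB : 0 < B := (Nat.zero_le _).trans_lt (hd 0)
    rw [packDigits_succ]
    rcases Nat.lt_succ_iff_lt_or_eq.mp hn with h | rfl
    · rw [show M + 1 - 1 - n = (M - 1 - n) + 1 by omega, pow_succ', ← Nat.div_div_eq_div_mul,
        Nat.mul_add_div hB, Nat.div_eq_of_lt (hd M), add_zero]
      exact ih h
    · simp [Nat.mod_eq_of_lt (hd n)]

theorem testBit_packDigits {β M : ℕ} {d : ℕ → ℕ} (hβ : 0 < β) (hd : ∀ n, d n < 2 ^ β) (i : ℕ) :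
    (packDigits (2 ^ β) M d).testBit i =
      (decide (i / β < M) && (d (M - 1 - i / β)).testBit (i % β)) := by
  induction M generalizing i with
  | zero => simp [packDigits]
  | succ M ih =>
    rw [packDigits_succ, Nat.testBit_two_pow_mul_add _ (hd M)]
    split_ifs with h
    · rw [Nat.div_eq_of_lt h, Nat.mod_eq_of_lt h]
      simp
    · push Not at h
      obtain ⟨t, rfl⟩ := Nat.exists_eq_add_of_le h
      rw [Nat.add_sub_cancel_left, ih, Nat.add_div_left _ hβ, Nat.add_mod_left]
      have : M + 1 - 1 - (t / β).succ = M - 1 - t / β := by omega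
      rw [this]
      congr 1
      simp

/-- Split every digit at the bit `s` and add the two halves. -/
theorem packDigits_fold {β s M : ℕ} {d : ℕ → ℕ} (hs : s < β) (hd : ∀ n, d n < 2 ^ β) :
    Nat.land (packDigits (2 ^ β) M d) (packDigits (2 ^ β) M fun _ => 2 ^ s - 1) +
        Nat.land (Nat.shiftRight (packDigits (2 ^ β) M d) s)
          (packDigits (2 ^ β) M fun _ => 2 ^ (β - s) - 1) =
      packDigits (2 ^ β) M fun n => d n % 2 ^ s + d n / 2 ^ s := by
  have hβ : 0 < β := by omega
  have hpow : ∀ t ≤ β, 2 ^ t - 1 < 2 ^ β := fun t ht =>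
    lt_of_lt_of_le (Nat.sub_lt (by positivity) one_pos) (Nat.pow_le_pow_right (by norm_num) ht)
  rw [← packDigits_add]
  congr 1
  · apply Nat.eq_of_testBit_eq
    intro i
    change (packDigits (2 ^ β) M d &&& packDigits (2 ^ β) M fun _ => 2 ^ s - 1).testBit i = _
    rw [Nat.testBit_and, testBit_packDigits hβ hd, testBit_packDigits hβ fun _ => hpow s hs.le,
      testBit_packDigits hβ fun n => (Nat.mod_le _ _).trans_lt (hd n), Nat.testBit_mod_two_pow,
      Nat.testBit_two_pow_sub_one]
    cases decide (i / β < M) <;> simp [Bool.and_comm]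
  · apply Nat.eq_of_testBit_eq
    intro i
    change ((packDigits (2 ^ β) M d >>> s) &&&
      packDigits (2 ^ β) M fun _ => 2 ^ (β - s) - 1).testBit i = _
    rw [Nat.testBit_and, Nat.testBit_shiftRight, testBit_packDigits hβ hd,
      testBit_packDigits hβ fun _ => hpow (β - s) (by omega),
      testBit_packDigits hβ fun n => (Nat.div_le_self _ _).trans_lt (hd n),
      Nat.testBit_div_two_pow, Nat.testBit_two_pow_sub_one]
    by_cases h : i % β < β - s
    · have h1 : (s + i) / β = i / β ∧ (s + i) % β = i % β + s := by
        rw [Nat.div_mod_unique hβ]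
        refine ⟨?_, by omega⟩
        have := Nat.mod_add_div i β
        omega
      rw [h1.1, h1.2]
      simp [h, Bool.and_comm]
    · have h2 : (d (M - 1 - i / β)).testBit (i % β + s) = false :=
        Nat.testBit_lt_two_pow ((hd _).trans_le (Nat.pow_le_pow_right (by norm_num) (by omega)))
      simp [h, h2]

theorem packDigits_mul_pred_le {B M b : ℕ} {d : ℕ → ℕ} (hd : ∀ n, d n ≤ b) :
    packDigits B M d * (B - 1) ≤ b * B ^ M := by
  rcases Nat.eq_zero_or_pos B with rfl | hB
  · simp
  · obtain ⟨C, rfl⟩ : ∃ C, B = C + 1 := ⟨B - 1, by omega⟩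
    rw [Nat.add_sub_cancel]
    -- This is the geometric sum bound with the constant `b` kept, without which the induction does
    -- not close.
    have key : packDigits (C + 1) M d * C + b ≤ b * (C + 1) ^ M := by
      induction M with
      | zero => simp [packDigits]
      | succ M ih =>
        rw [packDigits_succ, pow_succ]
        have := hd M
        nlinarith
    omega

/-- The high digits of a product of packed numbers are the Cauchy product of the digits. -/
theorem packDigits_mul_div {B m b σ : ℕ} {d e : ℕ → ℕ} (he : ∀ n, e n ≤ b)
    (hσ : ∑ n ∈ Finset.range (m + 1), d n ≤ σ) (hB : σ * b + 1 < B) :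
    packDigits B (m + 1) d * packDigits B (m + 1) e / B ^ m =
      packDigits B (m + 1) fun n =>
        ∑ q ∈ Finset.HasAntidiagonal.antidiagonal n, d q.1 * e q.2 := by
  -- Digits run from high to low, so the products of total degree above `m` form the low end of the
  -- full product. `R` collects them.
  set R : ℕ := ∑ a ∈ Finset.range (m + 1),
    d a * B ^ (m - a) * packDigits B a (fun x => e (m + 1 - a + x)) with hR
  have hsplit : packDigits B (m + 1) d * packDigits B (m + 1) e =
      R + (packDigits B (m + 1) fun n =>
        ∑ q ∈ Finset.HasAntidiagonal.antidiagonal n, d q.1 * e q.2) * B ^ m := by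
    have h1 : (packDigits B (m + 1) fun n =>
        ∑ q ∈ Finset.HasAntidiagonal.antidiagonal n, d q.1 * e q.2) =
        ∑ a ∈ Finset.range (m + 1), ∑ b ∈ Finset.range (m + 1 - a),
          d a * e b * B ^ (m - a - b) := by
      rw [← Finset.sum_range_diag_flip, packDigits]
      refine Finset.sum_congr rfl fun n hn => ?_
      rw [Finset.mem_range] at hn
      rw [Finset.Nat.sum_antidiagonal_eq_sum_range_succ (fun a b => d a * e b), Finset.sum_mul]
      refine Finset.sum_congr rfl fun k hk => ?_
      rw [Finset.mem_range] at hk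
      rw [show m + 1 - 1 - n = m - k - (n - k) by omega]
    rw [h1, hR, Finset.sum_mul, ← Finset.sum_add_distrib]
    conv_lhs => rw [packDigits, Finset.sum_mul]
    refine Finset.sum_congr rfl fun a ha => ?_
    rw [Finset.mem_range] at ha
    have h2 : packDigits B (m + 1) e = ∑ b ∈ Finset.range (m + 1 - a), e b * B ^ (m - b) +
        packDigits B a (fun x => e (m + 1 - a + x)) := by
      rw [packDigits, show m + 1 = (m + 1 - a) + a by omega, Finset.sum_range_add, packDigits]
      rw [show m + 1 - a + a = m + 1 by omega]
      refine congrArg₂ _ rfl (Finset.sum_congr rfl fun x hx => ?_)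
      rw [Finset.mem_range] at hx
      rw [show m + 1 - 1 - (m + 1 - a + x) = a - 1 - x by omega]
    rw [h2, mul_add, add_comm, show m + 1 - 1 - a = m - a by omega, Finset.mul_sum, Finset.sum_mul]
    congr 1
    refine Finset.sum_congr rfl fun b hb => ?_
    rw [Finset.mem_range] at hb
    have h3 : B ^ (m - a) * B ^ (m - b) = B ^ (m - a - b) * B ^ m := by
      rw [← pow_add, ← pow_add]
      congr 1
      omega
    calc d a * B ^ (m - a) * (e b * B ^ (m - b)) =
        d a * e b * (B ^ (m - a) * B ^ (m - b)) := by ring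
      _ = _ := by rw [h3]; ring
  -- The discarded part must produce no carry. Its digits are at most `σ * b`, and `σ * b < B - 1`
  -- keeps it below `B ^ m`.
  have hlt : R < B ^ m := by
    have h1 : R * (B - 1) ≤ σ * b * B ^ m := by
      calc R * (B - 1) ≤ ∑ a ∈ Finset.range (m + 1), d a * (b * B ^ m) := by
            rw [hR, Finset.sum_mul]
            refine Finset.sum_le_sum fun a ha => ?_
            rw [Finset.mem_range] at ha
            have := packDigits_mul_pred_le (B := B) (M := a)
              (d := fun x => e (m + 1 - a + x)) (fun n => he _)
            calc _ = d a * B ^ (m - a) *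
                  (packDigits B a (fun x => e (m + 1 - a + x)) * (B - 1)) := by ring
              _ ≤ d a * B ^ (m - a) * (b * B ^ a) := Nat.mul_le_mul_left _ this
              _ = d a * (b * (B ^ (m - a) * B ^ a)) := by ring
              _ = _ := by rw [← pow_add, Nat.sub_add_cancel (by omega)]
        _ = (∑ a ∈ Finset.range (m + 1), d a) * b * B ^ m := by rw [Finset.sum_mul, Finset.sum_mul]; 
                                                                exact Finset.sum_congr rfl fun a _ => by ring
        _ ≤ σ * b * B ^ m := by gcongr
    have hpos : 0 < B ^ m := pow_pos (by omega) m
    have h2 : R * (B - 1) < B ^ m * (B - 1) := by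
      have : σ * b < B - 1 := by omega
      nlinarith
    exact lt_of_mul_lt_mul_right h2 (Nat.zero_le _)
  rw [hsplit, Nat.add_mul_div_right _ _ (pow_pos (by omega) m), Nat.div_eq_of_lt hlt, zero_add]

/-! ### Packed series with coefficients modulo 31 -/

/-- The prime is a Mersenne prime: 2 ^ 5 = 1 modulo 31, hence also 2 ^ 15 = 1, and reduction of
packed digits needs no division. -/
instance fact_prime_thirtyOne : Fact (Nat.Prime 31) := ⟨by norm_num⟩

/-- The field with `31` elements. -/
abbrev F31 := ZMod 31

/-- The series `∑ c_n q^n` modulo `31`. -/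
noncomputable def truncMod (U : ℕ) (w : List ℕ) : F31⟦X⟧ :=
  PowerSeries.map (Int.castRingHom F31) (truncSeries U w)

noncomputable def letterMod (r u : ℕ) : F31⟦X⟧ :=
  PowerSeries.map (Int.castRingHom F31) (letterSeries r u)

/-- The word series modulo `31`. -/
noncomputable def rowSeries (w : List ℕ) : F31⟦X⟧ :=
  PowerSeries.mk fun n => ((multipleDivisorSum w.get n : ℤ) : F31)

/-- `x` is a packed form, with digits at most `b` in base `2 ^ β`, of the first `m` coefficients
of `g`. There is one more digit, which is arbitrary. -/
def Packs (β m b x : ℕ) (g : F31⟦X⟧) : Prop :=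
  ∃ d : ℕ → ℕ, (∀ n, d n ≤ b) ∧ (∀ n < m, (d n : F31) = PowerSeries.coeff n g) ∧
    x = packDigits (2 ^ β) (m + 1) d

/-- `x` is a packed form, with digit sum at most `σ` in base `2 ^ β`, of the first `m`
coefficients of `g`. There is one more digit, which is arbitrary. -/
def PacksFactor (β m σ x : ℕ) (g : F31⟦X⟧) : Prop :=
  ∃ d : ℕ → ℕ, ∑ n ∈ Finset.range (m + 1), d n ≤ σ ∧
    (∀ n < m, (d n : F31) = PowerSeries.coeff n g) ∧ x = packDigits (2 ^ β) (m + 1) d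

theorem packDigits_congr {B M : ℕ} {d e : ℕ → ℕ} (h : ∀ n < M, d n = e n) :
    packDigits B M d = packDigits B M e :=
  Finset.sum_congr rfl fun n hn => by rw [h n (Finset.mem_range.mp hn)]

theorem Packs.mono {β m b b' x : ℕ} {g : F31⟦X⟧} (h : Packs β m b x g) (hb : b ≤ b') :
    Packs β m b' x g := by
  obtain ⟨d, h1, h2⟩ := h
  exact ⟨d, fun n => (h1 n).trans hb, h2⟩

theorem Packs.congr {β m b x : ℕ} {g g' : F31⟦X⟧} (h : Packs β m b x g)
    (hg : ∀ n < m, PowerSeries.coeff n g = PowerSeries.coeff n g') : Packs β m b x g' := by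
  obtain ⟨d, h1, h2, h3⟩ := h
  exact ⟨d, h1, fun n hn => (h2 n hn).trans (hg n hn), h3⟩

theorem Packs.zero {β m b : ℕ} : Packs β m b 0 0 :=
  ⟨fun _ => 0, fun _ => Nat.zero_le _, by simp, by simp [packDigits]⟩

theorem Packs.add {β m b b' x y : ℕ} {g h : F31⟦X⟧} (hx : Packs β m b x g)
    (hy : Packs β m b' y h) : Packs β m (b + b') (x + y) (g + h) := by
  obtain ⟨d, h1, h2, rfl⟩ := hx
  obtain ⟨e, h3, h4, rfl⟩ := hy
  refine ⟨fun n => d n + e n, fun n => Nat.add_le_add (h1 n) (h3 n), fun n hn => ?_,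
    packDigits_add _ _ _ _⟩
  rw [Nat.cast_add, h2 n hn, h4 n hn, map_add]

theorem Packs.mul_const {β m b x : ℕ} {g : F31⟦X⟧} (hx : Packs β m b x g) (c : ℕ) :
    Packs β m (b * c) (x * c) ((c : F31) • g) := by
  obtain ⟨d, h1, h2, rfl⟩ := hx
  refine ⟨fun n => d n * c, fun n => Nat.mul_le_mul_right c (h1 n), fun n hn => ?_,
    packDigits_mul_const _ _ _ _⟩
  rw [Nat.cast_mul, h2 n hn, map_smul, smul_eq_mul, mul_comm]

/-- A digit of the convolution is at most the digit sum of one factor times the largest digit of the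
other; this is why the two factors carry different kinds of bounds. The shift discards the degrees
above `m`. The free digit at `m` does not influence the coefficients below `m`. -/
theorem PacksFactor.mul {β m σ b f x : ℕ} {g h : F31⟦X⟧} (hf : PacksFactor β m σ f g)
    (hx : Packs β m b x h) (hb : σ * b + 1 < 2 ^ β) :
    Packs β m (σ * b) ((f * x) >>> (β * m)) (g * h) := by
  obtain ⟨d, h1, h2, rfl⟩ := hf
  obtain ⟨e, h3, h4, rfl⟩ := hx
  rw [Nat.shiftRight_eq_div_pow, pow_mul, packDigits_mul_div h3 h1 hb]
  refine ⟨fun n => if n < m + 1 then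
    ∑ q ∈ Finset.HasAntidiagonal.antidiagonal n, d q.1 * e q.2 else 0, fun n => ?_,
    fun n hn => ?_, packDigits_congr fun n hn => (if_pos hn).symm⟩
  · dsimp only
    split_ifs with hn
    · calc ∑ q ∈ Finset.HasAntidiagonal.antidiagonal n, d q.1 * e q.2
          ≤ ∑ q ∈ Finset.HasAntidiagonal.antidiagonal n, d q.1 * b :=
            Finset.sum_le_sum fun q _ => Nat.mul_le_mul_left _ (h3 _)
        _ = (∑ k ∈ Finset.range (n + 1), d k) * b := by
            rw [Finset.Nat.sum_antidiagonal_eq_sum_range_succ (fun i _ => d i * b),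
              Finset.sum_mul]
        _ ≤ σ * b := by
            refine Nat.mul_le_mul_right b (le_trans (Finset.sum_le_sum_of_subset ?_) h1)
            exact Finset.range_mono hn
    · exact Nat.zero_le _
  · dsimp only
    rw [if_pos (by omega), PowerSeries.coeff_mul]
    push_cast
    refine Finset.sum_congr rfl fun q hq => ?_
    rw [Finset.HasAntidiagonal.mem_antidiagonal] at hq
    rw [h2 _ (by omega), h4 _ (by omega)]

/-- Reduction of all digits modulo `2 ^ s - 1`. -/
noncomputable def foldBits (s lo hi x : ℕ) : ℕ :=
  Nat.add (Nat.land x lo) (Nat.land (Nat.shiftRight x s) hi)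

/-- Splitting a digit as `d % 2 ^ s + 2 ^ s * (d / 2 ^ s)` and using `2 ^ s = 1`, the sum of the two
halves has the same residue. -/
theorem Packs.foldBits {β m b x s lo hi : ℕ} {g : F31⟦X⟧} (hx : Packs β m b x g)
    (hb : b < 2 ^ β) (hs : s < β) (hs1 : (2 : F31) ^ s = 1)
    (hlo : lo = packDigits (2 ^ β) (m + 1) fun _ => 2 ^ s - 1)
    (hhi : hi = packDigits (2 ^ β) (m + 1) fun _ => 2 ^ (β - s) - 1) :
    Packs β m (2 ^ s - 1 + b / 2 ^ s) (foldBits s lo hi x) g := by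
  obtain ⟨d, h1, h2, rfl⟩ := hx
  subst hlo hhi
  refine ⟨fun n => d n % 2 ^ s + d n / 2 ^ s, fun n => ?_, fun n hn => ?_,
    packDigits_fold hs fun n => (h1 n).trans_lt hb⟩
  · have h3 : d n % 2 ^ s < 2 ^ s := Nat.mod_lt _ (by positivity)
    have h4 : d n / 2 ^ s ≤ b / 2 ^ s := Nat.div_le_div_right (h1 n)
    dsimp only
    omega
  · rw [← h2 n hn]
    conv_rhs => rw [← Nat.mod_add_div (d n) (2 ^ s)]
    push_cast
    rw [hs1, one_mul]

theorem Packs.digit {β m b x n : ℕ} {g : F31⟦X⟧} (hx : Packs β m b x g) (hb : b < 2 ^ β)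
    (hn : n < m) :
    (((x >>> (β * m - β * n)) % 2 ^ β : ℕ) : F31) = PowerSeries.coeff n g := by
  obtain ⟨d, h1, h2, rfl⟩ := hx
  rw [← h2 n hn, Nat.shiftRight_eq_div_pow, ← Nat.mul_sub, pow_mul]
  congr 1
  exact packDigits_div_mod (M := m + 1) (fun n => (h1 n).trans_lt hb) (n := n) (by omega)

/-! ### The machine -/

/-- Call-by-value application for the evaluation in the kernel. -/
noncomputable def strictly {α : Type} (n : ℕ) (k : ℕ → α) : α :=
  Nat.rec (k 0) (fun m _ => k (Nat.succ m)) n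

theorem strictly_eq {α : Type} (n : ℕ) (k : ℕ → α) : strictly n k = k n := by
  cases n <;> rfl

/-- From the truncations of a word at the parts 0, 1, 2, …, this forms those of the word with one
more letter in front: they are the running sums of factor times truncation, folded after each
addition. Recursors and continuations let every packed number be evaluated once. -/
noncomputable def extendSeq (sh s lo hi : ℕ) (fs : List ℕ) :
    List ℕ → ℕ → (List ℕ → Bool) → Bool :=
  List.rec (motive := fun _ => List ℕ → ℕ → (List ℕ → Bool) → Bool)
    (fun _ _ k => k [])
    (fun f _ ih bs acc k => List.rec (motive := fun _ => Bool) (k [])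
      (fun b bs' _ => strictly (foldBits s lo hi
          (Nat.add acc (Nat.shiftRight (Nat.mul f b) sh))) fun acc' =>
        ih bs' acc' fun l => k (acc :: l)) bs) fs

/-- Only the final sum is wanted for a row, so the partial sums are neither kept nor folded; the 40
bits of a digit leave room for all products. -/
noncomputable def dotSeq (sh : ℕ) (fs : List ℕ) : List ℕ → ℕ → (ℕ → Bool) → Bool :=
  List.rec (motive := fun _ => List ℕ → ℕ → (ℕ → Bool) → Bool)
    (fun _ acc k => k acc)
    (fun f _ ih bs acc k => List.rec (motive := fun _ => Bool) (k acc)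
      (fun b bs' _ => strictly (Nat.add acc (Nat.shiftRight (Nat.mul f b) sh)) fun acc' =>
        ih bs' acc' k) bs) fs

noncomputable def lookupSeq (l : List (List ℕ)) : ℕ → (List ℕ → Bool) → Bool :=
  List.rec (motive := fun _ => ℕ → (List ℕ → Bool) → Bool) (fun _ _ => false)
    (fun x _ ih n k => Nat.rec (motive := fun _ => Bool) (k x) (fun m _ => ih m k) n) l

noncomputable def digitAt (p B s x : ℕ) : ℕ := Nat.mod (Nat.mod (Nat.shiftRight x s) B) p

/-- The multiplier `p - digit` represents minus the pivot coefficient without leaving the natural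
numbers; `b` has entry one at its pivot. -/
noncomputable def elimStep (p B s b x : ℕ) (k : ℕ → Bool) : Bool :=
  strictly (Nat.add x (Nat.mul b (Nat.sub p (digitAt p B s x)))) k

/-- Two folds at 15 bits and two at 5 bits bring any 40-bit digit down to at most 65. -/
noncomputable def normalizeRow (s₁ lo₁ hi₁ s₂ lo₂ hi₂ y : ℕ) (k : ℕ → Bool) : Bool :=
  strictly (foldBits s₁ lo₁ hi₁ y) fun y => strictly (foldBits s₁ lo₁ hi₁ y) fun y =>
    strictly (foldBits s₂ lo₂ hi₂ y) fun y => strictly (foldBits s₂ lo₂ hi₂ y) k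

/-- The constants of the machine. -/
structure MachineSpec (m p B β sh s₁ lo₁ hi₁ s₂ lo₂ hi₂ e w : ℕ) : Prop where
  hp : p = 31
  hβ : β = 40
  hB : B = 2 ^ β
  hsh : sh = β * m
  hs₁ : s₁ = 15
  hlo₁ : lo₁ = packDigits (2 ^ β) (m + 1) fun _ => 2 ^ s₁ - 1
  hhi₁ : hi₁ = packDigits (2 ^ β) (m + 1) fun _ => 2 ^ (β - s₁) - 1
  hs₂ : s₂ = 5
  hlo₂ : lo₂ = packDigits (2 ^ β) (m + 1) fun _ => 2 ^ s₂ - 1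
  hhi₂ : hi₂ = packDigits (2 ^ β) (m + 1) fun _ => 2 ^ (β - s₂) - 1
  he : e = 29
  hw : w = 32

/-- The machine. The code `0` drops the sequence on top of the stack, the code `r + 1` with
`r < 32` pushes its extension by the letter `r`, and the code `32 n + r + 1` computes the row that
belongs to the extension by `r`, eliminates with the previous rows, and checks that the
`n`-th coefficient that remains is not zero modulo `p`. -/
noncomputable def runMachine (m p B β sh s₁ lo₁ hi₁ s₂ lo₂ hi₂ e w : ℕ) (F : List (List ℕ))
    (prog : List ℕ) : List (List ℕ) → (ℕ → (ℕ → Bool) → Bool) → Bool :=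
  List.rec (motive := fun _ => List (List ℕ) → (ℕ → (ℕ → Bool) → Bool) → Bool)
    (fun _ _ => true)
    (fun i _ ih st el => List.rec (motive := fun _ => Bool) false (fun top tl _ =>
      Nat.rec (motive := fun _ => Bool) (ih tl el) (fun j _ =>
        strictly (Nat.mod j w) fun r => lookupSeq F r fun f =>
          Nat.rec (motive := fun _ => Bool)
            (extendSeq sh s₁ lo₁ hi₁ f top 0 fun l => ih (l :: top :: tl) el)
            (fun n _ => dotSeq sh f top 0 fun x => el x fun y =>
              normalizeRow s₁ lo₁ hi₁ s₂ lo₂ hi₂ y fun y =>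
              -- Here `Nat.succ n` is the quotient `j / w`, the pivot column; quotient zero is
              -- reserved for pushing a letter.
              strictly (Nat.sub sh (Nat.mul β (Nat.succ n))) fun s =>
              strictly (digitAt p B s y) fun c =>
              Nat.rec (motive := fun _ => Bool) false (fun _ _ =>
                Nat.rec (motive := fun _ => Bool) false (fun _ _ =>
                  -- With `e = p - 2` this is the inverse of the pivot coefficient, by Fermat.
                  strictly (Nat.mod (Nat.pow c e) p) fun v =>
                  strictly (foldBits s₂ lo₂ hi₂ (Nat.mul y v)) fun b =>
                  ih (top :: tl) fun x k => el x fun x' => elimStep p B s b x' k) c)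
                (Nat.sub m (Nat.succ n)))
            (Nat.div j w)) i) st) prog

/-- The words whose rows are computed by a program. -/
def emittedWords : List ℕ → List (List ℕ) → List (List ℕ)
  | [], _ => []
  | _ :: _, [] => []
  | 0 :: prog, _ :: st => emittedWords prog st
  | (j + 1) :: prog, w :: st =>
    if j / 32 = 0 then emittedWords prog ((j % 32 :: w) :: w :: st)
    else (j % 32 :: w) :: emittedWords prog (w :: st)

/-! ### The factors -/

/-- The packed series `∑_v v^r q^{uv}`. -/
noncomputable def packLetter (p B sh βu r vmax : ℕ) : ℕ :=
  Nat.rec (motive := fun _ => ℕ) 0 (fun v x =>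
    Nat.add x (Nat.mul (Nat.mod (Nat.pow (Nat.succ v) r) p)
      (Nat.pow B (Nat.sub sh (Nat.mul βu (Nat.succ v)))))) vmax

/-- The factors for the parts `H, …, 1` are put in front of the initial list, so the part 1 ends up
first. The salt, which varies with the letter and the part, is added to the free last digit and
hence affects no coefficient below `m`. -/
noncomputable def letterSeq (m p β sh r salt : ℕ) (H : ℕ) : List ℕ → (List ℕ → Bool) → Bool :=
  Nat.rec (motive := fun _ => List ℕ → (List ℕ → Bool) → Bool) (fun l k => k l)
    (fun u ih l k =>
      strictly (Nat.add (packLetter p 2 sh (Nat.mul β (Nat.succ u)) r (Nat.div m (Nat.succ u)))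
        (Nat.add salt u)) fun x => ih (x :: l) k) H

noncomputable def letterSeqs (m p β sh H rest : ℕ) (R : ℕ) :
    List (List ℕ) → (List (List ℕ) → Bool) → Bool :=
  Nat.rec (motive := fun _ => List (List ℕ) → (List (List ℕ) → Bool) → Bool) (fun l k => k l)
    (fun r ih l k => strictly (Nat.mul r 512) fun salt => strictly (Nat.add rest salt) fun y =>
      letterSeq m p β sh r salt H [y] fun x => ih (x :: l) k) R

/-- Run a program on series modulo `q ^ m`, with letters `r < R`. -/
noncomputable def checkProgram (m R : ℕ) (prog : List ℕ) : Bool :=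
  strictly 31 fun p => strictly 40 fun β => strictly (2 ^ β) fun B =>
  strictly (β * m) fun sh => strictly 15 fun s₁ => strictly 5 fun s₂ =>
  strictly 29 fun e => strictly 32 fun w =>
  strictly ((B ^ (m + 1) - 1) / (B - 1)) fun ones =>
  strictly (ones * (2 ^ s₁ - 1)) fun lo₁ => strictly (ones * (2 ^ (β - s₁) - 1)) fun hi₁ =>
  strictly (ones * (2 ^ s₂ - 1)) fun lo₂ => strictly (ones * (2 ^ (β - s₂) - 1)) fun hi₂ =>
  strictly (m / 2) fun H =>
  strictly ((B ^ (m - H) - 1) / (B - 1)) fun rest =>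
  strictly (2 ^ sh) fun one =>
  letterSeqs m p β sh H rest R [] fun F =>
  runMachine m p B β sh s₁ lo₁ hi₁ s₂ lo₂ hi₂ e w F prog [List.replicate (H + 1) one]
    fun x k => elimStep p B sh one x k

/-! ### Correctness of the machine -/

theorem truncMod_succ (U r : ℕ) (w : List ℕ) :
    truncMod (U + 1) (r :: w) =
      truncMod U (r :: w) + letterMod r (U + 1) * truncMod U w := by
  simp [truncMod, letterMod, truncSeries]

/-- The term with `v = 1` is `q ^ u` whatever the exponent `r`, and the next one has degree `2 * u`.
-/
theorem X_pow_dvd_letterSeries_sub (r u : ℕ) (hu : 0 < u) :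
    (PowerSeries.X : ℤ⟦X⟧) ^ (2 * u) ∣ letterSeries r u - PowerSeries.X ^ u := by
  rw [PowerSeries.X_pow_dvd_iff]
  intro n hn
  rw [map_sub, PowerSeries.coeff_X_pow, letterSeries, PowerSeries.coeff_mk, sub_eq_zero]
  refine if_ctx_congr ⟨?_, ?_⟩ (fun h => ?_) fun _ => rfl
  · rintro ⟨h0, c, rfl⟩
    have h1 : c < 2 := by
      by_contra! h
      nlinarith
    have h2 : c ≠ 0 := by rintro rfl; simp at h0
    rw [show c = 1 by omega, mul_one]
  · rintro rfl
    exact ⟨hu, dvd_rfl⟩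
  · rw [h, Nat.div_self hu]
    simp

/-- Modulo `q ^ (2 H + 2)`, the parts greater than `H` occur with multiplicity one. -/
theorem X_pow_dvd_truncSeries_sub_tail (r : ℕ) (w : List ℕ) {H V : ℕ} (h : H ≤ V) :
    (PowerSeries.X : ℤ⟦X⟧) ^ (2 * H + 2) ∣ truncSeries V (r :: w) -
      (truncSeries H (r :: w) +
        (∑ u ∈ Finset.Ico (H + 1) (V + 1), PowerSeries.X ^ u) * truncSeries H w) := by
  induction V, h using Nat.le_induction with
  | base => simp
  | succ V hV ih =>
    have h1 : truncSeries (V + 1) (r :: w) - (truncSeries H (r :: w) +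
        (∑ u ∈ Finset.Ico (H + 1) (V + 1 + 1), PowerSeries.X ^ u) * truncSeries H w) =
        (truncSeries V (r :: w) - (truncSeries H (r :: w) +
          (∑ u ∈ Finset.Ico (H + 1) (V + 1), PowerSeries.X ^ u) * truncSeries H w)) +
        ((letterSeries r (V + 1) - PowerSeries.X ^ (V + 1)) * truncSeries V w +
          PowerSeries.X ^ (V + 1) * (truncSeries V w - truncSeries H w)) := by
      rw [Finset.sum_Ico_succ_top (by omega), truncSeries]
      ring
    rw [h1]
    -- The two error terms have either multiplicity at least two for the part `V + 1`, or a second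
    -- part above `H`; both have degree at least `2 * H + 2`.
    refine dvd_add ih (dvd_add (Dvd.dvd.mul_right ?_ _) ?_)
    · exact (pow_dvd_pow _ (by omega)).trans (X_pow_dvd_letterSeries_sub r (V + 1) (by omega))
    · cases w with
      | nil => simp
      | cons s w =>
        have := mul_dvd_mul (pow_dvd_pow (PowerSeries.X : ℤ⟦X⟧) (show H + 1 ≤ V + 1 by omega))
          (X_pow_dvd_truncSeries_sub s w hV)
        rw [← pow_add] at this
        convert this using 2
        ring

/-- The series `∑_{n > H} q^n`. -/
noncomputable def tailSeries (H : ℕ) : F31⟦X⟧ := PowerSeries.mk fun n => if H < n then 1 else 0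

/-- Below degree `m` at most one part exceeds `H`, and it has multiplicity one. So truncations up to
about half of `m` suffice, and the large parts contribute a single extra factor `tailSeries H`, the
same for all letters. -/
theorem coeff_rowSeries_cons (r : ℕ) (w : List ℕ) {m H n : ℕ} (hn : n < m) (hH : m ≤ 2 * H + 2) :
    PowerSeries.coeff n (truncMod H (r :: w) + tailSeries H * truncMod H w) =
      PowerSeries.coeff n (rowSeries (r :: w)) := by
  rcases le_or_gt n H with h | h
  · have h0 : PowerSeries.coeff n (tailSeries H * truncMod H w) = 0 := by
      rw [PowerSeries.coeff_mul]
      refine Finset.sum_eq_zero fun q hq => ?_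
      rw [Finset.HasAntidiagonal.mem_antidiagonal] at hq
      rw [tailSeries, PowerSeries.coeff_mk, if_neg (by omega), zero_mul]
    rw [map_add, h0, add_zero, truncMod, PowerSeries.coeff_map, coeff_truncSeries h, rowSeries,
      PowerSeries.coeff_mk]
    rfl
  · have h1 := PowerSeries.X_pow_dvd_iff.mp
      (X_pow_dvd_truncSeries_sub_tail r w (V := n) h.le) n (by omega)
    rw [map_sub, sub_eq_zero, coeff_truncSeries le_rfl] at h1
    rw [rowSeries, PowerSeries.coeff_mk, h1, ← eq_intCast (Int.castRingHom F31),
      ← PowerSeries.coeff_map, (PowerSeries.map _).map_add, (PowerSeries.map _).map_mul, map_add,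
      map_add]
    change PowerSeries.coeff n (truncMod H (r :: w)) + _ =
      PowerSeries.coeff n (truncMod H (r :: w)) + _
    congr 1
    refine coeff_mul_congr (fun q hq => ?_) (fun _ _ => rfl) n le_rfl
    rw [tailSeries, PowerSeries.coeff_mk, PowerSeries.coeff_map, map_sum]
    simp only [PowerSeries.coeff_X_pow, Finset.sum_ite_eq, Finset.mem_Ico]
    split_ifs with h2 h3 h3
    · simp
    · omega
    · omega
    · simp

/-- A list that packs the series of the word `w` truncated at the parts `0, 1, …, H`. -/
def IsSeqOf (m H : ℕ) (l : List ℕ) (w : List ℕ) : Prop :=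
  l.length = H + 1 ∧ ∀ j x, l[j]? = some x → Packs 40 m 131072 x (truncMod j w)

/-- A list that packs the factors of the letter `r`. -/
def IsLetterSeq (m H : ℕ) (l : List ℕ) (r : ℕ) : Prop :=
  l.length = H + 1 ∧ (∀ j x, l[j]? = some x → j < H → PacksFactor 40 m 22000 x (letterMod r (j + 1))) ∧
    ∀ x, l[H]? = some x → PacksFactor 40 m 22000 x (tailSeries H)

theorem extendSeq_cons_cons (sh s lo hi f b acc : ℕ) (fs bs : List ℕ) (k : List ℕ → Bool) :
    extendSeq sh s lo hi (f :: fs) (b :: bs) acc k =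
      strictly (foldBits s lo hi (Nat.add acc (Nat.shiftRight (Nat.mul f b) sh))) fun acc' =>
        extendSeq sh s lo hi fs bs acc' fun l => k (acc :: l) := rfl

theorem dotSeq_cons_cons (sh f b acc : ℕ) (fs bs : List ℕ) (k : ℕ → Bool) :
    dotSeq sh (f :: fs) (b :: bs) acc k =
      strictly (Nat.add acc (Nat.shiftRight (Nat.mul f b) sh)) fun acc' =>
        dotSeq sh fs bs acc' k := rfl

/-- The running sum is recorded before each factor is used. Hence nothing is required of the last
factor, which is the tail, nor of the sum left over at the end of the list. -/
theorem extendSeq_correct {m sh lo hi r : ℕ} {w : List ℕ} (hsh : sh = 40 * m)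
    (hlo : lo = packDigits (2 ^ 40) (m + 1) fun _ => 2 ^ 15 - 1)
    (hhi : hi = packDigits (2 ^ 40) (m + 1) fun _ => 2 ^ (40 - 15) - 1) (fs : List ℕ) :
    ∀ (bs : List ℕ) (i acc : ℕ), bs.length = fs.length →
      (∀ j f, fs[j]? = some f → j + 1 < fs.length →
        PacksFactor 40 m 22000 f (letterMod r (i + j + 1))) →
      (∀ j b, bs[j]? = some b → Packs 40 m 131072 b (truncMod (i + j) w)) →
      (fs ≠ [] → Packs 40 m 131072 acc (truncMod i (r :: w))) →
      ∃ l : List ℕ, (∀ k, extendSeq sh 15 lo hi fs bs acc k = k l) ∧ l.length = fs.length ∧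
        ∀ j x, l[j]? = some x → Packs 40 m 131072 x (truncMod (i + j) (r :: w)) := by
  induction fs with
  | nil =>
    intro bs i acc _ _ _ _
    exact ⟨[], fun k => rfl, rfl, by simp⟩
  | cons f fs ih =>
    intro bs i acc hlen hf hb hacc
    cases bs with
    | nil => simp at hlen
    | cons b bs =>
      have hacc := hacc (by simp)
      obtain ⟨l, h1, h2, h3⟩ := ih bs (i + 1)
        (foldBits 15 lo hi (Nat.add acc (Nat.shiftRight (Nat.mul f b) sh))) (by simpa using hlen)
        (fun j g hj hj' => by
          have := hf (j + 1) g (by simpa using hj) (by simpa using hj')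
          rwa [show i + (j + 1) + 1 = i + 1 + j + 1 by ring] at this)
        (fun j g hj => by
          have := hb (j + 1) g (by simpa using hj)
          rwa [show i + (j + 1) = i + 1 + j by ring] at this)
        (fun hne => by
          have hf0 := hf 0 f (by simp) (by
            have := List.length_pos_iff.mpr hne
            simpa using this)
          have hb0 := hb 0 b (by simp)
          -- The new digits are at most 131072 + 22000 · 131072, and one fold at 15 bits brings them
          -- back below 131072 = 2 ^ 17.
          have hadd := hacc.add (hf0.mul hb0 (by norm_num))
          rw [add_zero, ← truncMod_succ, ← hsh] at hadd
          exact (hadd.foldBits (by norm_num) (by norm_num) (by decide) hlo hhi).mono (by norm_num))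
      refine ⟨acc :: l, fun k => ?_, by simp [h2], ?_⟩
      · rw [extendSeq_cons_cons, strictly_eq]
        exact h1 _
      · intro j x hj
        cases j with
        | zero =>
          simp only [List.getElem?_cons_zero, Option.some.injEq] at hj
          rwa [← hj, add_zero]
        | succ j =>
          have := h3 j x (by simpa using hj)
          rwa [show i + 1 + j = i + (j + 1) by ring] at this

/-- The parameter `c` counts the products already added, each with digits at most 22000 · 131072;
the last factor is the tail. -/
theorem dotSeq_correct {m sh r : ℕ} {w : List ℕ} (hsh : sh = 40 * m) (fs : List ℕ) :
    ∀ (bs : List ℕ) (i acc c : ℕ), bs.length = fs.length → fs ≠ [] →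
      (∀ j f, fs[j]? = some f → j + 1 < fs.length →
        PacksFactor 40 m 22000 f (letterMod r (i + j + 1))) →
      (∀ j f, fs[j]? = some f → j + 1 = fs.length →
        PacksFactor 40 m 22000 f (tailSeries (i + j))) →
      (∀ j b, bs[j]? = some b → Packs 40 m 131072 b (truncMod (i + j) w)) →
      Packs 40 m (c * (22000 * 131072)) acc (truncMod i (r :: w)) →
      ∃ x, (∀ k, dotSeq sh fs bs acc k = k x) ∧
        Packs 40 m ((c + fs.length) * (22000 * 131072)) x
          (truncMod (i + fs.length - 1) (r :: w) +
            tailSeries (i + fs.length - 1) * truncMod (i + fs.length - 1) w) := by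
  induction fs with
  | nil => intro _ _ _ _ _ h; exact absurd rfl h
  | cons f fs ih =>
    intro bs i acc c hlen _ hf hF hb hacc
    cases bs with
    | nil => simp at hlen
    | cons b bs =>
      have hb0 := hb 0 b (by simp)
      rcases eq_or_ne fs [] with rfl | hne
      · obtain rfl : bs = [] := by simpa using hlen
        have hF0 := hF 0 f (by simp) (by simp)
        have hadd := hacc.add (hF0.mul hb0 (by norm_num))
        rw [← hsh] at hadd
        refine ⟨Nat.add acc (Nat.shiftRight (Nat.mul f b) sh), fun k => ?_, ?_⟩
        · rw [dotSeq_cons_cons, strictly_eq]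
          rfl
        · simpa [add_mul] using hadd
      · have hf0 := hf 0 f (by simp) (by simpa using List.length_pos_iff.mpr hne)
        have hadd := hacc.add (hf0.mul hb0 (by norm_num))
        rw [add_zero, ← truncMod_succ, ← hsh] at hadd
        obtain ⟨x, h1, h2⟩ := ih bs (i + 1) (Nat.add acc (Nat.shiftRight (Nat.mul f b) sh)) (c + 1)
          (by simpa using hlen) hne
          (fun j g hj hj' => by
            have := hf (j + 1) g (by simpa using hj) (by simpa using hj')
            rwa [show i + (j + 1) + 1 = i + 1 + j + 1 by ring] at this)
          (fun j g hj hj' => by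
            have := hF (j + 1) g (by simpa using hj) (by simpa using hj')
            rwa [show i + (j + 1) = i + 1 + j by ring] at this)
          (fun j g hj => by
            have := hb (j + 1) g (by simpa using hj)
            rwa [show i + (j + 1) = i + 1 + j by ring] at this)
          (hadd.mono (by rw [add_mul, one_mul]))
        refine ⟨x, fun k => ?_, ?_⟩
        · rw [dotSeq_cons_cons, strictly_eq]
          exact h1 _
        · rw [List.length_cons, show i + (fs.length + 1) - 1 = i + 1 + fs.length - 1 by omega]
          exact h2.mono (le_of_eq (by ring))

theorem lookupSeq_eq_true {l : List (List ℕ)} {n : ℕ} {k : List ℕ → Bool}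
    (h : lookupSeq l n k = true) : ∃ x, l[n]? = some x ∧ k x = true := by
  induction l generalizing n with
  | nil => exact absurd h (by simp [lookupSeq])
  | cons x l ih =>
    cases n with
    | zero => exact ⟨x, by simp, h⟩
    | succ n =>
      obtain ⟨y, h1, h2⟩ := ih (n := n) h
      exact ⟨y, by simpa using h1, h2⟩

/-- The invariant of the elimination. -/
structure ElimInv (m : ℕ) (ws : Set (List ℕ)) (P : Set ℕ) (el : ℕ → (ℕ → Bool) → Bool)
    (c : ℕ) : Prop where
  indep : LinearIndepOn F31 rowSeries ws
  pivots : IsPivotSet (Submodule.span F31 (rowSeries '' ws)) P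
  -- One elimination step adds a row with digits at most 100 times a number at most 31, hence 3100
  -- for each of the `c` pivots.
  elim : ∀ b x g, b + c * 3100 < 2 ^ 40 → Packs 40 m b x g → ∃ y g', (∀ k, el x k = k y) ∧
    Packs 40 m (b + c * 3100) y g' ∧ g' - g ∈ Submodule.span F31 (rowSeries '' ws) ∧
      ∀ n ∈ P, PowerSeries.coeff n g' = 0

theorem ElimInv.empty (m : ℕ) : ElimInv m ∅ ∅ (fun x k => k x) 0 where
  indep := linearIndepOn_empty _ _
  pivots := by
    intro f hf _
    simpa using hf
  elim b x g _ hx := ⟨x, g, fun _ => rfl, by simpa using hx, by simp, by simp⟩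

/-- The new row has been reduced by the previous ones, so it vanishes at the old pivots and adding a
multiple of it does not disturb them. Appending its step to the elimination is therefore enough. -/
theorem ElimInv.insert {m : ℕ} {ws : Set (List ℕ)} {P : Set ℕ} {el : ℕ → (ℕ → Bool) → Bool}
    {c : ℕ} (h : ElimInv m ws P el c) {w : List ℕ} {f g : F31⟦X⟧} {q b s : ℕ} {v : F31}
    (hf : f - rowSeries w ∈ Submodule.span F31 (rowSeries '' ws))
    (hfP : ∀ n ∈ P, PowerSeries.coeff n f = 0) (hq : q < m) (hg : g = v • f)
    (hgq : PowerSeries.coeff q g = 1) (hb : Packs 40 m 100 b g) (hs : s = 40 * m - 40 * q) :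
    w ∉ ws ∧ ElimInv m (insert w ws) (insert q P)
      (fun x k => el x fun x' => elimStep 31 (2 ^ 40) s b x' k) (c + 1) := by
  have hfq : PowerSeries.coeff q f ≠ 0 := by
    intro h0
    rw [hg, map_smul, h0, smul_zero] at hgq
    exact zero_ne_one hgq
  obtain ⟨h1, h2⟩ := h.pivots.insert hf hfP hfq
  have hw : w ∉ ws := fun hw => h1 (Submodule.subset_span (Set.mem_image_of_mem _ hw))
  have hmono : Submodule.span F31 (rowSeries '' ws) ≤
      Submodule.span F31 (rowSeries '' Insert.insert w ws) :=
    Submodule.span_mono (Set.image_mono (Set.subset_insert _ _))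
  have hfmem : f ∈ Submodule.span F31 (rowSeries '' Insert.insert w ws) := by
    have := Submodule.add_mem _ (hmono hf)
      (Submodule.subset_span (Set.mem_image_of_mem rowSeries (Set.mem_insert w ws)))
    simpa using this
  refine ⟨hw, h.indep.insert h1, h2, ?_⟩
  intro b' x g₀ hb' hx
  obtain ⟨y, g', e1, e2, e3, e4⟩ := h.elim b' x g₀ (lt_of_le_of_lt (by omega) hb') hx
  set a : ℕ := digitAt 31 (2 ^ 40) s y with ha
  have hdig : ((a : ℕ) : F31) = PowerSeries.coeff q g' := by
    rw [← e2.digit (lt_of_le_of_lt (by omega) hb') hq, ← hs]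
    exact ZMod.natCast_mod _ 31
  have ha31 : a ≤ 31 := (Nat.mod_lt _ (by norm_num)).le
  have hcast : ((31 - a : ℕ) : F31) = - PowerSeries.coeff q g' := by
    rw [Nat.cast_sub ha31, hdig]
    have : ((31 : ℕ) : F31) = 0 := ZMod.natCast_self 31
    rw [this, zero_sub]
  refine ⟨y + b * (31 - a), g' + ((31 - a : ℕ) : F31) • g, fun k => ?_, ?_, ?_, ?_⟩
  · rw [e1, elimStep, strictly_eq]
    rfl
  · refine (e2.add (hb.mul_const (31 - a))).mono ?_
    have : 100 * (31 - a) ≤ 100 * 31 := Nat.mul_le_mul_left _ (Nat.sub_le _ _)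
    omega
  · rw [add_sub_right_comm]
    refine Submodule.add_mem _ (hmono e3) (Submodule.smul_mem _ _ ?_)
    rw [hg]
    exact Submodule.smul_mem _ _ hfmem
  · intro n hn
    rw [map_add, map_smul, smul_eq_mul, hcast]
    rcases Set.mem_insert_iff.mp hn with rfl | hn
    · rw [hgq]; ring
    · rw [e4 n hn, hg, map_smul, hfP n hn, smul_zero, mul_zero, add_zero]

theorem normalizeRow_correct {m s₁ lo₁ hi₁ s₂ lo₂ hi₂ b y : ℕ} {g : F31⟦X⟧}
    (hs₁ : s₁ = 15) (hs₂ : s₂ = 5)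
    (hlo₁ : lo₁ = packDigits (2 ^ 40) (m + 1) fun _ => 2 ^ 15 - 1)
    (hhi₁ : hi₁ = packDigits (2 ^ 40) (m + 1) fun _ => 2 ^ (40 - 15) - 1)
    (hlo₂ : lo₂ = packDigits (2 ^ 40) (m + 1) fun _ => 2 ^ 5 - 1)
    (hhi₂ : hi₂ = packDigits (2 ^ 40) (m + 1) fun _ => 2 ^ (40 - 5) - 1)
    (hy : Packs 40 m b y g) (hb : b < 2 ^ 40) :
    ∃ z, (∀ k, normalizeRow s₁ lo₁ hi₁ s₂ lo₂ hi₂ y k = k z) ∧ Packs 40 m 65 z g := by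
  subst hs₁ hs₂
  have h1 := ((hy.mono (Nat.le_sub_one_of_lt hb)).foldBits (by norm_num) (by norm_num)
    (by decide) hlo₁ hhi₁).foldBits (by norm_num) (by norm_num) (by decide) hlo₁ hhi₁
  have h2 := (h1.foldBits (by norm_num) (by norm_num) (by decide) hlo₂ hhi₂).foldBits
    (by norm_num) (by norm_num) (by decide) hlo₂ hhi₂
  refine ⟨_, fun k => ?_, h2.mono (by norm_num)⟩
  rw [normalizeRow, strictly_eq, strictly_eq, strictly_eq, strictly_eq]

theorem runMachine_succ (m p B β sh s₁ lo₁ hi₁ s₂ lo₂ hi₂ e w j : ℕ) (F : List (List ℕ))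
    (prog : List ℕ) (top : List ℕ) (tl : List (List ℕ)) (el : ℕ → (ℕ → Bool) → Bool) :
    runMachine m p B β sh s₁ lo₁ hi₁ s₂ lo₂ hi₂ e w F ((j + 1) :: prog) (top :: tl) el =
      strictly (Nat.mod j w) fun r => lookupSeq F r fun f =>
        Nat.rec (motive := fun _ => Bool)
          (extendSeq sh s₁ lo₁ hi₁ f top 0 fun l =>
            runMachine m p B β sh s₁ lo₁ hi₁ s₂ lo₂ hi₂ e w F prog (l :: top :: tl) el)
          (fun n _ => dotSeq sh f top 0 fun x => el x fun y =>
            normalizeRow s₁ lo₁ hi₁ s₂ lo₂ hi₂ y fun y =>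
            strictly (Nat.sub sh (Nat.mul β (Nat.succ n))) fun s =>
            strictly (digitAt p B s y) fun c =>
            Nat.rec (motive := fun _ => Bool) false (fun _ _ =>
              Nat.rec (motive := fun _ => Bool) false (fun _ _ =>
                strictly (Nat.mod (Nat.pow c e) p) fun v =>
                strictly (foldBits s₂ lo₂ hi₂ (Nat.mul y v)) fun b =>
                runMachine m p B β sh s₁ lo₁ hi₁ s₂ lo₂ hi₂ e w F prog (top :: tl)
                  fun x k => el x fun x' => elimStep p B s b x' k) c)
              (Nat.sub m (Nat.succ n)))
          (Nat.div j w) := rfl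

theorem runMachine_correct {m H p B β sh s₁ lo₁ hi₁ s₂ lo₂ hi₂ e w : ℕ} {F : List (List ℕ)}
    (S : MachineSpec m p B β sh s₁ lo₁ hi₁ s₂ lo₂ hi₂ e w) (hm : m ≤ 460) (hH : H = m / 2)
    (hF : ∀ r f, F[r]? = some f → IsLetterSeq m H f r) (prog : List ℕ) :
    ∀ (st : List (List ℕ)) (wst : List (List ℕ)) (ws : Set (List ℕ)) (P : Set ℕ)
      (el : ℕ → (ℕ → Bool) → Bool) (c : ℕ), List.Forall₂ (IsSeqOf m H) st wst →
      ElimInv m ws P el c → c + prog.length ≤ 2000 →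
      runMachine m p B β sh s₁ lo₁ hi₁ s₂ lo₂ hi₂ e w F prog st el = true →
      (emittedWords prog wst).Nodup ∧ (∀ v ∈ emittedWords prog wst, v ∉ ws) ∧
        LinearIndepOn F31 rowSeries (ws ∪ {v | v ∈ emittedWords prog wst}) := by
  obtain ⟨rfl, rfl, rfl, rfl, rfl, hlo₁, hhi₁, rfl, hlo₂, hhi₂, rfl, rfl⟩ := S
  induction prog with
  | nil =>
    intro st wst ws P el c _ hinv _ _
    simpa [emittedWords] using hinv.indep
  | cons i prog ih =>
    intro st wst ws P el c hst hinv hc hrun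
    rw [List.length_cons] at hc
    cases hst with
    | nil => exact absurd hrun (by simp [runMachine])
    | @cons top w₀ tl wtl htop htl =>
      cases i with
      | zero => exact ih tl wtl ws P el c htl hinv (by omega) hrun
      | succ j =>
        rw [runMachine_succ, strictly_eq] at hrun
        obtain ⟨f, hf, hrun⟩ := lookupSeq_eq_true hrun
        obtain ⟨hf1, hf2, hf3⟩ := hF _ f hf
        change F[j % 32]? = some f at hf
        rw [show Nat.mod j 32 = j % 32 from rfl] at hf2
        rw [show Nat.div j 32 = j / 32 from rfl] at hrun
        rcases hj : j / 32 with _ | n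
        · rw [hj] at hrun
          change extendSeq _ _ _ _ _ _ _ _ = true at hrun
          obtain ⟨l, h1, h2, h3⟩ := extendSeq_correct (r := j % 32) (w := w₀) rfl hlo₁ hhi₁ f top 0 0
            (by rw [htop.1, hf1])
            (fun a x ha ha' => by simpa using hf2 a x ha (by omega))
            (fun a x ha => by simpa using htop.2 a x ha)
            (fun _ => by simpa [truncMod, truncSeries] using Packs.zero)
          rw [h1] at hrun
          rw [emittedWords, if_pos hj]
          refine ih _ _ ws P el c (List.Forall₂.cons ⟨by rw [h2, hf1], ?_⟩
            (List.Forall₂.cons htop htl)) hinv (by omega) hrun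
          exact fun a x ha => by simpa using h3 a x ha
        · rw [hj] at hrun
          change dotSeq _ _ _ _ _ = true at hrun
          obtain ⟨x, h1, h2⟩ := dotSeq_correct (m := m) (r := j % 32) (w := w₀) rfl f top 0 0 0
            (by rw [htop.1, hf1]) (by rintro rfl; simp at hf1)
            (fun a x ha ha' => by simpa using hf2 a x ha (by omega))
            (fun a x ha ha' => by
              obtain rfl : a = H := by omega
              simpa using hf3 x ha)
            (fun a x ha => by simpa using htop.2 a x ha)
            (by simpa [truncMod, truncSeries] using Packs.zero)
          rw [h1] at hrun
          rw [hf1, zero_add, Nat.add_sub_cancel] at h2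
          have h3 := h2.congr fun n hn =>
            coeff_rowSeries_cons (j % 32) w₀ (m := m) hn (by omega)
          -- This estimate is what ties the digit size 40 to `m ≤ 460`: at most 231 products and
          -- 2000 pivots fit.
          have hbound : (H + 1) * (22000 * 131072) + c * 3100 < 2 ^ 40 := by
            have h4 : (H + 1) * (22000 * 131072) ≤ 231 * (22000 * 131072) :=
              Nat.mul_le_mul_right _ (by omega)
            have h5 : c * 3100 ≤ 2000 * 3100 := Nat.mul_le_mul_right _ (by omega)
            exact (Nat.add_le_add h4 h5).trans_lt (by norm_num)
          obtain ⟨y, g, e1, e2, e3, e4⟩ := hinv.elim _ _ _ hbound h3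
          rw [e1] at hrun
          obtain ⟨z, f1, f2⟩ := normalizeRow_correct (m := m) rfl rfl hlo₁ hhi₁ hlo₂ hhi₂ e2
            hbound
          rw [f1, strictly_eq, strictly_eq] at hrun
          set s := Nat.sub (40 * m) (Nat.mul 40 n.succ) with hs
          set a := digitAt 31 (2 ^ 40) s z with ha
          rcases hac : a with _ | a'
          · rw [hac] at hrun
            rcases hmn : Nat.sub m n.succ with _ | t <;> rw [hmn] at hrun <;>
              exact absurd hrun (by simp)
          · rw [hac] at hrun
            rcases hmn : Nat.sub m n.succ with _ | t
            · rw [hmn] at hrun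
              exact absurd hrun (by simp)
            · rw [hmn] at hrun
              have hn : n + 1 < m := by
                have : m - (n + 1) = t + 1 := hmn
                omega
              change strictly _ _ = true at hrun
              rw [strictly_eq, strictly_eq] at hrun
              have hdig : ((a : ℕ) : F31) = PowerSeries.coeff (n + 1) g := by
                rw [← f2.digit (by norm_num) hn]
                exact ZMod.natCast_mod _ 31
              have ha31 : a < 31 := Nat.mod_lt _ (by norm_num)
              have hane : ((a : ℕ) : F31) ≠ 0 := by
                rw [Ne, ZMod.natCast_eq_zero_iff]
                exact fun hd => absurd (Nat.le_of_dvd (by omega) hd) (by omega)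
              rw [← hac] at hrun
              set v := Nat.mod (Nat.pow a 29) 31 with hv
              have hv1 : ((v : ℕ) : F31) * PowerSeries.coeff (n + 1) g = 1 := by
                have : ((v : ℕ) : F31) = (a : F31) ^ 29 := by
                  rw [← Nat.cast_pow]
                  exact ZMod.natCast_mod _ 31
                rw [this, ← hdig, ← pow_succ]
                exact ZMod.pow_card_sub_one_eq_one hane
              have hv31 : v < 31 := Nat.mod_lt _ (by norm_num)
              -- Digits at most 65 · 30 = 1950 fold to at most 31 + 60, within the bound 100 for
              -- stored rows.
              have hb := ((f2.mul_const v).mono (show 65 * v ≤ 1950 by omega)).foldBits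
                (by norm_num) (by norm_num) (by decide) hlo₂ hhi₂
              obtain ⟨hw1, hw2⟩ := hinv.insert (w := j % 32 :: w₀) e3 e4 hn rfl
                (by rw [map_smul, smul_eq_mul, hv1]) (hb.mono (by norm_num)) (s := s) rfl
              obtain ⟨i1, i2, i3⟩ := ih _ _ _ _ _ _ (List.Forall₂.cons htop htl) hw2 (by omega) hrun
              rw [emittedWords, if_neg (by omega)]
              refine ⟨List.nodup_cons.mpr ⟨fun hmem => i2 _ hmem (Set.mem_insert _ _), i1⟩, ?_, ?_⟩
              · intro u hu
                rcases List.mem_cons.mp hu with rfl | hu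
                · exact hw1
                · exact fun hu' => i2 u hu (Set.mem_insert_of_mem _ hu')
              · convert i3 using 1
                ext u
                simp only [Set.mem_union, Set.mem_ofPred_eq, List.mem_cons, Set.mem_insert_iff]
                tauto

/-- The digits of a factor, with a salt in the last digit. -/
def letterDigits (m r u salt n : ℕ) : ℕ :=
  (if 0 < n ∧ u ∣ n then (n / u) ^ r % 31 else 0) + if n = m then salt else 0

theorem packDigits_single (B m c : ℕ) :
    packDigits B (m + 1) (fun n => if n = m then c else 0) = c := by
  rw [packDigits, Finset.sum_eq_single m]
  · simp
  · intro n _ hn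
    simp [hn]
  · intro h
    simp at h

theorem packLetter_eq {B m β r u vmax : ℕ} (hB : B = 2 ^ β) (hu : 0 < u) (hv : vmax = m / u) :
    packLetter 31 2 (β * m) (β * u) r vmax =
      packDigits B (m + 1) fun n => if 0 < n ∧ u ∣ n then (n / u) ^ r % 31 else 0 := by
  have h1 : ∀ V, packLetter 31 2 (β * m) (β * u) r V =
      ∑ v ∈ Finset.range V, (v + 1) ^ r % 31 * 2 ^ (β * m - β * u * (v + 1)) := by
    intro V
    induction V with
    | zero => rfl
    | succ V ih =>
      rw [Finset.sum_range_succ, ← ih]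
      rfl
  rw [h1, packDigits]
  simp only [ite_mul, zero_mul]
  rw [← Finset.sum_filter]
  refine Finset.sum_nbij' (fun v => u * (v + 1)) (fun n => n / u - 1) ?_ ?_ ?_ ?_ ?_
  · intro v hv'
    rw [Finset.mem_range, hv, Nat.lt_iff_add_one_le, Nat.le_div_iff_mul_le hu] at hv'
    rw [Finset.mem_filter, Finset.mem_range]
    refine ⟨?_, Nat.mul_pos hu (Nat.succ_pos _), dvd_mul_right _ _⟩
    rw [mul_comm u]
    omega
  · intro n hn
    rw [Finset.mem_filter, Finset.mem_range] at hn
    rw [Finset.mem_range, hv]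
    obtain ⟨h2, h3, c, rfl⟩ := hn
    rw [Nat.mul_div_cancel_left _ hu]
    have hc : c ≤ m / u := (Nat.le_div_iff_mul_le hu).mpr (by rw [mul_comm]; omega)
    have : 0 < c := Nat.pos_of_ne_zero fun h => by simp [h] at h3
    omega
  · intro v _
    rw [Nat.mul_div_cancel_left _ hu]
    rfl
  · intro n hn
    rw [Finset.mem_filter] at hn
    obtain ⟨_, h3, c, rfl⟩ := hn
    rw [Nat.mul_div_cancel_left _ hu]
    have : 0 < c := Nat.pos_of_ne_zero fun h => by simp [h] at h3
    rw [Nat.sub_add_cancel this]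
  · intro v hv'
    rw [Nat.mul_div_cancel_left _ hu, hB, ← pow_mul, Nat.add_sub_cancel, Nat.mul_sub, mul_assoc]

/-- The 461 residues of size at most 30 and the salt add up to at most 21830, which explains the
bound 22000. -/
theorem packsFactor_letter {m r u salt : ℕ} (hu : 0 < u) (hm : m ≤ 460) (hs : salt ≤ 8000) :
    PacksFactor 40 m 22000
      (Nat.add (packLetter 31 2 (40 * m) (40 * u) r (m / u)) salt) (letterMod r u) := by
  refine ⟨letterDigits m r u salt, ?_, fun n hn => ?_, ?_⟩
  · have h1 : ∑ n ∈ Finset.range (m + 1), (if n = m then salt else 0) = salt := by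
      simp
    simp only [letterDigits, Finset.sum_add_distrib, h1]
    have h2 : ∑ n ∈ Finset.range (m + 1), (if 0 < n ∧ u ∣ n then (n / u) ^ r % 31 else 0) ≤
        ∑ n ∈ Finset.range (m + 1), 30 := by
      refine Finset.sum_le_sum fun n _ => ?_
      split_ifs
      · exact Nat.le_of_lt_succ (Nat.mod_lt _ (by norm_num))
      · exact Nat.zero_le _
    simp only [Finset.sum_const, Finset.card_range, smul_eq_mul] at h2
    omega
  · rw [letterDigits, if_neg (show n ≠ m by omega), add_zero, letterMod, PowerSeries.coeff_map,
      letterSeries, PowerSeries.coeff_mk]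
    split_ifs with h
    · rw [ZMod.natCast_mod, Nat.cast_pow]
      simp only [map_pow, eq_intCast, Int.cast_natCast]
    · simp
  · rw [packLetter_eq rfl hu rfl]
    conv_lhs => rw [← packDigits_single (2 ^ 40) m salt]
    exact packDigits_add _ _ _ _

theorem packsFactor_tail {m H salt : ℕ} (hH : H ≤ m) (hm : m ≤ 460) (hs : salt ≤ 8000) :
    PacksFactor 40 m 22000
      (Nat.add (((2 ^ 40) ^ (m - H) - 1) / (2 ^ 40 - 1)) salt) (tailSeries H) := by
  refine ⟨fun n => (if H < n then 1 else 0) + if n = m then salt else 0, ?_, fun n hn => ?_, ?_⟩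
  · rw [Finset.sum_add_distrib]
    have h1 : ∑ n ∈ Finset.range (m + 1), (if n = m then salt else 0) = salt := by
      simp
    have h2 : ∑ n ∈ Finset.range (m + 1), (if H < n then 1 else 0) ≤
        ∑ n ∈ Finset.range (m + 1), 1 :=
      Finset.sum_le_sum fun n _ => by split_ifs <;> omega
    simp only [Finset.sum_const, Finset.card_range, smul_eq_mul] at h2
    omega
  · dsimp only
    rw [if_neg (show n ≠ m by omega), tailSeries, PowerSeries.coeff_mk]
    simp
  · rw [← packDigits_add, packDigits_single]
    refine congrArg (· + salt) ?_
    rw [← Nat.geomSum_eq (by norm_num), packDigits]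
    simp only [ite_mul, one_mul, zero_mul]
    rw [← Finset.sum_filter]
    refine Finset.sum_nbij' (fun i => m - i) (fun n => m - n) ?_ ?_ ?_ ?_ ?_
    · intro i hi
      rw [Finset.mem_range] at hi
      rw [Finset.mem_filter, Finset.mem_range]
      omega
    · intro n hn
      rw [Finset.mem_filter, Finset.mem_range] at hn
      rw [Finset.mem_range]
      omega
    · intro i hi
      rw [Finset.mem_range] at hi
      omega
    · intro n hn
      rw [Finset.mem_filter, Finset.mem_range] at hn
      omega
    · intro i hi
      rw [Finset.mem_range] at hi
      rw [show m + 1 - 1 - (m - i) = i by omega]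

theorem letterSeq_eq_true {m r salt H : ℕ} (hm : m ≤ 460) (hs : salt + H ≤ 8000) :
    ∀ {l : List ℕ} {i : ℕ} {k : List ℕ → Bool}, l.length = i + 1 →
      (∀ j x, l[j]? = some x → j < i → PacksFactor 40 m 22000 x (letterMod r (H + j + 1))) →
      (∀ x, l[i]? = some x → PacksFactor 40 m 22000 x (tailSeries (H + i))) →
      letterSeq m 31 40 (40 * m) r salt H l k = true →
      ∃ f, IsLetterSeq m (H + i) f r ∧ k f = true := by
  induction H with
  | zero =>
    intro l i k h1 h2 h3 h
    refine ⟨l, ⟨by omega, fun j x hj hji => ?_, fun x hx => ?_⟩, h⟩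
    · simpa using h2 j x hj (by omega)
    · rw [zero_add] at hx ⊢
      simpa using h3 x hx
  | succ H ih =>
    intro l i k h1 h2 h3 h
    change strictly _ (fun x => letterSeq m 31 40 (40 * m) r salt H (x :: l) k) = true at h
    rw [strictly_eq] at h
    have := ih (by omega) (i := i + 1) (by simp [h1]) (fun j x hj hji => ?_) (fun x hx => ?_) h
    · rwa [show H + (i + 1) = H + 1 + i by ring] at this
    · cases j with
      | zero =>
        simp only [List.getElem?_cons_zero, Option.some.injEq] at hj
        rw [← hj]
        exact packsFactor_letter (Nat.succ_pos H) hm (salt := salt + H) (by omega)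
      | succ j =>
        have := h2 j x (by simpa using hj) (by omega)
        rwa [show H + 1 + j + 1 = H + (j + 1) + 1 by ring] at this
    · have := h3 x (by simpa using hx)
      rwa [show H + 1 + i = H + (i + 1) by ring] at this

theorem letterSeqs_eq_true {m H : ℕ} (hm : m ≤ 460) (hH : H ≤ m) {R : ℕ} (hR : R ≤ 15) :
    ∀ {l : List (List ℕ)} {k : List (List ℕ) → Bool},
      (∀ r f, l[r]? = some f → IsLetterSeq m H f (R + r)) →
      letterSeqs m 31 40 (40 * m) H (((2 ^ 40) ^ (m - H) - 1) / (2 ^ 40 - 1)) R l k = true →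
      ∃ F : List (List ℕ), (∀ r f, F[r]? = some f → IsLetterSeq m H f r) ∧ k F = true := by
  induction R with
  | zero =>
    intro l k h1 h
    exact ⟨l, fun r f hf => by simpa using h1 r f hf, h⟩
  | succ R ih =>
    intro l k h1 h
    change strictly _ (fun salt => strictly _ fun y => letterSeq m 31 40 (40 * m) R salt H [y]
      fun x => letterSeqs m 31 40 (40 * m) H _ R (x :: l) k) = true at h
    rw [strictly_eq, strictly_eq] at h
    have hs : Nat.mul R 512 + H ≤ 8000 := by
      change R * 512 + H ≤ 8000
      omega
    obtain ⟨f, h2, h3⟩ := letterSeq_eq_true (i := 0) hm hs rfl (by simp) (fun x hx => by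
      simp only [List.getElem?_cons_zero, Option.some.injEq] at hx
      rw [← hx]
      exact packsFactor_tail hH hm ((Nat.le_add_right _ _).trans hs)) h
    refine ih (by omega) (fun r g hg => ?_) h3
    cases r with
    | zero =>
      simp only [List.getElem?_cons_zero, Option.some.injEq] at hg
      rw [← hg]
      exact h2
    | succ r =>
      have := h1 r g (by simpa using hg)
      rwa [show R + 1 + r = R + (r + 1) by ring] at this

theorem rowSeries_nil : rowSeries [] = 1 := by
  ext n
  have := coeff_truncSeries_self n []
  rw [rowSeries, PowerSeries.coeff_mk, ← this, truncSeries_nil, PowerSeries.coeff_one,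
    PowerSeries.coeff_one]
  split_ifs <;> simp

theorem packs_one {m b : ℕ} (hb : 1 ≤ b) : Packs 40 m b (2 ^ (40 * m)) 1 := by
  refine ⟨fun n => if n = 0 then 1 else 0, fun n => by dsimp only; split_ifs <;> omega,
    fun n _ => ?_, ?_⟩
  · rw [PowerSeries.coeff_one]
    split_ifs with h <;> simp [h]
  · rw [packDigits, Finset.sum_eq_single 0]
    · simp [pow_mul]
    · intro n _ hn
      simp [hn]
    · simp

/-- The words whose rows are computed by a successful program are independent. -/
theorem checkProgram_correct {m R : ℕ} {prog : List ℕ} (h0 : 0 < m) (hm : m ≤ 460) (hR : R ≤ 15)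
    (hlen : prog.length < 2000) (h : checkProgram m R prog = true) :
    ([] :: emittedWords prog [[]]).Nodup ∧
      LinearIndepOn F31 rowSeries {v | v ∈ [] :: emittedWords prog [[]]} := by
  simp only [checkProgram, strictly_eq] at h
  obtain ⟨F, hF, h⟩ := letterSeqs_eq_true hm (Nat.div_le_self m 2) hR (by simp) h
  have hone : ∀ b, 1 ≤ b → Packs 40 m b (2 ^ (40 * m)) 1 := fun b hb => packs_one hb
  -- The empty word, with series 1, is the first row and takes the pivot 0.
  obtain ⟨_, h1⟩ := (ElimInv.empty m).insert (w := []) (f := 1) (g := 1) (q := 0) (v := 1)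
    (b := 2 ^ (40 * m)) (s := 40 * m) (by simp [rowSeries_nil]) (by simp) h0 (by simp) (by simp)
    (hone 100 (by norm_num)) rfl
  have h2 := runMachine_correct (H := m / 2)
    ⟨rfl, rfl, rfl, rfl, rfl, (packDigits_const _ _ _ (by norm_num)).symm,
      (packDigits_const _ _ _ (by norm_num)).symm, rfl,
      (packDigits_const _ _ _ (by norm_num)).symm, (packDigits_const _ _ _ (by norm_num)).symm,
      rfl, rfl⟩ hm rfl hF prog [List.replicate (m / 2 + 1) (2 ^ (40 * m))] [[]] _ _ _ _
      (List.Forall₂.cons ⟨by simp, fun j x hx => ?_⟩ List.Forall₂.nil) h1 (by omega) h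
  · obtain ⟨h3, h4, h5⟩ := h2
    refine ⟨List.nodup_cons.mpr ⟨fun hmem => h4 _ hmem (by simp), h3⟩, ?_⟩
    convert h5 using 1
    ext v
    simp
  · rw [List.getElem?_replicate] at hx
    split_ifs at hx
    simp only [Option.some.injEq] at hx
    rw [← hx, truncMod, truncSeries_nil, map_one]
    exact hone _ (by norm_num)

/-! ### Lower bounds -/

/-- The number of admissible words of weight at most `k` and length at most `l` in a list. -/
def admissibleCount (W : List (List ℕ)) (k l : ℕ) : ℕ :=
  (W.filter fun r => decide (r.length ≤ l ∧ r.sum + r.length ≤ k ∧ r.head? ≠ some 0)).length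

/-- A subfamily of an independent family is independent, so a single program serves many entries (k,
l) at once: only its words of the right weight and length are counted. -/
theorem admissibleCount_le_finrank {m R k l : ℕ} {prog : List ℕ} (h0 : 0 < m) (hm : m ≤ 460)
    (hR : R ≤ 15) (hlen : prog.length < 2000) (h : checkProgram m R prog = true) :
    admissibleCount ([] :: emittedWords prog [[]]) k l ≤ Module.finrank ℚ (filMDA k l) := by
  obtain ⟨h1, h2⟩ := checkProgram_correct h0 hm hR hlen h
  set W := [] :: emittedWords prog [[]] with hW
  set V := W.filter fun r => decide (r.length ≤ l ∧ r.sum + r.length ≤ k ∧ r.head? ≠ some 0)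
  have h3 : V.Nodup := h1.filter _
  have h4 : admissibleCount W k l = V.toFinset.card := (List.toFinset_card_of_nodup h3).symm
  rw [h4]
  refine card_le_finrank_filMDA _ ?_ fun r hr => ?_
  · have h5 := linearIndepOn_rat_of_zmod (p := 31)
      (fun (r : List ℕ) n => (multipleDivisorSum r.get n : ℤ)) V.toFinset ?_
    · simp only [Int.cast_natCast] at h5
      exact h5
    · have h6 : rowSeries = fun r : List ℕ => (PowerSeries.mk fun n =>
          (((multipleDivisorSum r.get n : ℕ) : ℤ) : F31)) := by
        funext r
        simp [rowSeries]
      rw [← h6]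
      refine h2.mono fun r hr => ?_
      rw [List.coe_toFinset] at hr
      exact List.mem_of_mem_filter hr
  · rw [List.mem_toFinset, List.mem_filter, decide_eq_true_eq] at hr
    refine ⟨hr.2.1, hr.2.2.1, fun a ha => Nat.pos_of_ne_zero ?_⟩
    rintro rfl
    exact hr.2.2.2 ha

/-- Whether a list of words has enough admissible words for the given rows of the table. -/
def countsSuffice (W : List (List ℕ)) (ks : List ℕ) : Bool :=
  ks.all fun k => (dimTable k).zipIdx.all fun d => decide (d.1 ≤ admissibleCount W k d.2)

theorem le_finrank_of_checks {m R : ℕ} {prog ks : List ℕ} (h0 : 0 < m) (hm : m ≤ 460)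
    (hR : R ≤ 15) (hlen : prog.length < 2000) (h : checkProgram m R prog = true)
    (hc : countsSuffice ([] :: emittedWords prog [[]]) ks = true) {k l d : ℕ} (hk : k ∈ ks)
    (hd : (dimTable k)[l]? = some d) : d ≤ Module.finrank ℚ (filMDA k l) := by
  rw [countsSuffice, List.all_eq_true] at hc
  have h1 := List.all_eq_true.mp (hc k hk) (d, l) (by
    rw [List.mk_mem_zipIdx_iff_getElem?]
    exact hd)
  exact (of_decide_eq_true h1).trans (admissibleCount_le_finrank h0 hm hR hlen h)

/-! ### Certificates for the lower bounds in the table -/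

/-- A program for the rows of weight at most 11. -/
def program11 : List ℕ :=
  [1, 1, 1, 1, 1, 1, 1, 1, 1, 1762, 0, 1442, 1731, 0, 1154, 1411, 1668, 0, 898, 2, 1, 1698, 0,
    1379, 0, 1123, 1348, 1573, 0, 674, 2, 1, 1, 1634, 0, 1538, 0, 1091, 1316, 0, 867, 3, 1, 1602,
    0, 1283, 0, 1060, 1253, 1478, 0, 482, 2, 1, 1, 1, 1794, 0, 1506, 1827, 0, 1218, 0, 835, 1028,
    1861, 0, 643, 3, 1, 1, 1890, 0, 1922, 0, 995, 1188, 0, 804, 4, 1, 1954, 0, 1987, 0, 965, 2022,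
    2055, 0, 322, 2, 1, 1, 1, 1, 2082, 0, 2114, 2147, 0, 2178, 2211, 2244, 0, 930, 2, 1, 2274, 0,
    0, 2309, 0, 2, 2340, 0, 611, 3, 1, 2370, 0, 0, 772, 2405, 2438, 0, 451, 3, 1, 1, 1, 2466, 0,
    2530, 2499, 0, 2562, 0, 739, 2596, 2629, 0, 580, 4, 1, 1, 2658, 0, 2690, 0, 2723, 2756, 0,
    709, 5, 1, 2786, 0, 2818, 2851, 0, 2886, 6, 2946, 0, 2919, 2984, 0, 194, 2, 1, 1, 1, 1, 1,
    3010, 0, 3042, 3075, 0, 3106, 3139, 3172, 0, 3202, 2, 1, 3234, 0, 3267, 0, 3299, 3332, 0,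
    3362, 2, 1, 1, 3394, 0, 3426, 0, 0, 3461, 3494, 0, 2, 3525, 0, 419, 3, 1, 1, 3554, 0, 3586, 0,
    0, 548, 4, 1, 3618, 0, 3651, 0, 3685, 3718, 3751, 0, 291, 3, 1, 1, 1, 1, 3778, 0, 3810, 3843,
    0, 3874, 3907, 3940, 0, 3970, 2, 1, 4002, 0, 0, 4037, 0, 515, 3, 1, 4066, 0, 0, 4100, 4133,
    4166, 0, 388, 4, 1, 1, 1, 4194, 0, 4226, 4259, 0, 4290, 0, 4323, 4356, 4389, 0, 4421, 5, 1, 1,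
    4450, 0, 4482, 0, 4514, 4547, 4580, 0, 4614, 6, 1, 4642, 0, 4674, 4707, 0, 4743, 7, 4770, 0,
    4808, 4841, 0, 98, 2, 1, 1, 1, 1, 1, 1, 4866, 0, 4898, 4931, 0, 4962, 4995, 5028, 0, 5058, 2,
    1, 5090, 0, 5123, 0, 5155, 5188, 5221, 0, 5282, 2, 1, 1, 5250, 0, 5314, 0, 5347, 5380, 0,
    5411, 3, 1, 5442, 0, 0, 5476, 5510, 0, 5538, 2, 1, 1, 1, 5602, 0, 5570, 5635, 0, 5666, 0, 0,
    5701, 5734, 5767, 0, 2, 5797, 5830, 0, 259, 3, 1, 1, 1, 5858, 0, 5890, 5923, 0, 5954, 0, 5989,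
    0, 356, 4, 1, 1, 6018, 0, 6050, 0, 6083, 6116, 0, 6149, 5, 1, 6178, 0, 6211, 0, 6246, 6, 6274,
    0, 6311, 6344, 0, 163, 3, 1, 1, 1, 1, 1, 6370, 0, 6402, 6435, 0, 6466, 6499, 6532, 0, 6562, 2,
    1, 6594, 0, 6627, 0, 6659, 6692, 0, 6722, 2, 1, 1, 6754, 0, 6786, 0, 0, 6822, 0, 6851, 3, 1,
    1, 6882, 0, 6946, 0, 0, 6916, 4, 1, 6978, 0, 0, 7013, 7046, 7079, 0, 228, 4, 1, 1, 1, 1, 7106,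
    0, 7138, 7171, 0, 7202, 7235, 7268, 0, 7298, 2, 1, 7330, 0, 0, 0, 7363, 3, 1, 7394, 0, 0,
    7428, 7461, 7494, 0, 7525, 5, 1, 1, 1, 7554, 0, 7586, 7619, 0, 7650, 0, 7682, 2, 1, 7714, 0,
    0, 7747, 7780, 7813, 0, 7846, 6, 1, 1, 7874, 0, 7906, 0, 7938, 7971, 8004, 0, 8039, 7, 1,
    8066, 0, 8098, 8131, 0, 8168, 8, 8194, 0, 8233, 8266, 0, 34, 2, 1, 1, 1, 1, 1, 1, 1, 8290, 0,
    8322, 8355, 0, 8386, 8419, 8452, 0, 8482, 2, 1, 8514, 0, 8547, 0, 8579, 8612, 8645, 0, 8674,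
    2, 1, 1, 8706, 0, 8738, 0, 8771, 8804, 0, 8835, 3, 1, 8866, 0, 8899, 0, 8932, 8965, 8998, 0,
    9026, 2, 1, 1, 1, 9058, 0, 9090, 9123, 0, 9154, 0, 9187, 9220, 9253, 0, 9283, 3, 1, 1, 9314,
    0, 9346, 0, 0, 9380, 4, 1, 9410, 0, 0, 9446, 0, 9474, 2, 1, 1, 1, 1, 9506, 0, 9538, 9571, 0,
    9602, 9635, 9668, 0, 9698, 2, 1, 9730, 0, 0, 0, 0, 9767, 9800, 0, 2, 9830, 9863, 0, 131, 3, 1,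
    1, 1, 1, 9890, 0, 9922, 9955, 0, 9986, 10019, 10052, 0, 10082, 2, 1, 10114, 0, 0, 0, 0, 10148,
    4, 1, 1, 1, 10178, 0, 10210, 10243, 0, 10274, 0, 0, 10309, 5, 1, 1, 10338, 0, 10370, 0, 0,
    10406, 6, 1, 10434, 0, 0, 10471, 10504, 10537, 0, 67, 3, 1, 1, 1, 1, 1, 1, 10594, 0, 10562,
    10627, 0, 10658, 10691, 10724, 0, 10754, 2, 1, 10786, 0, 10819, 0, 10851, 10884, 10917, 0,
    10946, 2, 1, 1, 10978, 0, 11010, 0, 11043, 11076, 0, 11107, 3, 1, 11138, 0, 0, 11172, 11206,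
    0, 11234, 2, 1, 1, 1, 11266, 0, 11298, 11331, 0, 11362, 0, 0, 0, 11396, 4, 1, 1, 11426, 0,
    11458, 0, 0, 11493, 5, 1, 11522, 0, 0, 11558, 11591, 11624, 0, 11652, 4, 1, 1, 1, 1, 1, 11682,
    0, 11746, 11715, 0, 11778, 11811, 11844, 0, 11874, 2, 1, 11906, 0, 11939, 0, 11971, 12004, 0,
    12034, 2, 1, 1, 12066, 0, 12098, 0, 0, 0, 12133, 12166, 12199, 0, 12229, 5, 1, 1, 1, 1, 12258,
    0, 12290, 12323, 0, 12354, 12387, 12420, 0, 12450, 2, 1, 12482, 0, 0, 0, 12518, 0, 12550, 6,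
    1, 1, 1, 12578, 0, 12610, 12643, 0, 12674, 0, 0, 12711, 7, 1, 1, 12738, 0, 12770, 0, 0, 12808,
    8, 1, 12834, 0, 0, 12873, 12906, 12971]

set_option maxRecDepth 100000 in
set_option maxHeartbeats 0 in
theorem checkProgram_program11 : checkProgram 406 15 program11 = true := by
  decide +kernel

set_option maxRecDepth 100000 in
set_option maxHeartbeats 0 in
theorem countsSuffice_program11 :
    countsSuffice ([] :: emittedWords program11 [[]]) [0, 1, 2, 3, 4, 5, 6, 7, 8, 9, 10, 11] = true := by
  decide +kernel

/-- A program for the rows of weight 12. -/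
def program12 : List ℕ :=
  [1, 1, 1, 1, 1, 674, 867, 1060, 1253, 1446, 1639, 0, 482, 2, 835, 1028, 1221, 1414, 0, 643, 3,
    995, 1188, 1381, 0, 804, 4, 1155, 1348, 0, 965, 5, 1315, 0, 1126, 6, 1474, 0, 1287, 1608, 0,
    322, 2, 1, 930, 1093, 1510, 0, 2, 1540, 1573, 0, 611, 772, 4, 1667, 0, 1701, 1734, 1767, 0,
    451, 3, 1, 1794, 1829, 0, 739, 900, 1861, 1894, 0, 580, 4, 1, 1922, 0, 1955, 1988, 2021, 0,
    709, 5, 1, 2050, 0, 2082, 2115, 2148, 0, 2182, 6, 1, 2210, 0, 2242, 2275, 0, 2311, 7, 2338, 0,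
    2376, 2409, 0, 194, 2, 1, 1, 2434, 2467, 2500, 2534, 0, 2562, 2597, 2630, 2695, 0, 2, 2725,
    2662, 0, 419, 3, 1, 2754, 0, 2789, 0, 548, 4, 1, 2818, 0, 2851, 2884, 0, 2917, 5, 1, 2946, 0,
    2979, 0, 3014, 6, 3042, 0, 3079, 3112, 0, 291, 3, 1, 1, 3138, 3171, 3204, 0, 3234, 3301, 3270,
    0, 2, 3333, 0, 515, 3, 1, 3362, 0, 0, 3396, 4, 1, 3426, 0, 3459, 0, 3493, 5, 3522, 0, 3558,
    3591, 0, 388, 4, 1, 1, 3618, 3651, 3684, 0, 3714, 3749, 0, 3811, 3, 1, 3778, 0, 0, 3844, 3877,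
    3910, 0, 3941, 5, 1, 1, 4002, 3971, 0, 4034, 0, 4066, 2, 1, 4098, 0, 0, 4131, 4164, 4197, 0,
    4230, 6, 1, 1, 4258, 0, 4290, 0, 4322, 4355, 4388, 0, 4423, 7, 1, 4450, 0, 4482, 4515, 0,
    4552, 8, 4578, 0, 4617, 4650, 0, 98, 2, 1, 1, 1, 4674, 4707, 4740, 4773, 4806, 0, 4834, 2,
    4867, 4900, 4933, 0, 4963, 4996, 5030, 0, 5058, 2, 1, 5090, 0, 0, 5125, 5, 1, 5154, 0, 0,
    5190, 5223, 5256, 0, 2, 5285, 5318, 5351, 0, 259, 3, 1, 1, 5378, 5411, 5444, 0, 5474, 0, 5509,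
    5542, 0, 356, 4, 1, 1, 5570, 5603, 0, 5634, 0, 5699, 5668, 5733, 0, 5765, 5, 1, 1, 5826, 0,
    5794, 0, 5859, 5892, 0, 5926, 6, 1, 5954, 0, 5986, 6019, 0, 6055, 7, 6082, 0, 6120, 6185, 0,
    163, 3, 1, 1, 1, 6146, 6211, 6244, 6277, 0, 6306, 2, 6339, 6372, 0, 6403, 6436, 6470, 0, 6498,
    2, 1, 6530, 0, 0, 6566, 6599, 0, 2, 6630, 0, 6659, 3, 1, 1, 6690, 6723, 0, 6754, 0, 6789, 0,
    6820, 4, 1, 1, 6850, 0, 6882, 0, 6916, 0, 6949, 5, 1, 6978, 0, 0, 7014, 7047, 7080, 0, 228, 4,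
    1, 1, 1, 7106, 7139, 7172, 0, 7202, 2, 7235, 0, 7267, 7300, 0, 7330, 2, 1, 7362, 0, 0, 0,
    7395, 3, 1, 1, 7426, 0, 7458, 0, 0, 7524, 4, 1, 7490, 0, 0, 7557, 7590, 7623, 0, 7653, 5, 1,
    1, 1, 7682, 7715, 0, 7746, 7779, 7812, 0, 7842, 2, 1, 7874, 0, 0, 0, 7906, 2, 1, 1, 7938, 0,
    7970, 0, 0, 8035, 3, 1, 8002, 0, 0, 8068, 8101, 8134, 0, 8166, 6, 1, 1, 1, 8194, 0, 8226,
    8259, 0, 8290, 0, 8322, 2, 1, 8354, 0, 0, 8387, 8420, 8453, 0, 8487, 7, 1, 1, 8514, 0, 8546,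
    0, 8578, 8611, 8644, 0, 8680, 8, 1, 8706, 0, 8738, 8771, 0, 8809, 9, 8834, 0, 8874, 8907, 0,
    34, 2, 1, 1, 1, 1, 8930, 8963, 8996, 9029, 9062, 0, 9090, 2, 9123, 9156, 9189, 0, 9251, 3,
    9219, 9284, 0, 9316, 4, 9347, 0, 9381, 9414, 9447, 0, 9474, 2, 1, 9506, 9541, 0, 9571, 9604,
    9637, 9670, 0, 9699, 3, 1, 9730, 0, 0, 9764, 4, 1, 9794, 0, 0, 9830, 9864, 0, 9890, 2, 1, 1,
    9922, 9955, 9988, 0, 10018, 0, 0, 10055, 10088, 10121, 0, 2, 10150, 10183, 10216, 0, 131, 3,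
    1, 1, 1, 10242, 10275, 10308, 0, 10338, 2, 10371, 0, 10403, 10436, 0, 10466, 2, 1, 10498, 0,
    0, 0, 10535, 0, 10564, 4, 1, 1, 1, 10594, 10627, 0, 10690, 10659, 10724, 0, 10754, 2, 1,
    10786, 0, 0, 0, 10822, 0, 10853, 5, 1, 1, 1, 10882, 0, 10914, 10979, 0, 10946, 0, 0, 11014, 6,
    1, 1, 11042, 0, 11074, 0, 0, 11111, 7, 1, 11138, 0, 0, 11176, 11209, 11242, 0, 67, 3, 1, 1, 1,
    1, 11266, 11299, 11332, 11365, 0, 11394, 2, 11427, 11460, 0, 11491, 3, 11523, 0, 11556, 11589,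
    11622, 0, 11650, 2, 1, 11682, 0, 11715, 11748, 11781, 0, 11811, 3, 1, 11842, 0, 0, 11876, 4,
    1, 11906, 0, 0, 11942, 0, 11970, 2, 1, 1, 12002, 12035, 12068, 0, 12098, 0, 0, 0, 12132, 4, 1,
    1, 1, 12162, 0, 12194, 12227, 0, 12258, 0, 0, 12293, 5, 1, 1, 12322, 0, 12354, 0, 0, 12390, 6,
    1, 12418, 0, 0, 12455, 12488, 12521, 0, 12548, 4, 1, 1, 1, 1, 12578, 12611, 12644, 0, 12706,
    2, 12675, 0, 12739, 12772, 12805, 0, 12834, 2, 1, 12866, 0, 12899, 12932, 0, 12963, 3, 1,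
    12994, 0, 0, 13028, 13062, 0, 13090, 2, 1, 1, 13122, 13155, 0, 13186, 0, 0, 0, 13221, 5, 1,
    13250, 0, 0, 13286, 13319, 13352, 0, 13381, 5, 1, 1, 1, 1, 13410, 13443, 0, 13474, 13507,
    13540, 0, 13570, 2, 1, 13602, 0, 13635, 0, 13667, 13700, 0, 13762, 2, 1, 1, 13730, 0, 13794,
    0, 0, 0, 13830, 13863, 0, 13894, 6, 1, 1, 1, 1, 13922, 0, 13954, 13987, 0, 14018, 14051,
    14084, 0, 14114, 2, 1, 14146, 0, 0, 0, 0, 14183, 7, 1, 1, 1, 14210, 0, 14242, 14275, 0, 14306,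
    0, 0, 14344, 8, 1, 1, 14370, 0, 14402, 0, 0, 14441, 9, 1, 14466, 0, 0, 14506, 14539, 14572]

set_option maxRecDepth 100000 in
set_option maxHeartbeats 0 in
theorem checkProgram_program12 : checkProgram 457 15 program12 = true := by
  decide +kernel

set_option maxRecDepth 100000 in
set_option maxHeartbeats 0 in
theorem countsSuffice_program12 :
    countsSuffice ([] :: emittedWords program12 [[]]) [12] = true := by
  decide +kernel

/-- A program for the rows of weight 13 and 14. -/
def program14 : List ℕ :=
  [1, 1, 1, 322, 451, 580, 709, 838, 967, 1096, 1225, 1354, 1483, 0, 194, 2, 419, 548, 677, 806,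
    935, 1064, 1193, 1322, 0, 291, 3, 515, 644, 773, 902, 1031, 1160, 1289, 0, 388, 4, 611, 740,
    869, 998, 1127, 1256, 0, 485, 5, 1378, 1411, 1444, 1509, 1542, 1575, 0, 1606, 6, 1634, 1667,
    1700, 1733, 1766, 0, 1799, 7, 1826, 1859, 1892, 1925, 0, 1960, 8, 2018, 1987, 2052, 0, 2089,
    9, 2114, 2179, 0, 2154, 10, 2210, 0, 2251, 2284, 0, 98, 2, 1, 2306, 2341, 2374, 2407, 2440,
    2505, 2474, 0, 2, 2533, 2566, 2599, 2632, 2665, 0, 259, 3, 2693, 2726, 2759, 2792, 0, 356, 4,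
    2819, 2852, 2885, 2918, 2951, 0, 2981, 5, 3011, 3076, 3045, 3110, 0, 3142, 6, 3170, 3203,
    3236, 3269, 0, 3303, 7, 3330, 3363, 3396, 0, 3432, 8, 3458, 3491, 0, 3529, 9, 3554, 0, 3594,
    3627, 0, 163, 3, 1, 3650, 3686, 3719, 3752, 3785, 0, 2, 3814, 3847, 3880, 0, 3907, 3, 3941,
    3974, 4007, 0, 4036, 4, 4068, 4101, 4134, 0, 4165, 5, 4196, 4229, 0, 4262, 6, 4291, 4324, 0,
    4359, 7, 4386, 4419, 0, 4456, 8, 4482, 0, 4521, 4554, 0, 228, 4, 1, 4578, 4615, 4648, 0, 2,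
    4678, 4711, 0, 4739, 3, 4774, 0, 4804, 4, 4837, 0, 4869, 5, 4900, 0, 4934, 4967, 5000, 5033,
    0, 5061, 5, 1, 5090, 0, 5122, 5155, 5188, 5221, 5286, 5255, 5320, 0, 5350, 6, 1, 5378, 0,
    5410, 5443, 5476, 5509, 5542, 5575, 0, 5607, 7, 1, 5634, 0, 5666, 5699, 5732, 5765, 5798, 0,
    5832, 8, 1, 5858, 0, 5890, 5923, 5956, 5989, 0, 6025, 9, 1, 6050, 0, 6082, 6115, 6148, 0,
    6186, 10, 1, 6210, 0, 6242, 6275, 0, 6315, 11, 6338, 0, 6380, 6445, 0, 34, 2, 1, 1, 6402,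
    6467, 6500, 6534, 6568, 6602, 0, 6626, 6663, 6696, 6729, 6762, 6795, 0, 2, 6822, 6855, 6888,
    6921, 6954, 0, 131, 3, 1, 6978, 0, 7015, 7048, 7081, 0, 7108, 4, 1, 7138, 0, 7174, 7207, 7240,
    0, 7269, 5, 1, 7330, 0, 7302, 7367, 0, 7398, 6, 1, 7426, 0, 7462, 0, 7495, 7, 1, 7522, 0,
    7557, 0, 7592, 8, 1, 7618, 0, 7652, 0, 7689, 9, 1, 7714, 0, 0, 7754, 7787, 7820, 0, 67, 3, 1,
    1, 7842, 7875, 7908, 7942, 7976, 0, 8002, 0, 8036, 4, 1, 8066, 0, 0, 8101, 5, 1, 8130, 0, 0,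
    8166, 6, 1, 8194, 0, 0, 8231, 7, 1, 8258, 0, 0, 8296, 8, 1, 8322, 0, 0, 8393, 8362, 8427, 0,
    8452, 4, 1, 1, 8482, 8515, 8548, 8582, 8616, 0, 8642, 0, 8677, 5, 1, 8706, 0, 0, 8742, 6, 1,
    8770, 0, 0, 8807, 7, 1, 8834, 0, 0, 8872, 8905, 8938, 0, 8965, 5, 1, 1, 8994, 9027, 9060,
    9094, 0, 9122, 0, 9158, 6, 1, 9186, 0, 0, 9223, 9256, 9289, 0, 9318, 6, 1, 1, 9346, 9379,
    9412, 9446, 0, 9474, 0, 9511, 9544, 0, 9575, 7, 1, 1, 9602, 9635, 9668, 0, 9698, 0, 0, 9736,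
    8, 1, 1, 9762, 9795, 9828, 0, 9858, 0, 0, 9897, 9, 1, 1, 9922, 9955, 0, 9986, 0, 0, 10026, 10,
    1, 1, 10050, 0, 10082, 0, 0, 10123, 11, 1, 10146, 0, 0, 10188, 10221, 10254]

set_option maxRecDepth 100000 in
set_option maxHeartbeats 0 in
theorem checkProgram_program14 : checkProgram 322 15 program14 = true := by
  decide +kernel

set_option maxRecDepth 100000 in
set_option maxHeartbeats 0 in
theorem countsSuffice_program14 :
    countsSuffice ([] :: emittedWords program14 [[]]) [13, 14] = true := by
  decide +kernel

/-- A program for the rows of weight 15. -/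
def program15 : List ℕ :=
  [1, 1, 194, 291, 388, 485, 582, 679, 776, 873, 970, 1067, 1164, 1261, 0, 98, 2, 259, 356, 453,
    550, 647, 744, 841, 938, 1035, 1132, 0, 163, 3, 323, 420, 517, 614, 711, 808, 905, 1002, 1099,
    0, 228, 4, 1187, 1220, 1285, 1318, 1351, 1384, 1417, 1450, 0, 1477, 5, 1506, 1539, 1572, 1605,
    1638, 1671, 1704, 1737, 0, 1766, 6, 1826, 1795, 1860, 1893, 1958, 1991, 1928, 0, 2023, 7,
    2050, 2083, 2116, 2149, 2182, 2215, 0, 2248, 8, 2274, 2307, 2340, 2373, 2406, 0, 2441, 9,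
    2466, 2499, 2532, 2565, 0, 2602, 10, 2626, 2659, 2692, 0, 2731, 11, 2754, 2787, 0, 2828, 12,
    2850, 0, 2893, 2926, 0, 34, 2, 1, 2946, 2983, 3016, 3049, 3082, 3115, 3148, 0, 2, 3174, 3207,
    3240, 3273, 3306, 3339, 0, 131, 3, 3367, 3400, 3433, 3466, 0, 3492, 4, 3526, 3559, 3592, 3625,
    0, 3653, 5, 3686, 3719, 3752, 0, 3814, 6, 3782, 3847, 0, 3879, 7, 3909, 3942, 0, 3976, 8,
    4004, 4037, 0, 4073, 4106, 4139, 4172, 4205, 0, 67, 3, 1, 4226, 0, 4260, 4293, 4326, 4359,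
    4392, 4425, 4458, 4491, 4524, 0, 4548, 4, 1, 4578, 0, 4613, 4646, 4679, 4712, 4745, 4778,
    4843, 0, 4805, 5, 1, 4866, 0, 4902, 4935, 4968, 5001, 5034, 0, 5062, 6, 1, 5090, 0, 5127,
    5160, 5193, 0, 5223, 7, 1, 5250, 0, 5288, 0, 5320, 8, 1, 5346, 0, 0, 5385, 9, 1, 5410, 0, 0,
    5450, 10, 1, 5474, 0, 0, 5515, 11, 1, 5538, 0, 0, 5580, 12, 1, 5602, 0, 0, 5645, 5678, 5743]

set_option maxRecDepth 100000 in
set_option maxHeartbeats 0 in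
theorem checkProgram_program15 : checkProgram 180 15 program15 = true := by
  decide +kernel

set_option maxRecDepth 100000 in
set_option maxHeartbeats 0 in
theorem countsSuffice_program15 :
    countsSuffice ([] :: emittedWords program15 [[]]) [15] = true := by
  decide +kernel

theorem dimTable_eq_nil {k : ℕ} (hk : 16 ≤ k) : dimTable k = [] := by
  unfold dimTable
  split <;> first | omega | rfl

theorem le_finrank_filMDA {k l d : ℕ} (h : (dimTable k)[l]? = some d) :
    d ≤ Module.finrank ℚ (filMDA k l) := by
  rcases Nat.lt_or_ge k 16 with hk | hk
  · rcases (by omega : k < 12 ∨ k = 12 ∨ (k = 13 ∨ k = 14) ∨ k = 15) with hk | hk | hk | hk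
    · exact le_finrank_of_checks (by norm_num) (by norm_num) le_rfl (by decide +kernel)
        checkProgram_program11 countsSuffice_program11 (by simp; omega) h
    · exact le_finrank_of_checks (by norm_num) (by norm_num) le_rfl (by decide +kernel)
        checkProgram_program12 countsSuffice_program12 (by simpa using hk) h
    · exact le_finrank_of_checks (by norm_num) (by norm_num) le_rfl (by decide +kernel)
        checkProgram_program14 countsSuffice_program14 (by simpa using hk) h
    · exact le_finrank_of_checks (by norm_num) (by norm_num) le_rfl (by decide +kernel)
        checkProgram_program15 countsSuffice_program15 (by simpa using hk) h
  · rw [dimTable_eq_nil hk] at h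
    simp at h

/-! ### Sums over one, two and three pairs -/

/-- The pairs `(u, v)` of positive integers with `u v = n`. -/
def duos (n : ℕ) : Finset (ℕ × ℕ) :=
  ((Finset.Icc 1 n) ×ˢ (Finset.Icc 1 n)).filter fun x => x.1 * x.2 = n

/-- The pairs `(u, v)`, `(u', v')` of pairs of positive integers with `u v + u' v' = n`. -/
def quads (n : ℕ) : Finset ((ℕ × ℕ) × (ℕ × ℕ)) :=
  (((Finset.Icc 1 n) ×ˢ (Finset.Icc 1 n)) ×ˢ ((Finset.Icc 1 n) ×ˢ (Finset.Icc 1 n))).filter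
    fun x => x.1.1 * x.1.2 + x.2.1 * x.2.2 = n

/-- The triples of pairs of positive integers with `u v + u' v' + u'' v'' = n`. -/
def sexts (n : ℕ) : Finset ((ℕ × ℕ) × (ℕ × ℕ) × (ℕ × ℕ)) :=
  (((Finset.Icc 1 n) ×ˢ (Finset.Icc 1 n)) ×ˢ ((Finset.Icc 1 n) ×ˢ (Finset.Icc 1 n)) ×ˢ
    ((Finset.Icc 1 n) ×ˢ (Finset.Icc 1 n))).filter
    fun x => x.1.1 * x.1.2 + x.2.1.1 * x.2.1.2 + x.2.2.1 * x.2.2.2 = n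

theorem le_of_mul_le_of_pos {u v n : ℕ} (hu : 0 < u) (hv : 0 < v) (h : u * v ≤ n) :
    u ≤ n ∧ v ≤ n :=
  ⟨(Nat.le_mul_of_pos_right u hv).trans h, (Nat.le_mul_of_pos_left v hu).trans h⟩

theorem mem_duos {n u v : ℕ} : (u, v) ∈ duos n ↔ 0 < u ∧ 0 < v ∧ u * v = n := by
  simp only [duos, Finset.mem_filter, Finset.mem_product, Finset.mem_Icc]
  constructor
  · rintro ⟨⟨⟨h1, _⟩, h2, _⟩, h⟩
    exact ⟨h1, h2, h⟩
  · rintro ⟨h1, h2, h⟩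
    have := le_of_mul_le_of_pos h1 h2 h.le
    exact ⟨⟨⟨h1, this.1⟩, h2, this.2⟩, h⟩

theorem mem_quads {n u v u' v' : ℕ} : ((u, v), (u', v')) ∈ quads n ↔
    0 < u ∧ 0 < v ∧ 0 < u' ∧ 0 < v' ∧ u * v + u' * v' = n := by
  simp only [quads, Finset.mem_filter, Finset.mem_product, Finset.mem_Icc]
  constructor
  · rintro ⟨⟨⟨⟨h1, _⟩, h2, _⟩, ⟨h3, _⟩, h4, _⟩, h⟩
    exact ⟨h1, h2, h3, h4, h⟩
  · rintro ⟨h1, h2, h3, h4, h⟩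
    have a := le_of_mul_le_of_pos (n := n) h1 h2 (by omega)
    have b := le_of_mul_le_of_pos (n := n) h3 h4 (by omega)
    exact ⟨⟨⟨⟨h1, a.1⟩, h2, a.2⟩, ⟨h3, b.1⟩, h4, b.2⟩, h⟩

theorem mem_sexts {n u v u' v' u'' v'' : ℕ} : ((u, v), (u', v'), (u'', v'')) ∈ sexts n ↔
    0 < u ∧ 0 < v ∧ 0 < u' ∧ 0 < v' ∧ 0 < u'' ∧ 0 < v'' ∧
      u * v + u' * v' + u'' * v'' = n := by
  simp only [sexts, Finset.mem_filter, Finset.mem_product, Finset.mem_Icc]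
  constructor
  · rintro ⟨⟨⟨⟨h1, _⟩, h2, _⟩, ⟨⟨h3, _⟩, h4, _⟩, ⟨h5, _⟩, h6, _⟩, h⟩
    exact ⟨h1, h2, h3, h4, h5, h6, h⟩
  · rintro ⟨h1, h2, h3, h4, h5, h6, h⟩
    have a := le_of_mul_le_of_pos (n := n) h1 h2 (by omega)
    have b := le_of_mul_le_of_pos (n := n) h3 h4 (by omega)
    have c := le_of_mul_le_of_pos (n := n) h5 h6 (by omega)
    exact ⟨⟨⟨⟨h1, a.1⟩, h2, a.2⟩, ⟨⟨h3, b.1⟩, h4, b.2⟩, ⟨h5, c.1⟩, h6, c.2⟩, h⟩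

/-- The series `∑ h(v) q^{uv}`. -/
def series₁ : (ℕ → ℚ) →ₗ[ℚ] ℚ⟦X⟧ where
  toFun h := PowerSeries.mk fun n => ∑ x ∈ duos n, h x.2
  map_add' h g := by
    ext n
    simp [Finset.sum_add_distrib]
  map_smul' c h := by
    ext n
    simp [Finset.mul_sum]

/-- The series `∑ h(v₁, v₂) q^{u₁v₁ + u₂v₂}` over `u₁ > u₂`. -/
def series₂ : (ℕ → ℕ → ℚ) →ₗ[ℚ] ℚ⟦X⟧ where
  toFun h := PowerSeries.mk fun n => ∑ x ∈ quads n with x.2.1 < x.1.1, h x.1.2 x.2.2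
  map_add' h g := by
    ext n
    simp [Finset.sum_add_distrib]
  map_smul' c h := by
    ext n
    simp [Finset.mul_sum]

/-- The series `∑ h(v₁, v₂, v₃) q^{u₁v₁ + u₂v₂ + u₃v₃}` over `u₁ > u₂ > u₃`. -/
def series₃ : (ℕ → ℕ → ℕ → ℚ) →ₗ[ℚ] ℚ⟦X⟧ where
  toFun h := PowerSeries.mk fun n =>
    ∑ x ∈ sexts n with x.2.1.1 < x.1.1 ∧ x.2.2.1 < x.2.1.1, h x.1.2 x.2.1.2 x.2.2.2
  map_add' h g := by
    ext n
    simp [Finset.sum_add_distrib]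
  map_smul' c h := by
    ext n
    simp [Finset.mul_sum]

theorem coeff_series₁ (h : ℕ → ℚ) (n : ℕ) :
    PowerSeries.coeff n (series₁ h) = ∑ x ∈ duos n, h x.2 := by
  simp [series₁]

theorem coeff_series₂ (h : ℕ → ℕ → ℚ) (n : ℕ) :
    PowerSeries.coeff n (series₂ h) = ∑ x ∈ quads n with x.2.1 < x.1.1, h x.1.2 x.2.2 := by
  simp [series₂]

theorem coeff_series₃ (h : ℕ → ℕ → ℕ → ℚ) (n : ℕ) :
    PowerSeries.coeff n (series₃ h) =
      ∑ x ∈ sexts n with x.2.1.1 < x.1.1 ∧ x.2.2.1 < x.2.1.1, h x.1.2 x.2.1.2 x.2.2.2 := by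
  simp [series₃]

theorem series₁_congr {h g : ℕ → ℚ} (H : ∀ x, 0 < x → h x = g x) : series₁ h = series₁ g := by
  ext n
  rw [coeff_series₁, coeff_series₁]
  refine Finset.sum_congr rfl ?_
  rintro ⟨u, v⟩ hx
  exact H _ (mem_duos.mp hx).2.1

theorem series₂_congr {h g : ℕ → ℕ → ℚ} (H : ∀ x y, 0 < x → 0 < y → h x y = g x y) :
    series₂ h = series₂ g := by
  ext n
  rw [coeff_series₂, coeff_series₂]
  refine Finset.sum_congr rfl ?_
  rintro ⟨⟨u, v⟩, ⟨u', v'⟩⟩ hx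
  have := mem_quads.mp (Finset.mem_filter.mp hx).1
  exact H _ _ this.2.1 this.2.2.2.1

theorem wordSeries_one (a : ℕ) : wordSeries [a] = series₁ fun x => (x : ℚ) ^ a := by
  ext n
  rw [coeff_series₁, wordSeries, PowerSeries.coeff_mk,
    multipleDivisorSum_congr (t := ![a]) rfl (fun i => by fin_cases i; rfl),
    multipleDivisorSum, Nat.cast_sum]
  refine Finset.sum_nbij' (fun p => (p.1 0, p.2 0)) (fun x => (![x.1], ![x.2])) ?_ ?_ ?_ ?_ ?_
  · intro p hp
    simp only [Finset.mem_filter, Finset.mem_product, Fintype.mem_piFinset, Finset.mem_Icc,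
      Fin.sum_univ_one] at hp
    exact mem_duos.mpr ⟨(hp.1.1 0).1, (hp.1.2 0).1, hp.2.2⟩
  · rintro ⟨u, v⟩ hx
    rw [mem_duos] at hx
    obtain ⟨h1, h2, h⟩ := hx
    have a := le_of_mul_le_of_pos (n := n) h1 h2 (by omega)
    simp only [Finset.mem_filter, Finset.mem_product, Fintype.mem_piFinset, Finset.mem_Icc,
      Fin.sum_univ_one, Fin.forall_fin_one, Matrix.cons_val_zero]
    exact ⟨⟨⟨h1, a.1⟩, h2, a.2⟩, fun h => absurd h (lt_irrefl _), h⟩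
  · intro p _
    ext i <;> rw [Subsingleton.elim i 0] <;> rfl
  · rintro ⟨u, v⟩ _
    rfl
  · intro p _
    simp

theorem wordSeries_two (a b : ℕ) :
    wordSeries [a, b] = series₂ fun x y => (x : ℚ) ^ a * (y : ℚ) ^ b := by
  ext n
  rw [coeff_series₂, wordSeries, PowerSeries.coeff_mk,
    multipleDivisorSum_congr (t := ![a, b]) rfl (fun i => by fin_cases i <;> rfl),
    multipleDivisorSum, Nat.cast_sum]
  refine Finset.sum_nbij' (fun p => ((p.1 0, p.2 0), (p.1 1, p.2 1)))
    (fun x => (![x.1.1, x.2.1], ![x.1.2, x.2.2])) ?_ ?_ ?_ ?_ ?_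
  · intro p hp
    simp only [Finset.mem_filter, Finset.mem_product, Fintype.mem_piFinset, Finset.mem_Icc,
      Fin.sum_univ_two] at hp
    exact Finset.mem_filter.mpr ⟨mem_quads.mpr ⟨(hp.1.1 0).1, (hp.1.2 0).1, (hp.1.1 1).1,
      (hp.1.2 1).1, hp.2.2⟩, hp.2.1 0 1 Fin.zero_lt_one⟩
  · rintro ⟨⟨u, v⟩, ⟨u', v'⟩⟩ hx
    rw [Finset.mem_filter, mem_quads] at hx
    obtain ⟨⟨h1, h2, h3, h4, h⟩, h5⟩ := hx
    have a := le_of_mul_le_of_pos (n := n) h1 h2 (by omega)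
    have b := le_of_mul_le_of_pos (n := n) h3 h4 (by omega)
    simp only [Finset.mem_filter, Finset.mem_product, Fintype.mem_piFinset, Finset.mem_Icc,
      Fin.sum_univ_two, Fin.forall_fin_two, Matrix.cons_val_zero, Matrix.cons_val_one]
    refine ⟨⟨⟨⟨h1, a.1⟩, h3, b.1⟩, ⟨h2, a.2⟩, h4, b.2⟩, ⟨⟨?_, fun _ => h5⟩, ?_, ?_⟩, h⟩ <;>
    simp
  · intro p _
    ext i <;> fin_cases i <;> rfl
  · rintro ⟨⟨u, v⟩, ⟨u', v'⟩⟩ _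
    rfl
  · intro p _
    simp [Fin.prod_univ_two]

theorem wordSeries_three (a b c : ℕ) : wordSeries [a, b, c] =
    series₃ fun x y z => (x : ℚ) ^ a * (y : ℚ) ^ b * (z : ℚ) ^ c := by
  ext n
  rw [coeff_series₃, wordSeries, PowerSeries.coeff_mk,
    multipleDivisorSum_congr (t := ![a, b, c]) rfl (fun i => by fin_cases i <;> rfl),
    multipleDivisorSum, Nat.cast_sum]
  refine Finset.sum_nbij' (fun p => ((p.1 0, p.2 0), (p.1 1, p.2 1), (p.1 2, p.2 2)))
    (fun x => (![x.1.1, x.2.1.1, x.2.2.1], ![x.1.2, x.2.1.2, x.2.2.2])) ?_ ?_ ?_ ?_ ?_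
  · intro p hp
    simp only [Finset.mem_filter, Finset.mem_product, Fintype.mem_piFinset, Finset.mem_Icc,
      Fin.sum_univ_three] at hp
    exact Finset.mem_filter.mpr ⟨mem_sexts.mpr ⟨(hp.1.1 0).1, (hp.1.2 0).1, (hp.1.1 1).1,
      (hp.1.2 1).1, (hp.1.1 2).1, (hp.1.2 2).1, hp.2.2⟩, hp.2.1 0 1 (by decide),
      hp.2.1 1 2 (by decide)⟩
  · rintro ⟨⟨u, v⟩, ⟨u', v'⟩, ⟨u'', v''⟩⟩ hx
    rw [Finset.mem_filter, mem_sexts] at hx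
    obtain ⟨⟨h1, h2, h3, h4, h5, h6, h⟩, h7, h8⟩ := hx
    have a := le_of_mul_le_of_pos (n := n) h1 h2 (by omega)
    have b := le_of_mul_le_of_pos (n := n) h3 h4 (by omega)
    have c := le_of_mul_le_of_pos (n := n) h5 h6 (by omega)
    simp only [Finset.mem_filter, Finset.mem_product, Fintype.mem_piFinset, Finset.mem_Icc,
      Fin.sum_univ_three]
    refine ⟨⟨fun i => ?_, fun i => ?_⟩, fun i j hij => ?_, h⟩
    · fin_cases i
      exacts [⟨h1, a.1⟩, ⟨h3, b.1⟩, ⟨h5, c.1⟩]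
    · fin_cases i
      exacts [⟨h2, a.2⟩, ⟨h4, b.2⟩, ⟨h6, c.2⟩]
    · fin_cases i <;> fin_cases j <;> first | exact absurd hij (by decide) | skip
      exacts [h7, h8.trans h7, h8]
  · intro p _
    ext i <;> fin_cases i <;> rfl
  · rintro ⟨⟨u, v⟩, ⟨u', v'⟩, ⟨u'', v''⟩⟩ _
    rfl
  · intro p _
    simp [Fin.prod_univ_three]

/-! ### Two ways to expand a sum over two pairs -/

/-- The convolution of `p` over the compositions of `w` in two parts. -/
def conv (p : ℕ → ℕ → ℚ) (w : ℕ) : ℚ := ∑ v ∈ Finset.Ico 1 w, p v (w - v)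

theorem sum_quads_gt (p : ℕ → ℕ → ℚ) (n : ℕ) :
    ∑ x ∈ quads n with x.1.1 < x.2.1, p x.1.2 x.2.2 =
      ∑ x ∈ quads n with x.2.1 < x.1.1, p x.2.2 x.1.2 := by
  refine Finset.sum_nbij' Prod.swap Prod.swap ?_ ?_ (fun _ _ => rfl) (fun _ _ => rfl)
    (fun _ _ => rfl)
  all_goals
    rintro ⟨⟨u, v⟩, ⟨u', v'⟩⟩ hx
    simp only [Prod.swap, Finset.mem_filter, mem_quads] at hx ⊢
    omega

/-- Two equal parts merge, `u * v + u * v' = u * (v + v')`, and the splittings of the total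
multiplicity are summed by `conv`. -/
theorem sum_quads_eq (p : ℕ → ℕ → ℚ) (n : ℕ) :
    ∑ x ∈ quads n with x.1.1 = x.2.1, p x.1.2 x.2.2 = ∑ x ∈ duos n, conv p x.2 := by
  simp only [conv]
  rw [Finset.sum_sigma']
  refine Finset.sum_nbij' (fun x => ⟨(x.1.1, x.1.2 + x.2.2), x.1.2⟩)
    (fun y => ((y.1.1, y.2), (y.1.1, y.1.2 - y.2))) ?_ ?_ ?_ ?_ ?_
  · rintro ⟨⟨u, v⟩, ⟨u', v'⟩⟩ hx
    simp only [Finset.mem_filter, mem_quads] at hx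
    obtain ⟨⟨h1, h2, h3, h4, h⟩, rfl⟩ := hx
    simp only [Finset.mem_sigma, mem_duos, Finset.mem_Ico]
    exact ⟨⟨h1, by omega, by rw [← h]; ring⟩, by omega, by omega⟩
  · rintro ⟨⟨u, w⟩, v⟩ hy
    simp only [Finset.mem_sigma, mem_duos, Finset.mem_Ico] at hy
    obtain ⟨⟨h1, h2, h⟩, h3, h4⟩ := hy
    simp only [Finset.mem_filter, mem_quads]
    refine ⟨⟨h1, h3, h1, by omega, ?_⟩, trivial⟩
    rw [← mul_add, Nat.add_sub_cancel' h4.le, h]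
  · rintro ⟨⟨u, v⟩, ⟨u', v'⟩⟩ hx
    simp only [Finset.mem_filter] at hx
    obtain ⟨_, rfl⟩ := hx
    simp
  · rintro ⟨⟨u, w⟩, v⟩ hy
    simp only [Finset.mem_sigma, mem_duos, Finset.mem_Ico] at hy
    simp only [Nat.add_sub_cancel' hy.2.2.le]
  · rintro ⟨⟨u, v⟩, ⟨u', v'⟩⟩ _
    simp

/-- Trichotomy for the two parts. -/
theorem sum_quads_stuffle (p : ℕ → ℕ → ℚ) (n : ℕ) :
    ∑ x ∈ quads n, p x.1.2 x.2.2 = PowerSeries.coeff n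
      (series₂ (fun x y => p x y + p y x) + series₁ (conv p)) := by
  rw [map_add, coeff_series₁, coeff_series₂, Finset.sum_add_distrib, ← sum_quads_gt,
    ← sum_quads_eq, ← Finset.sum_filter_add_sum_filter_not (quads n) fun x => x.2.1 < x.1.1,
    ← Finset.sum_filter_add_sum_filter_not ((quads n).filter fun x => ¬ x.2.1 < x.1.1)
      fun x => x.1.1 < x.2.1, Finset.filter_filter, Finset.filter_filter, add_assoc]
  refine congrArg₂ _ rfl (congrArg₂ _ ?_ ?_) <;>
  refine Finset.sum_congr (Finset.filter_congr fun x _ => ?_) (fun _ _ => rfl) <;> omega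

/-- Trichotomy for the two multiplicities. If `v > v'`, then `u v + u' v' = (u + u') v' + u (v -
v')` has decreasing parts `u + u' > u`; the case `v < v'` is symmetric, and the diagonal carries no
weight. -/
theorem sum_quads_shuffle {p : ℕ → ℕ → ℚ} (hp : ∀ x, p x x = 0) (n : ℕ) :
    ∑ x ∈ quads n, p x.1.2 x.2.2 = PowerSeries.coeff n
      (series₂ (fun x y => p (x + y) x + p x (x + y))) := by
  rw [coeff_series₂, Finset.sum_add_distrib,
    ← Finset.sum_filter_add_sum_filter_not (quads n) fun x => x.2.2 < x.1.2,
    ← Finset.sum_filter_add_sum_filter_not ((quads n).filter fun x => ¬ x.2.2 < x.1.2)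
      fun x => x.1.2 < x.2.2, Finset.filter_filter, Finset.filter_filter]
  have h0 : ∑ x ∈ quads n with ¬ x.2.2 < x.1.2 ∧ ¬ x.1.2 < x.2.2, p x.1.2 x.2.2 = 0 := by
    refine Finset.sum_eq_zero fun x hx => ?_
    have := (Finset.mem_filter.mp hx).2
    rw [show x.1.2 = x.2.2 by omega, hp]
  rw [h0, add_zero]
  refine congrArg₂ _ ?_ ?_
  · refine Finset.sum_nbij' (fun x => ((x.1.1 + x.2.1, x.2.2), (x.1.1, x.1.2 - x.2.2)))
      (fun x => ((x.2.1, x.1.2 + x.2.2), (x.1.1 - x.2.1, x.1.2))) ?_ ?_ ?_ ?_ ?_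
    · rintro ⟨⟨u, v⟩, ⟨u', v'⟩⟩ hx
      simp only [Finset.mem_filter, mem_quads] at hx ⊢
      obtain ⟨⟨h1, h2, h3, h4, h⟩, h5⟩ := hx
      obtain ⟨t, rfl⟩ := Nat.exists_eq_add_of_lt h5
      refine ⟨⟨by omega, h4, h1, by omega, ?_⟩, by omega⟩
      rw [← h, add_assoc, Nat.add_sub_cancel_left]
      ring
    · rintro ⟨⟨u, v⟩, ⟨u', v'⟩⟩ hx
      simp only [Finset.mem_filter, mem_quads] at hx ⊢
      obtain ⟨⟨h1, h2, h3, h4, h⟩, h5⟩ := hx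
      obtain ⟨t, rfl⟩ := Nat.exists_eq_add_of_lt h5
      refine ⟨⟨h3, by omega, by omega, h2, ?_⟩, by omega⟩
      rw [← h, add_assoc, Nat.add_sub_cancel_left]
      ring
    all_goals
      rintro ⟨⟨u, v⟩, ⟨u', v'⟩⟩ hx
      simp only [Finset.mem_filter] at hx
      simp only [Prod.mk.injEq, and_true, true_and, Nat.add_sub_cancel_left]
      first
        | omega
        | rw [Nat.add_sub_cancel' hx.2.le]
  · refine Finset.sum_nbij' (fun x => ((x.1.1 + x.2.1, x.1.2), (x.2.1, x.2.2 - x.1.2)))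
      (fun x => ((x.1.1 - x.2.1, x.1.2), (x.2.1, x.1.2 + x.2.2))) ?_ ?_ ?_ ?_ ?_
    · rintro ⟨⟨u, v⟩, ⟨u', v'⟩⟩ hx
      simp only [Finset.mem_filter, mem_quads] at hx ⊢
      obtain ⟨⟨h1, h2, h3, h4, h⟩, h5, h6⟩ := hx
      obtain ⟨t, rfl⟩ := Nat.exists_eq_add_of_lt h6
      refine ⟨⟨by omega, h2, h3, by omega, ?_⟩, by omega⟩
      rw [← h, add_assoc v, Nat.add_sub_cancel_left]
      ring
    · rintro ⟨⟨u, v⟩, ⟨u', v'⟩⟩ hx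
      simp only [Finset.mem_filter, mem_quads] at hx ⊢
      obtain ⟨⟨h1, h2, h3, h4, h⟩, h5⟩ := hx
      obtain ⟨t, rfl⟩ := Nat.exists_eq_add_of_lt h5
      refine ⟨⟨by omega, h2, h3, by omega, ?_⟩, by omega⟩
      rw [← h, add_assoc u', Nat.add_sub_cancel_left]
      ring
    all_goals
      rintro ⟨⟨u, v⟩, ⟨u', v'⟩⟩ hx
      simp only [Finset.mem_filter] at hx
      simp only [Prod.mk.injEq, and_true, true_and, Nat.add_sub_cancel_left]
      first
        | omega
        | rw [Nat.add_sub_cancel' hx.2.2.le]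

/-- The double shuffle relation in length two. -/
theorem series₂_sub_of_diag_eq_zero {p : ℕ → ℕ → ℚ} (hp : ∀ x, p x x = 0) :
    series₂ (fun x y => p x y + p y x - p (x + y) x - p x (x + y)) = - series₁ (conv p) := by
  have h : series₂ (fun x y => p x y + p y x) + series₁ (conv p) =
      series₂ (fun x y => p (x + y) x + p x (x + y)) := by
    ext n
    rw [← sum_quads_stuffle, sum_quads_shuffle hp]
  have h2 : (fun x y => p x y + p y x - p (x + y) x - p x (x + y)) =
      (fun x y => p x y + p y x) - fun x y => p (x + y) x + p x (x + y) := by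
    funext x y
    simp only [Pi.sub_apply]
    ring
  rw [h2, map_sub, ← h]
  ring

/-! ### Two ways to expand a sum over three pairs -/

/-- The coefficients of a sum over three pairs, the last two of them ordered. -/
def sextSum (f : ℕ → ℕ → ℕ → ℚ) (n : ℕ) : ℚ :=
  ∑ x ∈ sexts n with x.2.2.1 < x.2.1.1, f x.1.2 x.2.1.2 x.2.2.2

theorem sum_sexts_mid (f : ℕ → ℕ → ℕ → ℚ) (n : ℕ) :
    ∑ x ∈ sexts n with x.2.2.1 < x.1.1 ∧ x.1.1 < x.2.1.1, f x.1.2 x.2.1.2 x.2.2.2 =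
      ∑ x ∈ sexts n with x.2.1.1 < x.1.1 ∧ x.2.2.1 < x.2.1.1, f x.2.1.2 x.1.2 x.2.2.2 := by
  refine Finset.sum_nbij' (fun x => (x.2.1, x.1, x.2.2)) (fun x => (x.2.1, x.1, x.2.2)) ?_ ?_
    (fun _ _ => rfl) (fun _ _ => rfl) (fun _ _ => rfl)
  all_goals
    rintro ⟨⟨u, v⟩, ⟨u', v'⟩, ⟨u'', v''⟩⟩ hx
    simp only [Finset.mem_filter, mem_sexts] at hx ⊢
    omega

theorem sum_sexts_last (f : ℕ → ℕ → ℕ → ℚ) (n : ℕ) :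
    ∑ x ∈ sexts n with x.1.1 < x.2.2.1 ∧ x.2.2.1 < x.2.1.1, f x.1.2 x.2.1.2 x.2.2.2 =
      ∑ x ∈ sexts n with x.2.1.1 < x.1.1 ∧ x.2.2.1 < x.2.1.1, f x.2.2.2 x.1.2 x.2.1.2 := by
  refine Finset.sum_nbij' (fun x => (x.2.1, x.2.2, x.1)) (fun x => (x.2.2, x.1, x.2.1)) ?_ ?_
    (fun _ _ => rfl) (fun _ _ => rfl) (fun _ _ => rfl)
  all_goals
    rintro ⟨⟨u, v⟩, ⟨u', v'⟩, ⟨u'', v''⟩⟩ hx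
    simp only [Finset.mem_filter, mem_sexts] at hx ⊢
    omega

theorem sum_sexts_eq_first (f : ℕ → ℕ → ℕ → ℚ) (n : ℕ) :
    ∑ x ∈ sexts n with x.1.1 = x.2.1.1 ∧ x.2.2.1 < x.2.1.1, f x.1.2 x.2.1.2 x.2.2.2 =
      ∑ x ∈ quads n with x.2.1 < x.1.1, conv (fun v v' => f v v' x.2.2) x.1.2 := by
  simp only [conv]
  rw [Finset.sum_sigma']
  refine Finset.sum_nbij' (fun x => ⟨((x.1.1, x.1.2 + x.2.1.2), x.2.2), x.1.2⟩)
    (fun y => ((y.1.1.1, y.2), (y.1.1.1, y.1.1.2 - y.2), y.1.2)) ?_ ?_ ?_ ?_ ?_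
  · rintro ⟨⟨u, v⟩, ⟨u', v'⟩, ⟨u'', v''⟩⟩ hx
    simp only [Finset.mem_filter, mem_sexts] at hx
    obtain ⟨⟨h1, h2, h3, h4, h5, h6, h⟩, rfl, h7⟩ := hx
    simp only [Finset.mem_sigma, Finset.mem_filter, mem_quads, Finset.mem_Ico]
    exact ⟨⟨⟨h1, by omega, h5, h6, by rw [← h]; ring⟩, h7⟩, by omega, by omega⟩
  · rintro ⟨⟨⟨u, w⟩, ⟨u', v'⟩⟩, v⟩ hy
    simp only [Finset.mem_sigma, Finset.mem_filter, mem_quads, Finset.mem_Ico] at hy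
    obtain ⟨⟨⟨h1, h2, h3, h4, h⟩, h5⟩, h6, h7⟩ := hy
    simp only [Finset.mem_filter, mem_sexts]
    refine ⟨⟨h1, h6, h1, by omega, h3, h4, ?_⟩, trivial, h5⟩
    rw [← mul_add, Nat.add_sub_cancel' h7.le, h]
  · rintro ⟨⟨u, v⟩, ⟨u', v'⟩, ⟨u'', v''⟩⟩ hx
    simp only [Finset.mem_filter] at hx
    obtain ⟨_, rfl, _⟩ := hx
    simp
  · rintro ⟨⟨⟨u, w⟩, ⟨u', v'⟩⟩, v⟩ hy
    simp only [Finset.mem_sigma, Finset.mem_Ico] at hy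
    simp only [Nat.add_sub_cancel' hy.2.2.le]
  · rintro ⟨⟨u, v⟩, ⟨u', v'⟩, ⟨u'', v''⟩⟩ _
    simp

theorem sum_sexts_eq_second (f : ℕ → ℕ → ℕ → ℚ) (n : ℕ) :
    ∑ x ∈ sexts n with x.1.1 = x.2.2.1 ∧ x.2.2.1 < x.2.1.1, f x.1.2 x.2.1.2 x.2.2.2 =
      ∑ x ∈ quads n with x.2.1 < x.1.1, conv (fun v v' => f v x.1.2 v') x.2.2 := by
  simp only [conv]
  rw [Finset.sum_sigma']
  refine Finset.sum_nbij' (fun x => ⟨(x.2.1, (x.1.1, x.1.2 + x.2.2.2)), x.1.2⟩)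
    (fun y => ((y.1.2.1, y.2), y.1.1, (y.1.2.1, y.1.2.2 - y.2))) ?_ ?_ ?_ ?_ ?_
  · rintro ⟨⟨u, v⟩, ⟨u', v'⟩, ⟨u'', v''⟩⟩ hx
    simp only [Finset.mem_filter, mem_sexts] at hx
    obtain ⟨⟨h1, h2, h3, h4, h5, h6, h⟩, rfl, h7⟩ := hx
    simp only [Finset.mem_sigma, Finset.mem_filter, mem_quads, Finset.mem_Ico]
    exact ⟨⟨⟨h3, h4, h1, by omega, by rw [← h]; ring⟩, h7⟩, by omega, by omega⟩
  · rintro ⟨⟨⟨u, w⟩, ⟨u', v'⟩⟩, v⟩ hy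
    simp only [Finset.mem_sigma, Finset.mem_filter, mem_quads, Finset.mem_Ico] at hy
    obtain ⟨⟨⟨h1, h2, h3, h4, h⟩, h5⟩, h6, h7⟩ := hy
    simp only [Finset.mem_filter, mem_sexts]
    refine ⟨⟨h3, h6, h1, h2, h3, by omega, ?_⟩, trivial, h5⟩
    rw [← h, add_right_comm, ← mul_add, Nat.add_sub_cancel' h7.le, add_comm]
  · rintro ⟨⟨u, v⟩, ⟨u', v'⟩, ⟨u'', v''⟩⟩ hx
    simp only [Finset.mem_filter] at hx
    obtain ⟨_, rfl, _⟩ := hx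
    simp
  · rintro ⟨⟨⟨u, w⟩, ⟨u', v'⟩⟩, v⟩ hy
    simp only [Finset.mem_sigma, Finset.mem_Ico] at hy
    simp only [Nat.add_sub_cancel' hy.2.2.le]
  · rintro ⟨⟨u, v⟩, ⟨u', v'⟩, ⟨u'', v''⟩⟩ _
    simp

/-- The free part is inserted into the ordered pair: three strict positions, and two coincidences
that shorten the sum. -/
theorem sextSum_stuffle (f : ℕ → ℕ → ℕ → ℚ) (n : ℕ) :
    sextSum f n = PowerSeries.coeff n
      (series₃ (fun x y z => f x y z + f y x z + f z x y) +
        series₂ fun x y => conv (fun v v' => f v v' y) x + conv (fun v v' => f v x v') y) := by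
  rw [map_add, coeff_series₃, coeff_series₂, Finset.sum_add_distrib, Finset.sum_add_distrib,
    Finset.sum_add_distrib, ← sum_sexts_mid, ← sum_sexts_last, ← sum_sexts_eq_first,
    ← sum_sexts_eq_second, sextSum]
  simp only [Finset.sum_filter, ← Finset.sum_add_distrib]
  refine Finset.sum_congr rfl fun x _ => ?_
  split_ifs <;> first | omega | simp

/-- The substitution is `u v + u' v' + u'' v'' = (u + u') v' + (u + u'') v'' + u (v - v' - v'')`. -/
theorem sum_sexts_shuffle_gt (f : ℕ → ℕ → ℕ → ℚ) (n : ℕ) :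
    ∑ x ∈ sexts n with x.2.2.1 < x.2.1.1 ∧ x.2.1.2 + x.2.2.2 < x.1.2, f x.1.2 x.2.1.2 x.2.2.2 =
      ∑ x ∈ sexts n with x.2.1.1 < x.1.1 ∧ x.2.2.1 < x.2.1.1,
        f (x.1.2 + x.2.1.2 + x.2.2.2) x.1.2 x.2.1.2 := by
  refine Finset.sum_nbij'
    (fun x => ((x.1.1 + x.2.1.1, x.2.1.2), (x.1.1 + x.2.2.1, x.2.2.2),
      (x.1.1, x.1.2 - (x.2.1.2 + x.2.2.2))))
    (fun x => ((x.2.2.1, x.1.2 + x.2.1.2 + x.2.2.2), (x.1.1 - x.2.2.1, x.1.2),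
      (x.2.1.1 - x.2.2.1, x.2.1.2))) ?_ ?_ ?_ ?_ ?_
  · rintro ⟨⟨u, v⟩, ⟨u', v'⟩, ⟨u'', v''⟩⟩ hx
    simp only [Finset.mem_filter, mem_sexts] at hx ⊢
    obtain ⟨⟨h1, h2, h3, h4, h5, h6, h⟩, h7, h8⟩ := hx
    obtain ⟨t, rfl⟩ := Nat.exists_eq_add_of_lt h8
    refine ⟨⟨by omega, h4, by omega, h6, h1, by omega, ?_⟩, by omega, by omega⟩
    rw [← h, add_assoc (v' + v''), Nat.add_sub_cancel_left]
    ring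
  · rintro ⟨⟨u, v⟩, ⟨u', v'⟩, ⟨u'', v''⟩⟩ hx
    simp only [Finset.mem_filter, mem_sexts] at hx ⊢
    obtain ⟨⟨h1, h2, h3, h4, h5, h6, h⟩, h7, h8⟩ := hx
    obtain ⟨t, rfl⟩ := Nat.exists_eq_add_of_lt h8
    obtain ⟨s, rfl⟩ := Nat.exists_eq_add_of_lt h7
    refine ⟨⟨h5, by omega, by omega, h2, by omega, h4, ?_⟩, by omega, by omega⟩
    rw [← h, show u'' + t + 1 + s + 1 - u'' = t + s + 2 by omega,
      show u'' + t + 1 - u'' = t + 1 by omega]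
    ring
  all_goals
    rintro ⟨⟨u, v⟩, ⟨u', v'⟩, ⟨u'', v''⟩⟩ hx
    simp only [Finset.mem_filter] at hx
    obtain ⟨_, h7, h8⟩ := hx
  · simp only [Prod.mk.injEq, and_true, true_and, Nat.add_sub_cancel_left]
    omega
  · simp only [Prod.mk.injEq, and_true, Nat.add_sub_cancel_left]
    omega
  · rw [Nat.add_sub_cancel' h8.le]

/-- The substitution is `u v + u' v' + u'' v'' = (u + u') v' + (u + u'') (v - v') + u'' (v' + v'' -
v)`. -/
theorem sum_sexts_shuffle_mid (f : ℕ → ℕ → ℕ → ℚ) (n : ℕ) :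
    ∑ x ∈ sexts n with x.2.2.1 < x.2.1.1 ∧ x.2.1.2 < x.1.2 ∧ x.1.2 < x.2.1.2 + x.2.2.2,
        f x.1.2 x.2.1.2 x.2.2.2 =
      ∑ x ∈ sexts n with x.2.1.1 < x.1.1 ∧ x.2.2.1 < x.2.1.1,
        f (x.1.2 + x.2.1.2) x.1.2 (x.2.1.2 + x.2.2.2) := by
  refine Finset.sum_nbij'
    (fun x => ((x.1.1 + x.2.1.1, x.2.1.2), (x.1.1 + x.2.2.1, x.1.2 - x.2.1.2),
      (x.2.2.1, x.2.1.2 + x.2.2.2 - x.1.2)))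
    (fun x => ((x.2.1.1 - x.2.2.1, x.1.2 + x.2.1.2),
      (x.1.1 + x.2.2.1 - x.2.1.1, x.1.2), (x.2.2.1, x.2.1.2 + x.2.2.2))) ?_ ?_ ?_ ?_ ?_
  · rintro ⟨⟨u, v⟩, ⟨u', v'⟩, ⟨u'', v''⟩⟩ hx
    simp only [Finset.mem_filter, mem_sexts] at hx ⊢
    obtain ⟨⟨h1, h2, h3, h4, h5, h6, h⟩, h7, h8, h9⟩ := hx
    obtain ⟨t, rfl⟩ := Nat.exists_eq_add_of_lt h8
    obtain ⟨s, rfl⟩ : ∃ s, v'' = t + 1 + s := ⟨v'' - (t + 1), by omega⟩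
    refine ⟨⟨by omega, h4, by omega, by omega, h5, by omega, ?_⟩, by omega, by omega⟩
    rw [← h, show v' + t + 1 - v' = t + 1 by omega,
      show v' + (t + 1 + s) - (v' + t + 1) = s by omega]
    ring
  · rintro ⟨⟨u, v⟩, ⟨u', v'⟩, ⟨u'', v''⟩⟩ hx
    simp only [Finset.mem_filter, mem_sexts] at hx ⊢
    obtain ⟨⟨h1, h2, h3, h4, h5, h6, h⟩, h7, h8⟩ := hx
    obtain ⟨t, rfl⟩ := Nat.exists_eq_add_of_lt h8
    obtain ⟨s, rfl⟩ := Nat.exists_eq_add_of_lt h7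
    refine ⟨⟨by omega, by omega, by omega, h2, h5, by omega, ?_⟩, by omega, by omega, by omega⟩
    rw [← h, show u'' + t + 1 + s + 1 + u'' - (u'' + t + 1) = u'' + s + 1 by omega,
      show u'' + t + 1 - u'' = t + 1 by omega]
    ring
  all_goals
    rintro ⟨⟨u, v⟩, ⟨u', v'⟩, ⟨u'', v''⟩⟩ hx
    simp only [Finset.mem_filter] at hx
    obtain ⟨_, h7, h8⟩ := hx
  · simp only [Prod.mk.injEq, and_true, true_and]
    omega
  · simp only [Prod.mk.injEq, and_true, true_and]
    omega
  · rw [Nat.add_sub_cancel' h8.1.le, show v - v' + (v' + v'' - v) = v'' by omega]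

/-- The substitution is `u v + u' v' = (u + u') v + u' (v' - v)`, with the third pair untouched. -/
theorem sum_sexts_shuffle_lt (f : ℕ → ℕ → ℕ → ℚ) (n : ℕ) :
    ∑ x ∈ sexts n with x.2.2.1 < x.2.1.1 ∧ x.1.2 < x.2.1.2, f x.1.2 x.2.1.2 x.2.2.2 =
      ∑ x ∈ sexts n with x.2.1.1 < x.1.1 ∧ x.2.2.1 < x.2.1.1,
        f x.1.2 (x.1.2 + x.2.1.2) x.2.2.2 := by
  refine Finset.sum_nbij'
    (fun x => ((x.1.1 + x.2.1.1, x.1.2), (x.2.1.1, x.2.1.2 - x.1.2), x.2.2))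
    (fun x => ((x.1.1 - x.2.1.1, x.1.2), (x.2.1.1, x.1.2 + x.2.1.2), x.2.2)) ?_ ?_ ?_ ?_ ?_
  · rintro ⟨⟨u, v⟩, ⟨u', v'⟩, ⟨u'', v''⟩⟩ hx
    simp only [Finset.mem_filter, mem_sexts] at hx ⊢
    obtain ⟨⟨h1, h2, h3, h4, h5, h6, h⟩, h7, h8⟩ := hx
    obtain ⟨t, rfl⟩ := Nat.exists_eq_add_of_lt h8
    refine ⟨⟨by omega, h2, h3, by omega, h5, h6, ?_⟩, by omega, h7⟩
    rw [← h, add_assoc v, Nat.add_sub_cancel_left]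
    ring
  · rintro ⟨⟨u, v⟩, ⟨u', v'⟩, ⟨u'', v''⟩⟩ hx
    simp only [Finset.mem_filter, mem_sexts] at hx ⊢
    obtain ⟨⟨h1, h2, h3, h4, h5, h6, h⟩, h7, h8⟩ := hx
    obtain ⟨s, rfl⟩ := Nat.exists_eq_add_of_lt h7
    refine ⟨⟨by omega, h2, h3, by omega, h5, h6, ?_⟩, h8, by omega⟩
    rw [← h, show u' + s + 1 - u' = s + 1 by omega]
    ring
  all_goals
    rintro ⟨⟨u, v⟩, ⟨u', v'⟩, ⟨u'', v''⟩⟩ hx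
    simp only [Finset.mem_filter] at hx
    obtain ⟨_, h7, h8⟩ := hx
  · simp only [Prod.mk.injEq, and_true, true_and]
    omega
  · simp only [Prod.mk.injEq, and_true, true_and]
    omega
  · rw [Nat.add_sub_cancel' h8.le]

/-- The free multiplicity is compared with `v'` and with `v' + v''`; the hypotheses say that `f`
vanishes on both walls. -/
theorem sextSum_shuffle {f : ℕ → ℕ → ℕ → ℚ} (h1 : ∀ x y, f x x y = 0)
    (h2 : ∀ x y, f (x + y) x y = 0) (n : ℕ) :
    sextSum f n = PowerSeries.coeff n (series₃ fun x y z =>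
      f (x + y + z) x y + f (x + y) x (y + z) + f x (x + y) z) := by
  rw [coeff_series₃, Finset.sum_add_distrib, Finset.sum_add_distrib, ← sum_sexts_shuffle_gt,
    ← sum_sexts_shuffle_mid, ← sum_sexts_shuffle_lt, sextSum]
  simp only [Finset.sum_filter, ← Finset.sum_add_distrib]
  refine Finset.sum_congr rfl fun x _ => ?_
  have h3 : x.1.2 = x.2.1.2 ∨ x.1.2 = x.2.1.2 + x.2.2.2 → f x.1.2 x.2.1.2 x.2.2.2 = 0 := by
    rintro (h | h) <;> rw [h]
    exacts [h1 _ _, h2 _ _]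
  split_ifs <;> first
    | omega
    | (rw [h3 (by omega), add_zero, add_zero])
    | simp

/-- The double shuffle relation in length three. -/
theorem series₃_sub_of_diag_eq_zero {f : ℕ → ℕ → ℕ → ℚ} (h1 : ∀ x y, f x x y = 0)
    (h2 : ∀ x y, f (x + y) x y = 0) :
    series₃ (fun x y z => f x y z + f y x z + f z x y -
        (f (x + y + z) x y + f (x + y) x (y + z) + f x (x + y) z)) =
      - series₂ fun x y => conv (fun v v' => f v v' y) x + conv (fun v v' => f v x v') y := by
  have h : series₃ (fun x y z => f x y z + f y x z + f z x y) +
        series₂ (fun x y => conv (fun v v' => f v v' y) x + conv (fun v v' => f v x v') y) =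
      series₃ fun x y z => f (x + y + z) x y + f (x + y) x (y + z) + f x (x + y) z := by
    ext n
    rw [← sextSum_stuffle, sextSum_shuffle h1 h2]
  have h3 : (fun x y z => f x y z + f y x z + f z x y -
        (f (x + y + z) x y + f (x + y) x (y + z) + f x (x + y) z)) =
      (fun x y z => f x y z + f y x z + f z x y) -
        fun x y z => f (x + y + z) x y + f (x + y) x (y + z) + f x (x + y) z := rfl
  rw [h3, map_sub, ← h]
  ring

/-! ### Multiples of relations by the divisor series -/

theorem coeff_series₁_mul_series₁ (a b : ℕ → ℚ) (n : ℕ) :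
    PowerSeries.coeff n (series₁ a * series₁ b) = ∑ x ∈ quads n, a x.1.2 * b x.2.2 := by
  rw [PowerSeries.coeff_mul]
  simp only [coeff_series₁, Finset.sum_mul_sum, ← Finset.sum_product']
  rw [Finset.sum_sigma']
  refine Finset.sum_nbij' (fun x => x.2) (fun x => ⟨(x.1.1 * x.1.2, x.2.1 * x.2.2), x⟩)
    ?_ ?_ ?_ ?_ ?_
  · rintro ⟨⟨i, j⟩, ⟨⟨u, v⟩, ⟨u', v'⟩⟩⟩ hx
    simp only [Finset.mem_sigma, Finset.HasAntidiagonal.mem_antidiagonal, Finset.mem_product,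
      mem_duos] at hx
    obtain ⟨h, ⟨h1, h2, h3⟩, h4, h5, h6⟩ := hx
    exact mem_quads.mpr ⟨h1, h2, h4, h5, by rw [h3, h6, h]⟩
  · rintro ⟨⟨u, v⟩, ⟨u', v'⟩⟩ hx
    rw [mem_quads] at hx
    simp only [Finset.mem_sigma, Finset.HasAntidiagonal.mem_antidiagonal, Finset.mem_product,
      mem_duos]
    exact ⟨hx.2.2.2.2, ⟨hx.1, hx.2.1, trivial⟩, hx.2.2.1, hx.2.2.2.1, trivial⟩
  · rintro ⟨⟨i, j⟩, ⟨⟨u, v⟩, ⟨u', v'⟩⟩⟩ hx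
    simp only [Finset.mem_sigma, Finset.mem_product, mem_duos] at hx
    simp only [hx.2.1.2.2, hx.2.2.2.2]
  · intro x _
    rfl
  · intro x _
    rfl

theorem coeff_series₁_mul_series₂ (a : ℕ → ℚ) (b : ℕ → ℕ → ℚ) (n : ℕ) :
    PowerSeries.coeff n (series₁ a * series₂ b) = sextSum (fun x y z => a x * b y z) n := by
  rw [PowerSeries.coeff_mul, sextSum]
  simp only [coeff_series₁, coeff_series₂, Finset.sum_mul_sum, ← Finset.sum_product']
  rw [Finset.sum_sigma']
  refine Finset.sum_nbij' (fun x => x.2)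
    (fun x => ⟨(x.1.1 * x.1.2, x.2.1.1 * x.2.1.2 + x.2.2.1 * x.2.2.2), x⟩) ?_ ?_ ?_ ?_ ?_
  · rintro ⟨⟨i, j⟩, ⟨⟨u, v⟩, ⟨u', v'⟩, ⟨u'', v''⟩⟩⟩ hx
    simp only [Finset.mem_sigma, Finset.HasAntidiagonal.mem_antidiagonal, Finset.mem_product,
      mem_duos, Finset.mem_filter, mem_quads] at hx
    obtain ⟨h, ⟨h1, h2, h3⟩, ⟨h4, h5, h6, h7, h8⟩, h9⟩ := hx
    exact Finset.mem_filter.mpr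
      ⟨mem_sexts.mpr ⟨h1, h2, h4, h5, h6, h7, by rw [add_assoc, h8, h3, h]⟩, h9⟩
  · rintro ⟨⟨u, v⟩, ⟨u', v'⟩, ⟨u'', v''⟩⟩ hx
    rw [Finset.mem_filter, mem_sexts] at hx
    obtain ⟨⟨h1, h2, h3, h4, h5, h6, h⟩, h7⟩ := hx
    simp only [Finset.mem_sigma, Finset.HasAntidiagonal.mem_antidiagonal, Finset.mem_product,
      mem_duos, Finset.mem_filter, mem_quads]
    exact ⟨by rw [← h, add_assoc], ⟨h1, h2, trivial⟩, ⟨h3, h4, h5, h6, trivial⟩, h7⟩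
  · rintro ⟨⟨i, j⟩, ⟨⟨u, v⟩, ⟨u', v'⟩, ⟨u'', v''⟩⟩⟩ hx
    simp only [Finset.mem_sigma, Finset.mem_product, mem_duos, Finset.mem_filter,
      mem_quads] at hx
    simp only [hx.2.1.2.2, hx.2.2.1.2.2.2.2]
  · intro x _
    rfl
  · intro x _
    rfl

theorem series₁_mul_series₁ (a b : ℕ → ℚ) : series₁ a * series₁ b =
    series₂ (fun x y => a x * b y + a y * b x) + series₁ (conv fun v v' => a v * b v') := by
  ext n
  rw [coeff_series₁_mul_series₁, ← sum_quads_stuffle fun x y => a x * b y]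

theorem series₁_mul_series₂ (a : ℕ → ℚ) (b : ℕ → ℕ → ℚ) : series₁ a * series₂ b =
    series₃ (fun x y z => a x * b y z + a y * b x z + a z * b x y) +
      series₂ fun x y => conv (fun v v' => a v * b v' y) x +
        conv (fun v v' => a v * b x v') y := by
  ext n
  rw [coeff_series₁_mul_series₂, ← sextSum_stuffle]

/-! ### Convolutions of polynomials -/

/-- The polynomial functions without constant term of degree at most `d`. -/
def polyFun (d : ℕ) : Submodule ℚ (ℕ → ℚ) :=
  Submodule.span ℚ ((fun i (w : ℕ) => (w : ℚ) ^ i) '' Set.Icc 1 d)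

/-- The homogeneous polynomial functions in two variables of degree `d`. -/
def homFun (d : ℕ) : Submodule ℚ (ℕ → ℕ → ℚ) :=
  Submodule.span ℚ ((fun i (v w : ℕ) => (v : ℚ) ^ i.1 * (w : ℚ) ^ i.2) '' {i : ℕ × ℕ | i.1 + i.2 = d})

theorem pow_mem_polyFun {i d : ℕ} (h1 : 1 ≤ i) (h2 : i ≤ d) :
    (fun w : ℕ => (w : ℚ) ^ i) ∈ polyFun d :=
  Submodule.subset_span ⟨i, ⟨h1, h2⟩, rfl⟩

theorem monomial_mem_homFun {a b d : ℕ} (h : a + b = d) :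
    (fun v w : ℕ => (v : ℚ) ^ a * (w : ℚ) ^ b) ∈ homFun d :=
  Submodule.subset_span ⟨(a, b), h, rfl⟩

theorem mul_mem_homFun {d e : ℕ} {g h : ℕ → ℕ → ℚ} (hg : g ∈ homFun d) (hh : h ∈ homFun e) :
    g * h ∈ homFun (d + e) := by
  refine Submodule.mul_le.mpr ?_ (Submodule.mul_mem_mul hg hh)
  rw [homFun, homFun]
  intro g hg h hh
  induction hg using Submodule.span_induction with
  | zero => simp
  | add x y _ _ hx hy => rw [add_mul]; exact add_mem hx hy
  | smul c x _ hx => rw [smul_mul_assoc]; exact Submodule.smul_mem _ _ hx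
  | mem x hx =>
    obtain ⟨⟨a, b⟩, h1, rfl⟩ := hx
    induction hh using Submodule.span_induction with
    | zero => simp
    | add x y _ _ hx hy => rw [mul_add]; exact add_mem hx hy
    | smul c x _ hx => rw [mul_smul_comm]; exact Submodule.smul_mem _ _ hx
    | mem x hx =>
      obtain ⟨⟨a', b'⟩, h2, rfl⟩ := hx
      have h1 : a + b = d := h1
      have h2 : a' + b' = e := h2
      convert monomial_mem_homFun (show (a + a') + (b + b') = d + e by omega) using 1
      funext v w
      simp only [Pi.mul_apply]
      ring

theorem pow_mem_homFun {d : ℕ} {g : ℕ → ℕ → ℚ} (hg : g ∈ homFun d) (n : ℕ) :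
    g ^ n ∈ homFun (n * d) := by
  induction n with
  | zero =>
    convert monomial_mem_homFun (show 0 + 0 = 0 * d by simp) using 1
    funext v w
    simp
  | succ n ih =>
    rw [pow_succ, add_one_mul]
    exact mul_mem_homFun ih hg

/-- Faulhaber's formula has no constant term. This matters: a constant would bring in the word [0],
that is the non-admissible bracket [1]. -/
theorem sum_pow_mem_polyFun {a : ℕ} (ha : 1 ≤ a) (b : ℕ) :
    (fun w : ℕ => ∑ v ∈ Finset.Ico 1 w, (v : ℚ) ^ a * (w : ℚ) ^ b) ∈ polyFun (a + b + 1) := by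
  have h : (fun w : ℕ => ∑ v ∈ Finset.Ico 1 w, (v : ℚ) ^ a * (w : ℚ) ^ b) =
      ∑ i ∈ Finset.range (a + 1), (bernoulli i * ((a + 1).choose i) / (a + 1)) •
        fun w : ℕ => (w : ℚ) ^ (a + 1 - i + b) := by
    funext w
    have h0 : ∑ v ∈ Finset.Ico 1 w, (v : ℚ) ^ a = ∑ v ∈ Finset.range w, (v : ℚ) ^ a := by
      rw [Finset.range_eq_Ico]
      refine Finset.sum_subset (Finset.Ico_subset_Ico_left (Nat.zero_le 1)) fun v h1 h2 => ?_
      rw [Finset.mem_Ico] at h1 h2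
      rw [show v = 0 by omega, Nat.cast_zero, zero_pow (by omega)]
    rw [← Finset.sum_mul, h0, sum_range_pow, Finset.sum_mul, Finset.sum_apply]
    refine Finset.sum_congr rfl fun i _ => ?_
    simp only [Pi.smul_apply, smul_eq_mul, pow_add]
    ring
  rw [h]
  refine Submodule.sum_mem _ fun i hi => Submodule.smul_mem _ _ (pow_mem_polyFun ?_ ?_) <;>
  · rw [Finset.mem_range] at hi
    omega

/-- Degree zero must be excluded, since the constant 1 sums to `w - 1`. For `d ≥ 1` a monomial
without `v` gives `w ^ (b + 1) - w ^ b` with `b ≥ 1`. -/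
theorem sum_mem_polyFun {d : ℕ} (hd : 1 ≤ d) {g : ℕ → ℕ → ℚ} (hg : g ∈ homFun d) :
    (fun w : ℕ => ∑ v ∈ Finset.Ico 1 w, g v w) ∈ polyFun (d + 1) := by
  rw [homFun] at hg
  induction hg using Submodule.span_induction with
  | zero =>
    convert Submodule.zero_mem _ using 1
    funext w
    simp
  | add x y _ _ hx hy =>
    convert add_mem hx hy using 1
    funext w
    simp [Finset.sum_add_distrib]
  | smul c x _ hx =>
    convert Submodule.smul_mem _ c hx using 1
    funext w
    simp [Finset.mul_sum]
  | mem x hx =>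
    obtain ⟨⟨a, b⟩, h1, rfl⟩ := hx
    obtain rfl : a + b = d := h1
    rcases Nat.eq_zero_or_pos a with rfl | ha
    · convert sub_mem (pow_mem_polyFun (i := b + 1) (d := 0 + b + 1) (by omega) (by omega))
        (pow_mem_polyFun (i := b) (d := 0 + b + 1) (by omega) (by omega)) using 1
      funext w
      rcases Nat.eq_zero_or_pos w with rfl | hw
      · simp [show b ≠ 0 by omega]
      · simp only [pow_zero, one_mul, Finset.sum_const, Nat.card_Ico, nsmul_eq_mul,
          Nat.cast_pred hw, Pi.sub_apply]
        ring
    · exact sum_pow_mem_polyFun ha b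

theorem conv_mem_polyFun {d : ℕ} (hd : 1 ≤ d) {p g : ℕ → ℕ → ℚ} (hg : g ∈ homFun d)
    (h : ∀ v w, v < w → p v (w - v) = g v w) : conv p ∈ polyFun (d + 1) := by
  convert sum_mem_polyFun hd hg using 1
  funext w
  exact Finset.sum_congr rfl fun v hv => h v w (Finset.mem_Ico.mp hv).2

theorem series₁_mem_of_mem_polyFun {d : ℕ} {h : ℕ → ℚ} (hh : h ∈ polyFun d) :
    series₁ h ∈ Submodule.span ℚ (wordSeries '' ((fun i => [i]) '' Set.Icc 1 d)) := by
  have h1 := Submodule.mem_map_of_mem (f := series₁) hh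
  rw [polyFun, Submodule.map_span, ← Set.image_comp] at h1
  rw [← Set.image_comp, show wordSeries ∘ (fun i => [i]) =
    series₁ ∘ fun i (w : ℕ) => (w : ℚ) ^ i from funext wordSeries_one]
  exact h1

/-! ### Reduction in length two -/

/-- A relation `∑ fᵢ [c + i, d - i] = series of smaller length` from a symmetric polynomial. -/
theorem exists_relation_two {a b : ℕ} (ha : 1 ≤ a) (hab : a ≤ b) :
    ∃ f : ℕ → ℚ, f 0 = 0 ∧ f 1 ≠ 0 ∧
      ∑ i ∈ Finset.range (b + 2), f i • wordSeries [a - 1 + i, b + 1 - i] ∈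
        Submodule.span ℚ (wordSeries '' ((fun i => [i]) '' Set.Icc 1 (a + b + 1))) := by
  obtain ⟨c, rfl⟩ : ∃ c, a = c + 1 := ⟨a - 1, by omega⟩
  -- The exponents of the symmetric polynomial `(x - y)^(2B) (x y)^c (x + y)^e`, of degree `a + b`;
  -- `e` adjusts the parity, and `a ≤ b` leaves room for `B ≥ 1`.
  obtain ⟨B, e, he, hB, hb⟩ : ∃ B e, (e = 0 ∨ e = 1) ∧ 1 ≤ B ∧ b + 1 = 2 * B + c + e :=
    ⟨(b - c + 1) / 2, (b - c + 1) % 2, by omega, by omega, by omega⟩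
  -- Up to the factor `2 x^c y^(b+1)`, this is the double shuffle combination of that polynomial in
  -- the variable `t = x / y`. Its constant terms cancel, and its linear coefficient is `-(b + 1)`,
  -- so the lowest word that occurs is [a, b] itself.
  let F : Polynomial ℚ := (Polynomial.X - 1) ^ (2 * B) * (Polynomial.X + 1) ^ e -
    (Polynomial.X + 1) ^ c * (2 * Polynomial.X + 1) ^ e
  have hF0 : F.coeff 0 = 0 := by
    rw [Polynomial.coeff_zero_eq_eval_zero]
    simp [F]
  have hF1 : F.coeff 1 = -((b : ℚ) + 1) := by
    have h1 : F.coeff 1 = F.derivative.eval 0 := by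
      rw [← Polynomial.coeff_zero_eq_eval_zero, Polynomial.coeff_derivative]
      simp
    have h2 : ((-1 : ℚ)) ^ (2 * B - 1) = -1 := Odd.neg_one_pow ⟨B - 1, by omega⟩
    have h3 : (b : ℚ) + 1 = 2 * B + c + e := by exact_mod_cast hb
    rw [h1, h3]
    simp [F, Polynomial.derivative_pow, h2]
    ring
  have hdeg : F.natDegree < b + 2 := by
    refine Nat.lt_succ_of_le ((Polynomial.natDegree_sub_le _ _).trans (max_le ?_ ?_)) <;>
    · compute_degree
      omega
  let p : ℕ → ℕ → ℚ := fun x y => (((x : ℚ) - y) ^ 2) ^ B * ((x : ℚ) * y) ^ c * ((x : ℚ) + y) ^ e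
  have hp : ∀ x, p x x = 0 := fun x => by simp [p, show B ≠ 0 by omega]
  have hrel := series₂_sub_of_diag_eq_zero hp
  have hcong : series₂ (fun x y => p x y + p y x - p (x + y) x - p x (x + y)) =
      (2 : ℚ) • ∑ i ∈ Finset.range (b + 2), F.coeff i • wordSeries [c + i, b + 1 - i] := by
    simp only [wordSeries_two, ← map_smul, ← map_sum]
    refine series₂_congr fun x y _ hy => ?_
    have hy' : (y : ℚ) ≠ 0 := by positivity
    obtain ⟨t, ht⟩ : ∃ t : ℚ, (x : ℚ) = y * t := ⟨x / y, by field_simp⟩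
    have h1 : (y : ℚ) ^ (b + 1) * F.eval t =
        ∑ i ∈ Finset.range (b + 2), F.coeff i * ((x : ℚ) ^ i * (y : ℚ) ^ (b + 1 - i)) := by
      rw [Polynomial.eval_eq_sum_range' hdeg, Finset.mul_sum]
      refine Finset.sum_congr rfl fun i hi => ?_
      rw [ht, mul_pow]
      have : (y : ℚ) ^ (b + 1) = (y : ℚ) ^ i * (y : ℚ) ^ (b + 1 - i) := by
        rw [← pow_add, Nat.add_sub_cancel' (Nat.lt_succ_iff.mp (Finset.mem_range.mp hi))]
      rw [this]
      ring
    have h2 : (y : ℚ) ^ (b + 1) * F.eval t = (((x : ℚ) - y) ^ 2) ^ B * (y : ℚ) ^ c *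
        ((x : ℚ) + y) ^ e - ((y : ℚ) ^ 2) ^ B * ((x : ℚ) + y) ^ c * (2 * (x : ℚ) + y) ^ e := by
      rw [ht, show (y : ℚ) * t - y = y * (t - 1) by ring, show (y : ℚ) * t + y = y * (t + 1) by ring,
        show 2 * ((y : ℚ) * t) + y = y * (2 * t + 1) by ring, hb]
      simp only [F, Polynomial.eval_sub, Polynomial.eval_mul, Polynomial.eval_pow,
        Polynomial.eval_add, Polynomial.eval_X, Polynomial.eval_one, Polynomial.eval_ofNat,
        mul_pow, pow_add, pow_mul]
      ring
    have h3 : ((2 : ℚ) • ∑ i ∈ Finset.range (b + 2),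
        F.coeff i • fun x y : ℕ => (x : ℚ) ^ (c + i) * (y : ℚ) ^ (b + 1 - i)) x y =
        2 * ((x : ℚ) ^ c * ((y : ℚ) ^ (b + 1) * F.eval t)) := by
      rw [h1]
      simp only [Pi.smul_apply, Finset.sum_apply, smul_eq_mul, Finset.mul_sum, pow_add]
      refine Finset.sum_congr rfl fun i _ => ?_
      ring
    rw [h3, h2]
    simp only [p, Nat.cast_add]
    rw [show ((y : ℚ) - x) ^ 2 = ((x : ℚ) - y) ^ 2 by ring,
      show ((x : ℚ) + y - x) ^ 2 = (y : ℚ) ^ 2 by ring,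
      show ((x : ℚ) - (x + y)) ^ 2 = (y : ℚ) ^ 2 by ring,
      show ((x : ℚ) + (x + y)) = 2 * x + y by ring, show ((x : ℚ) + y + x) = 2 * x + y by ring,
      show (y : ℚ) + x = x + y by ring]
    simp only [mul_pow]
    ring
  refine ⟨F.coeff, hF0, by rw [hF1]; exact neg_ne_zero.mpr (by positivity), ?_⟩
  rw [hcong] at hrel
  -- On `x = v`, `y = w - v` the polynomial is `(2v - w)^(2B) (v (w - v))^c w^e`, homogeneous of
  -- degree `a + b`.
  have hconv : conv p ∈ polyFun (c + 1 + b + 1) := by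
    have h1 : (fun v w : ℕ => 2 * (v : ℚ) - w) ∈ homFun 1 := by
      convert sub_mem (Submodule.smul_mem _ (2 : ℚ) (monomial_mem_homFun (add_zero 1)))
        (monomial_mem_homFun (zero_add 1)) using 1
      funext v w
      simp
    have h2 : (fun v w : ℕ => (v : ℚ) * ((w : ℚ) - v)) ∈ homFun 2 := by
      convert sub_mem (monomial_mem_homFun (show 1 + 1 = 2 from rfl))
        (monomial_mem_homFun (show 2 + 0 = 2 from rfl)) using 1
      funext v w
      simp
      ring
    have h3 : (fun _ w : ℕ => (w : ℚ)) ∈ homFun 1 := by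
      convert monomial_mem_homFun (zero_add 1) using 1
      funext v w
      simp
    have h4 := mul_mem_homFun (mul_mem_homFun (pow_mem_homFun (pow_mem_homFun h1 2) B)
      (pow_mem_homFun h2 c)) (pow_mem_homFun h3 e)
    have h5 := conv_mem_polyFun (p := p) (by omega) h4 fun v w hvw => by
      simp only [p, Pi.mul_apply, Pi.pow_apply, Nat.cast_sub hvw.le]
      rw [show (v : ℚ) - (w - v) = 2 * v - w by ring, show (v : ℚ) + (w - v) = w by ring]
    rwa [show B * (2 * 1) + c * 2 + e * 1 + 1 = c + 1 + b + 1 by omega] at h5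
  have h6 := Submodule.smul_mem _ (-2⁻¹ : ℚ) (series₁_mem_of_mem_polyFun hconv)
  rw [← neg_smul_neg, ← hrel, neg_neg, smul_smul, inv_mul_cancel₀ two_ne_zero, one_smul] at h6
  simpa using h6

/-! ### Relations in length three -/

/-- The closed forms of the sums of the powers 0 to 3; the positivity of `w` is needed for the count
`w - 1`. -/
theorem conv_eq_of_cubic {p : ℕ → ℕ → ℚ} {w : ℕ} (hw : 0 < w) (c₀ c₁ c₂ c₃ : ℚ)
    (h : ∀ v, v < w → p v (w - v) = c₀ + c₁ * v + c₂ * (v : ℚ) ^ 2 + c₃ * (v : ℚ) ^ 3) :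
    conv p w = c₀ * (w - 1) + c₁ * (w * (w - 1) / 2) +
      c₂ * (w * (w - 1) * (2 * w - 1) / 6) + c₃ * (w * (w - 1) / 2) ^ 2 := by
  have h1 : conv p w = ∑ v ∈ Finset.Ico 1 w,
      (c₀ + c₁ * v + c₂ * (v : ℚ) ^ 2 + c₃ * (v : ℚ) ^ 3) :=
    Finset.sum_congr rfl fun v hv => h v (Finset.mem_Ico.mp hv).2
  rw [h1]
  clear h1 h
  induction w, hw using Nat.le_induction with
  | base => simp
  | succ w hw ih =>
    rw [Finset.sum_Ico_succ_top hw, ih]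
    push_cast
    ring

/-- The family of relations in length three, up to weight six. -/
theorem relation_three (α β γ δ : ℚ) :
    series₃ (fun x y z =>
      α * (-(x : ℚ) ^ 3 + x * y ^ 2 + 2 * x * y * z + x ^ 2 * z) +
      β * (2 * x ^ 3 - 2 * x * y ^ 2 - 4 * x * y * z - x ^ 2 * z) +
      γ * (2 * x ^ 2 * z - 6 * x * y * z + x ^ 2 * y + x * y ^ 2) +
      δ * (x ^ 2 - x * y)) =
    series₂ (fun x y =>
      α * ((x : ℚ) * y / 6 + 2 * x * y ^ 2 - x * y ^ 3 / 2 + x ^ 2 / 4 + x ^ 2 * y -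
        5 / 2 * x ^ 2 * y ^ 2 - 3 / 2 * x ^ 3 + 5 / 6 * x ^ 3 * y + x ^ 4 / 4) +
      β * (-2 / 3 * x * y + x * y ^ 2 / 2 - x * y ^ 3 / 6 - x ^ 2 / 3 + x ^ 2 * y ^ 2 / 2 +
        3 / 2 * x ^ 3 - 7 / 6 * x ^ 3 * y - x ^ 4 / 6) +
      γ * (-7 / 6 * x * y + x * y ^ 2 / 2 + 3 / 2 * x ^ 2 * y - x ^ 2 * y ^ 2 / 2 -
        x ^ 3 * y / 3) +
      δ * (-x / 6 + 3 / 2 * x * y - x * y ^ 2 / 2 - x ^ 2 * y + x ^ 3 / 6)) +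
    series₁ (conv fun _ w => (δ + α * w) * ((w : ℚ) ^ 3 - 3 * w ^ 2 + 2 * w) / 6) := by
  -- The first two factors make `f` vanish on the two walls; the linear factor carries the
  -- parameters.
  let f : ℕ → ℕ → ℕ → ℚ := fun v x y =>
    ((v : ℚ) - x) * (v - x - y) * (α * v + β * x + γ * y + δ)
  -- The relation of `f` contains monomials without `x`, whose words are not admissible. They are
  -- exactly those of `r y z`, where `r` is the left side of the length-two relation of `p` below.
  let r : ℕ → ℕ → ℚ := fun x y => δ * ((x : ℚ) ^ 2 - 2 * x * y) +
    α * ((x : ℚ) ^ 3 - x ^ 2 * y - 3 * x * y ^ 2)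
  let p : ℕ → ℕ → ℚ := fun x y => ((x : ℚ) - y) ^ 2 * (δ + α * (x + y)) / 2
  let c : ℕ → ℚ := fun w => (δ + α * w) * ((w : ℚ) ^ 3 - 3 * w ^ 2 + 2 * w) / 6
  have hf := series₃_sub_of_diag_eq_zero (f := f) (fun x y => by simp [f])
    (fun x y => by simp [f])
  have hr : series₂ r + series₁ c = 0 := by
    have h1 := series₂_sub_of_diag_eq_zero (p := p) (fun x => by simp [p])
    have h2 : series₁ (conv p) = series₁ c := series₁_congr fun w hw => by
      rw [conv_eq_of_cubic hw ((w : ℚ) ^ 2 * (δ + α * w) / 2) (-2 * w * (δ + α * w))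
        (2 * (δ + α * w)) 0 fun v hv => ?_]
      · simp only [c]
        ring
      · simp only [p, Nat.cast_sub hv.le]
        ring
    rw [h2] at h1
    rw [eq_neg_iff_add_eq_zero] at h1
    rw [← h1]
    congr 2
    funext x y
    simp only [r, p, Nat.cast_add]
    ring
  -- The length-two relation multiplied by the series of the word [0] and expanded by the stuffle
  -- product; subtracting it removes the non-admissible words.
  have hm : series₃ (fun x y z => r y z + r x z + r x y) +
      series₂ (fun x y => conv (fun _ v' => r v' y) x + conv (fun _ v' => r x v') y) +
      (series₂ (fun x y => c y + c x) + series₁ (conv fun _ w => c w)) = 0 := by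
    have h1 := series₁_mul_series₂ (fun _ => 1) r
    have h2 := series₁_mul_series₁ (fun _ => 1) c
    simp only [one_mul] at h1 h2
    rw [← h1, ← h2, ← mul_add, hr, mul_zero]
  have h3 : series₃ (fun x y z =>
      α * (-(x : ℚ) ^ 3 + x * y ^ 2 + 2 * x * y * z + x ^ 2 * z) +
      β * (2 * x ^ 3 - 2 * x * y ^ 2 - 4 * x * y * z - x ^ 2 * z) +
      γ * (2 * x ^ 2 * z - 6 * x * y * z + x ^ 2 * y + x * y ^ 2) +
      δ * (x ^ 2 - x * y)) = series₃ (fun x y z => f x y z + f y x z + f z x y -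
        (f (x + y + z) x y + f (x + y) x (y + z) + f x (x + y) z)) -
      series₃ (fun x y z => r y z + r x z + r x y) := by
    rw [← map_sub]
    congr 1
    funext x y z
    simp only [f, r, Pi.sub_apply, Nat.cast_add]
    ring
  have h4 : series₂ (fun x y =>
      α * ((x : ℚ) * y / 6 + 2 * x * y ^ 2 - x * y ^ 3 / 2 + x ^ 2 / 4 + x ^ 2 * y -
        5 / 2 * x ^ 2 * y ^ 2 - 3 / 2 * x ^ 3 + 5 / 6 * x ^ 3 * y + x ^ 4 / 4) +
      β * (-2 / 3 * x * y + x * y ^ 2 / 2 - x * y ^ 3 / 6 - x ^ 2 / 3 + x ^ 2 * y ^ 2 / 2 +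
        3 / 2 * x ^ 3 - 7 / 6 * x ^ 3 * y - x ^ 4 / 6) +
      γ * (-7 / 6 * x * y + x * y ^ 2 / 2 + 3 / 2 * x ^ 2 * y - x ^ 2 * y ^ 2 / 2 -
        x ^ 3 * y / 3) +
      δ * (-x / 6 + 3 / 2 * x * y - x * y ^ 2 / 2 - x ^ 2 * y + x ^ 3 / 6)) =
      series₂ (fun x y => conv (fun _ v' => r v' y) x + conv (fun _ v' => r x v') y) +
      series₂ (fun x y => c y + c x) -
      series₂ (fun x y => conv (fun v v' => f v v' y) x + conv (fun v v' => f v x v') y) := by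
    rw [← map_add, ← map_sub]
    refine series₂_congr fun x y hx hy => ?_
    have e1 := conv_eq_of_cubic (p := fun _ v' => r v' y) hx
      (δ * ((x : ℚ) ^ 2 - 2 * x * y) + α * ((x : ℚ) ^ 3 - x ^ 2 * y - 3 * x * y ^ 2))
      (δ * (-2 * x + 2 * y) + α * (-3 * (x : ℚ) ^ 2 + 2 * x * y + 3 * y ^ 2))
      (δ + α * (3 * x - y)) (-α) fun v hv => by
        simp only [r, Nat.cast_sub hv.le]
        ring
    have e2 := conv_eq_of_cubic (p := fun _ v' => r x v') hy
      (δ * ((x : ℚ) ^ 2 - 2 * x * y) + α * ((x : ℚ) ^ 3 - x ^ 2 * y - 3 * x * y ^ 2))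
      (δ * (2 * x) + α * ((x : ℚ) ^ 2 + 6 * x * y)) (-3 * α * x) 0 fun v hv => by
        simp only [r, Nat.cast_sub hv.le]
        ring
    have e3 := conv_eq_of_cubic (p := fun v v' => f v v' y) hx
      ((x : ℚ) * (x + y) * (β * x + γ * y + δ))
      (x * (x + y) * (α - β) - (4 * x + 2 * y) * (β * x + γ * y + δ))
      (4 * (β * x + γ * y + δ) - (4 * x + 2 * y) * (α - β)) (4 * (α - β)) fun v hv => by
        simp only [f, Nat.cast_sub hv.le]
        ring
    have e4 := conv_eq_of_cubic (p := fun v v' => f v x v') hy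
      ((x : ℚ) * (x + y) * (β * x + γ * y + δ))
      (x * (x + y) * (α - γ) - (3 * x + y) * (β * x + γ * y + δ))
      (2 * (β * x + γ * y + δ) - (3 * x + y) * (α - γ)) (2 * (α - γ)) fun v hv => by
        simp only [f, Nat.cast_sub hv.le]
        ring
    simp only [Pi.sub_apply, Pi.add_apply, e1, e2, e3, e4, c]
    ring
  have h5 : series₁ (conv fun _ w => (δ + α * w) * ((w : ℚ) ^ 3 - 3 * w ^ 2 + 2 * w) / 6) =
      series₁ (conv fun _ w => c w) := rfl
  rw [h3, h4, hf, h5]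
  linear_combination -hm

/-! ### Upper bounds -/

/-- Whether a word remains after the reductions in length two and three. -/
def isReducedWord : List ℕ → Bool
  | [a, b] => b < a
  | [a, b, c] => [a, b, c] ∉ [[2, 0, 0], [3, 0, 0], [2, 0, 1], [2, 1, 0]]
  | _ => true

/-- The span of the reduced admissible words. -/
noncomputable def reducedSpan (k l : ℕ) : Submodule ℚ ℚ⟦X⟧ :=
  Submodule.span ℚ (wordSeries '' {r ∈ admissibleWords k l | isReducedWord r = true})

theorem mem_reducedSpan {k l : ℕ} {r : List ℕ} (h : r ∈ admissibleWords k l)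
    (hr : isReducedWord r = true) : wordSeries r ∈ reducedSpan k l :=
  Submodule.subset_span ⟨r, ⟨h, hr⟩, rfl⟩

theorem mem_admissibleWords_cons {k l a : ℕ} {r : List ℕ} : a :: r ∈ admissibleWords k l ↔
    r.length + 1 ≤ l ∧ a + r.sum + r.length + 1 ≤ k ∧ 0 < a := by
  simp [admissibleWords, Set.mem_ofPred_eq, add_assoc]

theorem series₁_mem_reducedSpan {k l d : ℕ} (hl : 1 ≤ l) (hd : d + 1 ≤ k) {h : ℕ → ℚ}
    (hh : h ∈ polyFun d) : series₁ h ∈ reducedSpan k l := by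
  refine Submodule.span_le.mpr ?_ (series₁_mem_of_mem_polyFun hh)
  rintro _ ⟨_, ⟨i, hi, rfl⟩, rfl⟩
  refine mem_reducedSpan (mem_admissibleWords_cons.mpr ?_) rfl
  have := hi.1
  have := hi.2
  simp
  omega

/-- The relation for [a, b] involves otherwise only words of length two with larger first and
smaller second exponent, so repeated use ends at `b < a`. -/
theorem wordSeries_two_mem_reducedSpan {k l : ℕ} (hl : 2 ≤ l) {a b : ℕ} (ha : 1 ≤ a)
    (hk : a + b + 2 ≤ k) : wordSeries [a, b] ∈ reducedSpan k l := by
  induction hn : b + 1 - a using Nat.strong_induction_on generalizing a b with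
  | _ n ih =>
    rcases Nat.lt_or_ge b a with hab | hab
    · refine mem_reducedSpan (mem_admissibleWords_cons.mpr ?_) (decide_eq_true hab)
      simp
      omega
    · obtain ⟨f, hf0, hf1, hf⟩ := exists_relation_two ha hab
      rw [Finset.sum_range_succ', Finset.sum_range_succ', hf0, zero_smul, add_zero, zero_add,
        Nat.sub_add_cancel ha, Nat.add_sub_cancel] at hf
      have h1 : ∑ i ∈ Finset.range b,
          f (i + 1 + 1) • wordSeries [a - 1 + (i + 1 + 1), b + 1 - (i + 1 + 1)] ∈
          reducedSpan k l := by
        refine Submodule.sum_mem _ fun i hi => Submodule.smul_mem _ _ ?_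
        rw [Finset.mem_range] at hi
        exact ih _ (by omega) (by omega) (by omega) rfl
      have h2 := Submodule.span_le.mpr (fun _ hx => by
        obtain ⟨_, ⟨i, hi, rfl⟩, rfl⟩ := hx
        have := hi.1
        have := hi.2
        refine mem_reducedSpan (k := k) (l := l) (mem_admissibleWords_cons.mpr ?_) rfl
        simp
        omega) hf
      have h3 := (Submodule.add_mem_iff_right _ h1).mp h2
      exact (Submodule.smul_mem_iff _ hf1).mp h3

theorem series₂_mem_reducedSpan {k l : ℕ} (hl : 2 ≤ l) (L : List (ℚ × ℕ × ℕ))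
    (hL : ∀ t ∈ L, 1 ≤ t.2.1 ∧ t.2.1 + t.2.2 + 2 ≤ k) :
    series₂ (fun x y => (L.map fun t => t.1 * ((x : ℚ) ^ t.2.1 * (y : ℚ) ^ t.2.2)).sum) ∈
      reducedSpan k l := by
  induction L with
  | nil =>
    convert Submodule.zero_mem _
    exact map_zero series₂
  | cons t L ih =>
    have h1 := ih fun s hs => hL s (List.mem_cons_of_mem _ hs)
    have h2 := hL t List.mem_cons_self
    have h3 := Submodule.smul_mem _ t.1 (wordSeries_two_mem_reducedSpan hl h2.1 h2.2)
    convert add_mem h3 h1 using 1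
    rw [wordSeries_two, ← map_smul, ← map_add]
    rfl

theorem conv_pow_mem_polyFun {i d : ℕ} (hi : 1 ≤ i) (hd : i + 1 ≤ d) :
    (conv fun _ w => (w : ℚ) ^ i) ∈ polyFun d := by
  have h1 : (fun v w : ℕ => (w : ℚ) - v) ∈ homFun 1 := by
    convert sub_mem (monomial_mem_homFun (zero_add 1)) (monomial_mem_homFun (add_zero 1)) using 1
    funext v w
    simp
  have h2 := conv_mem_polyFun (p := fun _ w => (w : ℚ) ^ i) (by omega) (pow_mem_homFun h1 i)
    fun v w hvw => by simp only [Pi.pow_apply, Nat.cast_sub hvw.le]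
  rw [mul_one] at h2
  exact Submodule.span_mono (Set.image_mono (Set.Icc_subset_Icc_right hd)) h2

/-- The degree is at most 4 for `α = 0` and at most 5 in general, which lets the same family serve
weight five (with `α = 0`) and weight six. -/
theorem conv_cubic_mem_polyFun {δ α : ℚ} {d : ℕ} (hd : 4 ≤ d) (h : α = 0 ∨ 5 ≤ d) :
    (conv fun _ w => (δ + α * w) * ((w : ℚ) ^ 3 - 3 * w ^ 2 + 2 * w) / 6) ∈ polyFun d := by
  have h1 : (conv fun _ w => (δ + α * w) * ((w : ℚ) ^ 3 - 3 * w ^ 2 + 2 * w) / 6) =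
      α • ((1 / 6 : ℚ) • conv fun _ w => (w : ℚ) ^ 4) +
      ((δ - 3 * α) / 6) • (conv fun _ w => (w : ℚ) ^ 3) +
      ((2 * α - 3 * δ) / 6) • (conv fun _ w => (w : ℚ) ^ 2) +
      (δ / 3) • (conv fun _ w => (w : ℚ) ^ 1) := by
    funext w
    simp only [conv, Pi.add_apply, Pi.smul_apply, smul_eq_mul, Finset.mul_sum,
      ← Finset.sum_add_distrib]
    refine Finset.sum_congr rfl fun v _ => ?_
    ring
  rw [h1]
  refine add_mem (add_mem (add_mem ?_ ?_) ?_) ?_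
  · rcases h with rfl | h
    · rw [zero_smul]
      exact Submodule.zero_mem _
    · exact Submodule.smul_mem _ _ (Submodule.smul_mem _ _
        (conv_pow_mem_polyFun (by norm_num) (by omega)))
  all_goals exact Submodule.smul_mem _ _ (conv_pow_mem_polyFun (by norm_num) (by omega))

/-- The constant linear factor, `δ = 1`. Every length-two term of the right side contains `x`, so it
is admissible and already reducible. -/
theorem relation_weight_five {k l : ℕ} (hk : 5 ≤ k) (hl : 2 ≤ l) :
    wordSeries [2, 0, 0] - wordSeries [1, 1, 0] ∈ reducedSpan k l := by
  have h := relation_three 0 0 0 1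
  have h1 : wordSeries [2, 0, 0] - wordSeries [1, 1, 0] = series₃ fun x y z =>
      0 * (-(x : ℚ) ^ 3 + x * y ^ 2 + 2 * x * y * z + x ^ 2 * z) +
      0 * (2 * x ^ 3 - 2 * x * y ^ 2 - 4 * x * y * z - x ^ 2 * z) +
      0 * (2 * x ^ 2 * z - 6 * x * y * z + x ^ 2 * y + x * y ^ 2) + 1 * (x ^ 2 - x * y) := by
    rw [wordSeries_three, wordSeries_three, ← map_sub]
    congr 1
    funext x y z
    simp only [Pi.sub_apply]
    ring
  rw [h1, h]
  refine add_mem ?_ (series₁_mem_reducedSpan (by omega) (show 4 + 1 ≤ k by omega)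
    (conv_cubic_mem_polyFun le_rfl (Or.inl rfl)))
  convert series₂_mem_reducedSpan hl [(-1 / 6, 1, 0), (3 / 2, 1, 1), (-1 / 2, 1, 2), (-1, 2, 1),
    (1 / 6, 3, 0)] (fun t ht => ?_) using 2
  · funext x y
    simp only [List.map_cons, List.map_nil, List.sum_cons, List.sum_nil]
    ring
  · simp only [List.mem_cons, List.not_mem_nil, or_false] at ht
    rcases ht with rfl | rfl | rfl | rfl | rfl <;> dsimp only <;> omega

/-- The homogeneous linear factors, `δ = 0`; collecting monomials in length three gives the five
coefficients. -/
theorem relation_weight_six {k l : ℕ} (hk : 6 ≤ k) (hl : 2 ≤ l) (α β γ : ℚ) :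
    (2 * β - α) • wordSeries [3, 0, 0] + (α - 2 * β + γ) • wordSeries [1, 2, 0] +
      (2 * α - 4 * β - 6 * γ) • wordSeries [1, 1, 1] +
      (α - β + 2 * γ) • wordSeries [2, 0, 1] + γ • wordSeries [2, 1, 0] ∈ reducedSpan k l := by
  have h := relation_three α β γ 0
  have h1 : (2 * β - α) • wordSeries [3, 0, 0] + (α - 2 * β + γ) • wordSeries [1, 2, 0] +
      (2 * α - 4 * β - 6 * γ) • wordSeries [1, 1, 1] +
      (α - β + 2 * γ) • wordSeries [2, 0, 1] + γ • wordSeries [2, 1, 0] = series₃ fun x y z =>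
      α * (-(x : ℚ) ^ 3 + x * y ^ 2 + 2 * x * y * z + x ^ 2 * z) +
      β * (2 * x ^ 3 - 2 * x * y ^ 2 - 4 * x * y * z - x ^ 2 * z) +
      γ * (2 * x ^ 2 * z - 6 * x * y * z + x ^ 2 * y + x * y ^ 2) + 0 * (x ^ 2 - x * y) := by
    simp only [wordSeries_three, ← map_smul, ← map_add]
    congr 1
    funext x y z
    simp only [Pi.add_apply, Pi.smul_apply, smul_eq_mul]
    ring
  rw [h1, h]
  refine add_mem ?_ (series₁_mem_reducedSpan (by omega) (show 5 + 1 ≤ k by omega)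
    (conv_cubic_mem_polyFun (by norm_num) (Or.inr le_rfl)))
  convert series₂_mem_reducedSpan hl [(α / 6 - 2 / 3 * β - 7 / 6 * γ, 1, 1),
    (2 * α + β / 2 + γ / 2, 1, 2), (-α / 2 - β / 6, 1, 3), (α / 4 - β / 3, 2, 0),
    (α + 3 / 2 * γ, 2, 1), (-5 / 2 * α + β / 2 - γ / 2, 2, 2), (-3 / 2 * α + 3 / 2 * β, 3, 0),
    (5 / 6 * α - 7 / 6 * β - γ / 3, 3, 1), (α / 4 - β / 6, 4, 0)] (fun t ht => ?_) using 2
  · funext x y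
    simp only [List.map_cons, List.map_nil, List.sum_cons, List.sum_nil]
    ring
  · simp only [List.mem_cons, List.not_mem_nil, or_false] at ht
    rcases ht with rfl | rfl | rfl | rfl | rfl | rfl | rfl | rfl | rfl <;> dsimp only <;> omega

theorem wordSeries_three_mem_reducedSpan {k l : ℕ} (hl : 3 ≤ l) {r : List ℕ}
    (hr : r ∈ [[2, 0, 0], [3, 0, 0], [2, 0, 1], [2, 1, 0]])
    (hk : r.sum + 3 ≤ k) : wordSeries r ∈ reducedSpan k l := by
  have hred : ∀ b c, 4 + b + c ≤ k → wordSeries [1, b, c] ∈ reducedSpan k l := fun b c h => by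
    refine mem_reducedSpan (mem_admissibleWords_cons.mpr ?_) (by simp [isReducedWord])
    simp
    omega
  have h201 : 6 ≤ k → wordSeries [2, 0, 1] ∈ reducedSpan k l := fun h6 => by
    -- With these parameters all coefficients but that of [2, 0, 1] vanish.
    have := relation_weight_six h6 (by omega : 2 ≤ l) 2 1 0
    norm_num at this
    exact this
  simp only [List.mem_cons, List.not_mem_nil, or_false] at hr
  rcases hr with rfl | rfl | rfl | rfl <;> simp at hk
  · have h := add_mem (relation_weight_five (by omega : 5 ≤ k) (by omega : 2 ≤ l))
      (hred 1 0 (by omega))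
    rwa [sub_add_cancel] at h
  · have h := relation_weight_six (by omega : 6 ≤ k) (by omega : 2 ≤ l) 1 0 0
    have h2 := add_mem (add_mem (hred 2 0 (by omega))
      (Submodule.smul_mem _ (2 : ℚ) (hred 1 1 (by omega)))) (h201 (by omega))
    convert sub_mem h2 h using 1
    module
  · exact h201 (by omega)
  · have h := relation_weight_six (by omega : 6 ≤ k) (by omega : 2 ≤ l) 0 0 1
    have h2 := add_mem (sub_mem (hred 2 0 (by omega))
      (Submodule.smul_mem _ (6 : ℚ) (hred 1 1 (by omega))))
      (Submodule.smul_mem _ (2 : ℚ) (h201 (by omega)))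
    convert sub_mem h h2 using 1
    module

theorem filMDA_le_reducedSpan (k l : ℕ) : filMDA k l ≤ reducedSpan k l := by
  rw [filMDA_eq_span]
  refine Submodule.span_le.mpr ?_
  rintro _ ⟨r, hr, rfl⟩
  by_cases h : isReducedWord r = true
  · exact mem_reducedSpan hr h
  · match r, hr, h with
    | [], _, h => simp [isReducedWord] at h
    | [_], _, h => simp [isReducedWord] at h
    | [a, b], hr, _ =>
      rw [mem_admissibleWords_cons] at hr
      simp at hr
      exact wordSeries_two_mem_reducedSpan (by omega) (by omega) (by omega)
    | [a, b, c], hr, h =>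
      rw [mem_admissibleWords_cons] at hr
      simp at hr
      refine wordSeries_three_mem_reducedSpan (by omega) ?_ (by simp; omega)
      by_contra hc
      exact h (decide_eq_true hc)
    | _ :: _ :: _ :: _ :: _, _, h => simp [isReducedWord] at h

/-- All words of length `n` with weight at most `k`. -/
def wordsOfLength : ℕ → ℕ → List (List ℕ)
  | 0, _ => [[]]
  | n + 1, k => (List.range k).flatMap fun a => (wordsOfLength n (k - 1 - a)).map (a :: ·)

theorem mem_wordsOfLength {n k : ℕ} {r : List ℕ} (h : r.length = n) (hk : r.sum + n ≤ k) :
    r ∈ wordsOfLength n k := by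
  induction n generalizing k r with
  | zero => simpa [wordsOfLength] using h
  | succ n ih =>
    cases r with
    | nil => simp at h
    | cons a r =>
      simp only [List.length_cons, Nat.add_right_cancel_iff, List.sum_cons] at h hk
      exact List.mem_flatMap.mpr ⟨a, List.mem_range.mpr (by omega),
        List.mem_map_of_mem (ih h (by omega))⟩

/-- The reduced admissible words of weight at most `k` and length at most `l`. -/
def reducedWords (k l : ℕ) : List (List ℕ) :=
  (List.range (l + 1)).flatMap fun n =>
    (wordsOfLength n k).filter fun r => isReducedWord r && r.head? ≠ some 0

theorem finrank_filMDA_le_length (k l : ℕ) :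
    Module.finrank ℚ (filMDA k l) ≤ (reducedWords k l).length := by
  classical
  refine (finrank_filMDA_le_card (reducedWords k l).toFinset fun r hr => ?_).trans
    (List.toFinset_card_le _)
  have h1 := filMDA_le_reducedSpan k l (wordSeries_mem_filMDA hr)
  refine Submodule.span_mono (Set.image_mono ?_) h1
  rintro r ⟨⟨h1, h2, h3⟩, h4⟩
  rw [List.coe_toFinset]
  refine List.mem_flatMap.mpr ⟨r.length, List.mem_range.mpr (by omega),
    List.mem_filter.mpr ⟨mem_wordsOfLength rfl h2, ?_⟩⟩
  simp only [h4, Bool.true_and, decide_eq_true_eq]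
  intro h
  exact absurd (h3 0 h) (lt_irrefl 0)

instance decidableIsExactEntry (k l : ℕ) : Decidable (IsExactEntry k l) :=
  inferInstanceAs (Decidable (_ ∨ _ ∨ _))

/-- Whether the numbers of reduced words agree with the exact entries of a row of the table. -/
def exactRowSuffices (k : ℕ) : Bool :=
  (dimTable k).zipIdx.all fun d =>
    !decide (IsExactEntry k d.2) || decide ((reducedWords k d.2).length ≤ d.1)

set_option maxRecDepth 100000 in
theorem exactRowSuffices_all : (List.range 16).all exactRowSuffices = true := by
  decide +kernel

theorem finrank_filMDA_le {k l d : ℕ} (h : (dimTable k)[l]? = some d) (hex : IsExactEntry k l) :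
    Module.finrank ℚ (filMDA k l) ≤ d := by
  rcases Nat.lt_or_ge k 16 with hk | hk
  · have h1 := List.all_eq_true.mp exactRowSuffices_all k (List.mem_range.mpr hk)
    have h2 := List.all_eq_true.mp h1 (d, l) (by
      rw [List.mk_mem_zipIdx_iff_getElem?]
      exact h)
    simp only [hex, decide_true, Bool.not_true, Bool.false_or, decide_eq_true_eq] at h2
    exact (finrank_filMDA_le_length k l).trans h2
  · rw [dimTable_eq_nil hk] at h
    simp at h

theorem mainTheorem8 (k l d : ℕ) (h : (dimTable k)[l]? = some d) :
    d ≤ Module.finrank ℚ (filMDA k l) ∧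
      (IsExactEntry k l → Module.finrank ℚ (filMDA k l) = d) := by
  exact ⟨le_finrank_filMDA h, fun hex =>
    le_antisymm (finrank_filMDA_le h hex) (le_finrank_filMDA h)⟩
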